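/- We work over $\mathbb{C}$; dimensions of linear subspaces of projective spaces are projective. For a smooth subvariety $X\subset\mathbb{P}^N$ and $x\in X$, the $k$-th osculating space $\mathrm{Osc}^k_x(X)\subseteq\mathbb{P}^N$ is the linear space spanned by all partial derivatives of order at most $k$ at $x$ of the homogeneous coordinates along $X$, with respect to local parameters of $X$ at $x$, and $\Phi_k(X)$ is the set of points $x\in X$ at which $\dim\mathrm{Osc}^k_x(X)$ is not maximal. Let $C$ be a smooth connected projective curve and let $\varphi_1,\varphi_2:C\to\mathbb{P}^N$ be embeddings such that the linear spans of $C_1=\varphi_1(C)$ and $C_2=\varphi_2(C)$ are disjoint and together span $\mathbb{P}^N$. The surface $X=\bigcup_{p\in C}\langle\varphi_1(p),\varphi_2(p)\rangle$ is called the decomposable surface scroll generated by $C_1$ and $C_2$. Let $m\ge 2$. The semibalanced rational normal scroll in $\mathbb{P}^{2m+2}$ is (up to projective equivalence) the decomposable scroll generated by the rational normal curves $\nu_m(\mathbb{P}^1)\subset\mathbb{P}^m$ and $\nu_{m+1}(\mathbb{P}^1)\subset\mathbb{P}^{m+1}$; its degree is $2m+1$. For $d\ge m+2$, a scroll of type $(m,d)$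 is (up to projective equivalence) a decomposable scroll in $\mathbb{P}^{2m+2}$ generated by $\nu_m(\mathbb{P}^1)\subset\mathbb{P}^m$ and $\pi_T(\nu_d(\mathbb{P}^1))\subset\mathbb{P}^{m+1}$ (with $\varphi_1=\nu_m$, $\varphi_2=\pi_T\circ\nu_d$), where $\pi_T:\mathbb{P}^d\dashrightarrow\mathbb{P}^{m+1}$ is the projection from a linear space $T$ of dimension $d-m-2$ that meets no $m$-th osculating space of the rational normal curve $\Gamma=\nu_d(\mathbb{P}^1)$ and is such that $\pi_T|_\Gamma$ is an embedding. **Theorem 3.4.** Let $m\ge 2$. (1) Let $X\subset\mathbb{P}^{2m+2}$ be a decomposable surface scroll with $\Phi_m(X)=\emptyset$. Then either $X$ is the semibalanced rational normal scroll, or $X$ is a scroll of type $(m,d)$ for some $d\ge m+2$. (2) For every $d\ge m+2$ there exist scrolls of type $(m,d)$, and every such scroll $X\subset\mathbb{P}^{2m+2}$ is a counterexample to the even-dimensional part of the Piene–Tai conjecture: $X$ is a smooth non-degenerate projective surface with $\Phi_m(X)=\emptyset$ and $\dim\mathrm{Osc}^k_x(X)\le 2k$ for all $x\in X$ and all $k\ge0$,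 with equality for all $x\in X$ when $k=m=\lfloor\frac{(2m+2)-1}{2}\rfloor$, but $X$ is not projectively equivalent to the semibalanced rational normal scroll. -/

import Mathlib

open Filter Topology
open scoped ContDiff Manifold

noncomputable section

/-! ### Subsets of projective space, their linear spans and osculating spaces

`Projectivization ℂ V` is the projective space of one-dimensional subspaces of `V`; a point `x` has
the underlying line `x.submodule`. -/

section Projective

variable {V : Type*} [NormedAddCommGroup V] [NormedSpace ℂ V]

/-- The affine cone (without its vertex) over a subset of projective space. -/
def affineCone (X : Set (Projectivization ℂ V)) : Set V :=
  {v | ∃ h : v ≠ 0, Projectivization.mk ℂ v h ∈ X}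

/-- The linear span of a subset of projective space, as a vector subspace of `V`. -/
def linearSpan (X : Set (Projectivization ℂ V)) : Submodule ℂ V :=
  ⨆ x ∈ X, x.submodule

/-- Two subsets of projective spaces are projectively equivalent if a linear isomorphism of the
underlying vector spaces carries one onto the other. -/
def ProjectivelyEquivalent {V V' : Type*} [AddCommGroup V] [Module ℂ V]
    [AddCommGroup V'] [Module ℂ V'] (X : Set (Projectivization ℂ V)) (Y : Set (Projectivization ℂ V')) : Prop :=
  ∃ e : V ≃ₗ[ℂ] V', Projectivization.map e.toLinearMap e.injective '' X = Y

/-- A lift `F` of a map to projective space is immersive at `z`: it is holomorphic at `z`,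
`F z ≠ 0`, and the induced map to projective space has injective differential at `z`. -/
def IsImmersiveLiftAt {E : Type*} [NormedAddCommGroup E] [NormedSpace ℂ E]
    (F : E → V) (z : E) : Prop :=
  AnalyticAt ℂ F z ∧
    Function.Injective (fun a : ℂ × E => a.1 • F z + fderiv ℂ F z a.2)

/-- `z ↦ [F z]`, for `z` near `0` in `E`, is a local holomorphic parametrization of `X` (as a complex
submanifold of dimension `dim E` of projective space) with `[F 0] = x`.  The last clause says that
`[F z]`, `z` near `0`, sweeps out a neighbourhood of `x` in `X`; it is expressed on the affine
cone. -/
structure IsLocalParametrization {E : Type*} [NormedAddCommGroup E] [NormedSpace ℂ E]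
    (X : Set (Projectivization ℂ V)) (x : Projectivization ℂ V) (F : E → V) : Prop where
  immersive : IsImmersiveLiftAt F 0
  base : x.submodule = Submodule.span ℂ {F 0}
  locally_onto :
    map (fun a : ℂ × E => a.1 • F a.2) (𝓝 ((1 : ℂ), (0 : E))) = 𝓝[affineCone X] (F 0)

/-- The span of all partial derivatives of order at most `k` of `F` at `z`: the row space of the
matrix of the `k`-jets at `z` of the homogeneous coordinates. -/
def derivativeSpan {E : Type*} [NormedAddCommGroup E] [NormedSpace ℂ E]
    (k : ℕ) (F : E → V) (z : E) : Submodule ℂ V :=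
  Submodule.span ℂ {v | ∃ j ≤ k, ∃ h : Fin j → E, v = iteratedFDeriv ℂ j F z h}

/-- The `k`-th osculating space at `x` to the complex submanifold `X` of projective space, as a vector
subspace of `V` (its projective dimension is one less than its vector space dimension).  `E` is the
model space of `X`: `ℂ` for a curve, `ℂ × ℂ` for a surface.  All local parametrizations of `X`
at `x` have the same span of derivatives of order at most `k`. -/
def osculatingSpace (E : Type*) [NormedAddCommGroup E] [NormedSpace ℂ E]
    (k : ℕ) (X : Set (Projectivization ℂ V)) (x : Projectivization ℂ V) : Submodule ℂ V :=
  ⨆ (F : E → V) (_ : IsLocalParametrization X x F), derivativeSpan k F 0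

/-- The `k`-th inflectional locus: the points of `X` where the rank of the `k`-jet map (the
dimension of the `k`-th osculating space) does not attain its maximum over `X`. -/
def inflectionalLocus (E : Type*) [NormedAddCommGroup E] [NormedSpace ℂ E]
    (k : ℕ) (X : Set (Projectivization ℂ V)) : Set (Projectivization ℂ V) :=
  {x | x ∈ X ∧ ∃ y ∈ X, Module.finrank ℂ (osculatingSpace E k X x) <
    Module.finrank ℂ (osculatingSpace E k X y)}

/-- A smooth projective surface: a closed connected complex submanifold of dimension two of a
projective space (such a subset is algebraic, by Chow's theorem). -/
structure IsSmoothProjectiveSurface (X : Set (Projectivization ℂ V)) : Prop where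
  closed : IsClosed (insert 0 (affineCone X))
  connected : IsConnected (affineCone X)
  smooth : ∀ x ∈ X, ∃ F : ℂ × ℂ → V, IsLocalParametrization X x F

/-- The hypotheses of the Piene-Tai conjecture on a surface in `ℙ^N`: it is smooth, projective and
non-degenerate, all its `k`-th osculating spaces have projective dimension at most `2k`, and
exactly `2k` for `k = ⌊(N-1)/2⌋`.  Here `V` has dimension `N + 1`. -/
structure SatisfiesPieneTaiHypotheses (N : ℕ) (X : Set (Projectivization ℂ V)) : Prop where
  ambient : Module.finrank ℂ V = N + 1
  smooth : IsSmoothProjectiveSurface X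
  nondegenerate : linearSpan X = ⊤
  osculating_le : ∀ x ∈ X, ∀ k : ℕ,
    Module.finrank ℂ (osculatingSpace (ℂ × ℂ) k X x) ≤ 2 * k + 1
  osculating_eq : ∀ x ∈ X,
    Module.finrank ℂ (osculatingSpace (ℂ × ℂ) ((N - 1) / 2) X x) = 2 * ((N - 1) / 2) + 1

end Projective

/-! ### Decomposable surface scrolls -/

section Scrolls

/-- The union of the lines joining the points `P p` and `Q p`, where `p` runs over the parameter
set `ι`; points of projective space are given as lines in `V`. -/
def joinOfCurves {V : Type*} [AddCommGroup V] [Module ℂ V] {ι : Type*}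
    (P Q : ι → Submodule ℂ V) : Set (Projectivization ℂ V) :=
  {x | ∃ p, x.submodule ≤ P p ⊔ Q p}

variable {V : Type*} [NormedAddCommGroup V] [NormedSpace ℂ V]

/-- A holomorphic embedding of a (compact) Riemann surface in projective space: an injective map
that in the chart around each point has an immersive holomorphic lift. -/
structure IsHolomorphicEmbedding {C : Type*} [TopologicalSpace C] [ChartedSpace ℂ C]
    (φ : C → Projectivization ℂ V) : Prop where
  injective : Function.Injective φ
  immersion : ∀ p : C, ∃ F : ℂ → V, IsImmersiveLiftAt F (chartAt ℂ p p) ∧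
    ∀ᶠ z in 𝓝 (chartAt ℂ p p),
      (φ ((chartAt ℂ p).symm z)).submodule = Submodule.span ℂ {F z}

/-- `X` is a decomposable surface scroll over the curve `C`: it is the union of the lines joining
corresponding points of two embeddings of `C`, whose images span complementary linear subspaces of
the ambient projective space. -/
def IsDecomposableSurfaceScroll (C : Type*) [TopologicalSpace C] [ChartedSpace ℂ C]
    (X : Set (Projectivization ℂ V)) : Prop :=
  ∃ φ₁ φ₂ : C → Projectivization ℂ V,
    IsHolomorphicEmbedding φ₁ ∧ IsHolomorphicEmbedding φ₂ ∧
    IsCompl (linearSpan (Set.range φ₁)) (linearSpan (Set.range φ₂)) ∧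
    X = joinOfCurves (fun p => (φ₁ p).submodule) (fun p => (φ₂ p).submodule)

end Scrolls

/-! ### Rational scrolls -/

section Rational

/-- The Veronese map `(s, t) ↦ (s^d, s^(d-1) t, …, t^d)`. -/
def veronese (d : ℕ) (s : ℂ × ℂ) : Fin (d + 1) → ℂ :=
  fun i => s.1 ^ (d - (i : ℕ)) * s.2 ^ (i : ℕ)

/-- The rational normal curve of degree `d` in `ℙ^d`. -/
def rationalNormalCurve (d : ℕ) : Set (Projectivization ℂ (Fin (d + 1) → ℂ)) :=
  {y | ∃ s : ℂ × ℂ, s ≠ 0 ∧ y.submodule = Submodule.span ℂ {veronese d s}}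

/-- The union of the lines joining `[A s : 0]` and `[0 : B s]`, for `s` in `ℂ² ∖ 0`: the scroll
generated by the curves `[s] ↦ [A s]` and `[s] ↦ [B s]`, `[s]` in `ℙ¹`, placed in complementary
linear subspaces (`A` and `B` are given by binary forms). -/
def rationalScroll {V₁ V₂ : Type*} [AddCommGroup V₁] [Module ℂ V₁] [AddCommGroup V₂] [Module ℂ V₂]
    (A : ℂ × ℂ → V₁) (B : ℂ × ℂ → V₂) : Set (Projectivization ℂ (V₁ × V₂)) :=
  joinOfCurves (fun s : {s : ℂ × ℂ // s ≠ 0} => Submodule.span ℂ {(A s, (0 : V₂))})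
    (fun s : {s : ℂ × ℂ // s ≠ 0} => Submodule.span ℂ {((0 : V₁), B s)})

variable {V : Type*} [NormedAddCommGroup V] [NormedSpace ℂ V]

/-- `G`, given by binary forms of one positive degree, induces an embedding of `ℙ¹` in the
projective space of `V₁`: it is everywhere defined, injective and immersive.  (By Euler's formula,
immersivity of `[s] ↦ [G s]` is injectivity of the differential of `G` away from the origin.) -/
structure InducesEmbedding (G : ℂ × ℂ → V) : Prop where
  defined : ∀ s, s ≠ 0 → G s ≠ 0
  injective : ∀ s t, s ≠ 0 → t ≠ 0 → Submodule.span ℂ {G s} = Submodule.span ℂ {G t} →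
    Submodule.span ℂ {s} = Submodule.span ℂ {t}
  immersive : ∀ s, s ≠ 0 → Function.Injective (fderiv ℂ G s)

/-- The semibalanced rational normal scroll in `ℙ^(2m+2)` (of degree `2m+1`), up to projective
equivalence: it is generated by the rational normal curves of degrees `m` and `m + 1`. -/
def IsSemibalancedRationalNormalScroll (m : ℕ) (X : Set (Projectivization ℂ V)) : Prop :=
  ProjectivelyEquivalent X (rationalScroll (veronese m) (veronese (m + 1)))

/-- The scroll in `ℙ^(2m+2)` generated by the rational normal curve of degree `m` and by the
projection to `ℙ^(m+1)` of the rational normal curve `Γ` of degree `d` from a center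
`T = ℙ(ker π)`, of dimension `d - m - 2`, such that the projection embeds `Γ` and `T` meets no
`m`-th osculating space of `Γ`. -/
def IsProjectedRationalScroll (m d : ℕ) (X : Set (Projectivization ℂ V)) : Prop :=
  ∃ π : (Fin (d + 1) → ℂ) →ₗ[ℂ] (Fin (m + 2) → ℂ),
    Function.Surjective π ∧
    InducesEmbedding (fun s => π (veronese d s)) ∧
    (∀ y ∈ rationalNormalCurve d,
      Disjoint (LinearMap.ker π) (osculatingSpace ℂ m (rationalNormalCurve d) y)) ∧
    ProjectivelyEquivalent X (rationalScroll (veronese m) (fun s => π (veronese d s)))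

end Rational

end

open Filter Topology
open scoped ContDiff Manifold

noncomputable section

/-! ### Vanishing orders of analytic functions and derivative spans -/

section VanishingOrder

variable {E : Type*} [NormedAddCommGroup E] [NormedSpace ℂ E]

/-! Osculating spaces are handled dually: a linear form kills all derivatives of order at most `k`
of a lift exactly when its composite with the lift vanishes to order `k + 1`
(`derivativeSpan_le_ker_iff`). Vanishing orders do not see changes of lift or parameter, so any
single local parametrization computes the osculating space. For the ruled lift `F₁(z) + (t₀ + w)
F₂(z)` they give the span of the derivatives of order at most `k` of `F₁ + t₀ F₂` and of order less
than `k` of `F₂` (`derivativeSpan_ruledLift`). On a directrix the dimension is the sum of two jet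
ranks.

Classification. At a general parameter both directrices have maximal jets. Comparing the osculating
dimensions on the two directrices there, an empty inflectional locus forces their spans to have
vector space dimensions `m + 1` and `m + 2`. Comparing with all other parameters shows that the
derivatives of order at most `m` of each directrix are everywhere independent.

The core is that an embedded curve in `ℙ^m` without inflection points, over an arbitrary compact
connected Riemann surface, is a rational normal curve. Its Wronskian never vanishes, which makes a
power of the hyperplane bundle inverse to a power of the canonical bundle. The Wronskian of `2m + 2`
quadrics independent on the curve would then be a nonzero section of a bundle with a negative power;
concretely it yields a holomorphic function that is constant, zero somewhere and nonzero elsewhere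
(`IsCurveLift.exists_quadric_relation`). If an osculating hyperplane met the curve a second time,
`2m + 2` such quadrics could be written down. Hence the quotient of two osculating linear forms is a
function `x` with one simple pole and no other pole. All meromorphic functions are rational in `x`,
so both directrices are given by binary forms in the same coordinate. The osculating hyperplane at
the pole shows that the first directrix has degree `m`. The second is a projected rational normal
curve of some degree `d ≥ m + 1`: for `d = m + 1` the projection is an isomorphism, and for larger
`d` the independence of jets says that the centre misses the `m`-th osculating spaces.

Converse. For a scroll of type `(m, d)` the same jet count gives osculating dimension `2m`
everywhere, in projective terms. It is not semibalanced: osculating spaces of order `m + 1` single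
out the first directrix, and projecting from its span carries the second directrix injectively into
a rational normal curve of degree `m + 1`. Pulled back osculating hyperplanes are then `d`-th powers
of linear forms; these span all forms of degree `d`, so the projection of the curve of degree `d` is
injective and `d = m + 1` (`ScrollData.eq_of_scroll_eq`). Existence uses the curve whose coordinates
are the `d`-th powers of `m + 2` distinct linear forms. -/

theorem isBigO_fderiv_apply {f : E → ℂ} (hf : AnalyticAt ℂ f 0) {k : ℕ}
    (hO : f =O[𝓝 0] fun z => ‖z‖ ^ (k + 1)) (w : E) :
    (fun z => fderiv ℂ f z w) =O[𝓝 0] fun z => ‖z‖ ^ k := by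
  rcases Nat.eq_zero_or_pos k with rfl | hk
  · have hc : ContinuousAt (fun z => fderiv ℂ f z w) 0 :=
      (hf.fderiv.continuousAt).clm_apply continuousAt_const
    simpa using hc.norm.isBoundedUnder_le.isBigO_one ℝ
  obtain ⟨C, hC⟩ := hO.bound
  have hCnn : 0 ≤ |C| := abs_nonneg C
  have han : ∀ᶠ z in 𝓝 (0 : E), AnalyticAt ℂ f z := hf.eventually_analyticAt
  obtain ⟨r, hr, hball⟩ := Metric.eventually_nhds_iff_ball.1 (hC.and han)
  have hM : 0 < 1 + ‖w‖ := by positivity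
  have h0 : fderiv ℂ f 0 w = 0 := by
    have : HasFDerivAt f (0 : E →L[ℂ] ℂ) 0 :=
      Asymptotics.IsBigO.hasFDerivAt (n := k + 1) (by simpa using hO) (by lia)
    rw [this.fderiv]; rfl
  refine Asymptotics.IsBigO.of_bound (|C| * (1 + ‖w‖) ^ (k + 1)) ?_
  filter_upwards [Metric.ball_mem_nhds (0 : E) (div_pos hr hM)] with z hz
  rw [mem_ball_zero_iff, lt_div_iff₀ hM] at hz
  by_cases hz0 : z = 0
  · subst hz0; rw [h0]; simp only [norm_zero]; positivity
  have hzn : 0 < ‖z‖ := norm_pos_iff.2 hz0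
  have hin : ∀ t ∈ Metric.closedBall (0 : ℂ) ‖z‖, ‖z + t • w‖ ≤ ‖z‖ * (1 + ‖w‖) := by
    intro t ht
    rw [mem_closedBall_zero_iff] at ht
    calc ‖z + t • w‖ ≤ ‖z‖ + ‖t‖ * ‖w‖ := (norm_add_le _ _).trans (by rw [norm_smul])
      _ ≤ ‖z‖ * (1 + ‖w‖) := by nlinarith [norm_nonneg w]
  have hdiff : ∀ t ∈ Metric.closedBall (0 : ℂ) ‖z‖,
      HasDerivAt (fun t : ℂ => f (z + t • w)) (fderiv ℂ f (z + t • w) w) t := by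
    intro t ht
    have h1 : HasDerivAt (fun t : ℂ => z + t • w) w t := by
      simpa using ((hasDerivAt_id t).smul_const w).const_add z
    have h2 := (hball (z + t • w) (by
      rw [mem_ball_zero_iff]; exact (hin t ht).trans_lt hz)).2.differentiableAt.hasFDerivAt
    exact h2.comp_hasDerivAt t h1
  -- Cauchy's estimate in the direction `w` on a circle of radius `‖z‖`: the circle stays at
  -- distance comparable to `‖z‖` from the origin, so exactly one power of `‖z‖` is lost.
  have key := Complex.norm_deriv_le_of_forall_mem_sphere_norm_le (c := 0) (R := ‖z‖)
    (C := |C| * (‖z‖ * (1 + ‖w‖)) ^ (k + 1)) (f := fun t : ℂ => f (z + t • w)) hzn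
    (DifferentiableOn.diffContOnCl (by
      rw [closure_ball _ hzn.ne']
      exact fun t ht => (hdiff t ht).differentiableAt.differentiableWithinAt))
    (fun t ht => by
      have htc := Metric.sphere_subset_closedBall ht
      have h3 := (hball (z + t • w) (by
        rw [mem_ball_zero_iff]; exact (hin t htc).trans_lt hz)).1
      refine h3.trans ?_
      rw [norm_pow, norm_norm]
      exact mul_le_mul (le_abs_self C) (pow_le_pow_left₀ (norm_nonneg _) (hin t htc) _)
        (by positivity) hCnn)
  rw [(hdiff 0 (by simp)).deriv] at key
  simp only [zero_smul, add_zero] at key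
  refine key.trans (le_of_eq ?_)
  rw [norm_pow, norm_norm]
  rw [mul_pow]
  field_simp
  ring

theorem iteratedFDeriv_eq_zero_of_isBigO {k : ℕ} : ∀ {f : E → ℂ}, AnalyticAt ℂ f 0 →
    (f =O[𝓝 0] fun z => ‖z‖ ^ (k + 1)) → ∀ j ≤ k, ∀ h : Fin j → E,
    iteratedFDeriv ℂ j f 0 h = 0 := by
  induction k with
  | zero =>
    intro f hf hO j hj h
    obtain rfl : j = 0 := by lia
    have : f 0 = 0 := by
      obtain ⟨C, hC⟩ := hO.bound
      simpa using hC.self_of_nhds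
    simpa using this
  | succ k ih =>
    intro f hf hO j hj h
    rcases j with _ | j
    · have : f 0 = 0 := by
        obtain ⟨C, hC⟩ := hO.bound
        simpa using hC.self_of_nhds
      simpa using this
    · rw [iteratedFDeriv_succ_apply_right]
      have hd : AnalyticAt ℂ (fun y => fderiv ℂ f y) 0 := hf.fderiv
      have hev := (ContinuousLinearMap.apply ℂ ℂ (h (Fin.last j))).iteratedFDeriv_comp_left
        (f := fun y => fderiv ℂ f y) (x := 0) (n := ω) (i := j) hd.contDiffAt le_top
      have hev' := congrArg (fun g => g (Fin.init h)) hev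
      refine Eq.trans hev'.symm ?_
      exact ih (((ContinuousLinearMap.apply ℂ ℂ (h (Fin.last j))).analyticAt _).comp hd) (isBigO_fderiv_apply hf hO _) j (by lia) _

theorem isBigO_of_iteratedFDeriv_eq_zero {k : ℕ} {f : E → ℂ} (hf : AnalyticAt ℂ f 0)
    (h0 : ∀ j ≤ k, ∀ h : Fin j → E, iteratedFDeriv ℂ j f 0 h = 0) :
    f =O[𝓝 0] fun z => ‖z‖ ^ (k + 1) := by
  obtain ⟨p, r, hp⟩ := hf
  have hz : ∀ y : E, p.partialSum (k + 1) y = 0 := by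
    intro y
    refine Finset.sum_eq_zero fun j hj => ?_
    have := hp.factorial_smul y j
    rw [h0 j (by simpa [Nat.lt_succ_iff] using hj)] at this
    exact (smul_eq_zero.1 this).resolve_left (Nat.factorial_ne_zero j)
  simpa [hz] using (hp.hasFPowerSeriesAt).isBigO_sub_partialSum_pow (k + 1)

variable {V : Type*} [NormedAddCommGroup V] [NormedSpace ℂ V] [CompleteSpace V]

/-- A linear form vanishes on the derivatives of order at most `k` of `F` if and only if its
composition with `F` vanishes to order at least `k + 1`. -/
theorem derivativeSpan_le_ker_iff {F : E → V} (hF : AnalyticAt ℂ F 0) {k : ℕ} (l : V →L[ℂ] ℂ) :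
    derivativeSpan k F 0 ≤ LinearMap.ker (l : V →ₗ[ℂ] ℂ) ↔
      (fun z => l (F z)) =O[𝓝 0] fun z => ‖z‖ ^ (k + 1) := by
  have hl : AnalyticAt ℂ (fun z => l (F z)) 0 := l.analyticAt _ |>.comp hF
  have hcomp : ∀ j (h : Fin j → E),
      iteratedFDeriv ℂ j (fun z => l (F z)) 0 h = l (iteratedFDeriv ℂ j F 0 h) := by
    intro j h
    have := l.iteratedFDeriv_comp_left (f := F) (x := 0) (n := ω) (i := j)
      (hF.contDiffAt) le_top
    change iteratedFDeriv ℂ j (l ∘ F) 0 h = _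
    rw [this]; rfl
  constructor
  · intro h
    refine isBigO_of_iteratedFDeriv_eq_zero hl fun j hj v => ?_
    rw [hcomp]
    exact h (Submodule.subset_span ⟨j, hj, v, rfl⟩)
  · intro h
    refine Submodule.span_le.2 ?_
    rintro _ ⟨j, hj, v, rfl⟩
    have := iteratedFDeriv_eq_zero_of_isBigO hl h j hj v
    rw [hcomp] at this
    exact this

end VanishingOrder

/-! ### Independence of derivative spans from lifts and parameters -/

section FiniteDimensional

variable {V : Type*} [NormedAddCommGroup V] [NormedSpace ℂ V] [FiniteDimensional ℂ V]

/-- Linear forms separate a subspace from the points outside it. Through this criterion every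
inclusion of derivative spans becomes a comparison of vanishing orders. -/
theorem submodule_le_of_forall_ker {S T : Submodule ℂ V}
    (h : ∀ l : V →L[ℂ] ℂ, T ≤ LinearMap.ker (l : V →ₗ[ℂ] ℂ) →
      S ≤ LinearMap.ker (l : V →ₗ[ℂ] ℂ)) : S ≤ T := by
  intro v hv
  by_contra hvT
  obtain ⟨f, hf, hfT⟩ := Submodule.exists_le_ker_of_notMem hvT
  exact hf (h (LinearMap.toContinuousLinearMap f) hfT hv)

variable {E E' : Type*} [NormedAddCommGroup E] [NormedSpace ℂ E]
  [NormedAddCommGroup E'] [NormedSpace ℂ E']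

/-- Derivative spans do not depend on the choice of a lift and of local parameters. -/
theorem derivativeSpan_le_of_eventuallyEq {F : E → V} {G : E' → V} {a : E' → ℂ} {ψ : E' → E}
    (hF : AnalyticAt ℂ F 0) (ha : AnalyticAt ℂ a 0) (hψ : AnalyticAt ℂ ψ 0) (hψ0 : ψ 0 = 0)
    (h : G =ᶠ[𝓝 0] fun z => a z • F (ψ z)) (k : ℕ) :
    derivativeSpan k G 0 ≤ derivativeSpan k F 0 := by
  have hFψ : AnalyticAt ℂ (fun z => F (ψ z)) 0 :=
    AnalyticAt.comp (g := F) (f := ψ) (by rwa [hψ0]) hψ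
  have hG : AnalyticAt ℂ G 0 := (ha.smul hFψ).congr h.symm
  refine submodule_le_of_forall_ker fun l hl => ?_
  rw [derivativeSpan_le_ker_iff hG]
  rw [derivativeSpan_le_ker_iff hF] at hl
  have hcont : Tendsto ψ (𝓝 0) (𝓝 0) := by simpa [hψ0] using hψ.continuousAt.tendsto
  -- Substituting `ψ`, which is `O(‖z‖)`, preserves the vanishing order, and the analytic multiplier
  -- `a` is bounded near the origin.
  have h1 : (fun z => l (F (ψ z))) =O[𝓝 0] fun z => ‖ψ z‖ ^ (k + 1) := hl.comp_tendsto hcont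
  have h2 : ψ =O[𝓝 0] fun z => ‖z‖ := by
    simpa [hψ0] using hψ.differentiableAt.isBigO_sub.norm_right
  have h3 : (fun z => ‖ψ z‖ ^ (k + 1)) =O[𝓝 0] fun z => ‖z‖ ^ (k + 1) := h2.norm_left.pow _
  have h4 : a =O[𝓝 0] fun _ => (1 : ℝ) :=
    ha.continuousAt.norm.isBoundedUnder_le.isBigO_one ℝ
  have h5 := h4.mul (h1.trans h3)
  simp only [one_mul] at h5
  refine h5.congr' ?_ EventuallyEq.rfl
  filter_upwards [h] with z hz
  rw [hz]; simp

end FiniteDimensional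

/-! ### Uniqueness of local parametrizations -/

section LocalParametrization

variable {V : Type*} [NormedAddCommGroup V] [NormedSpace ℂ V] 
variable {E : Type*} [NormedAddCommGroup E] [NormedSpace ℂ E]

theorem smul_mem_affineCone {X : Set (Projectivization ℂ V)} {v : V} {c : ℂ} (hc : c ≠ 0)
    (hv : v ∈ affineCone X) : c • v ∈ affineCone X := by
  obtain ⟨h, hX⟩ := hv
  refine ⟨smul_ne_zero hc h, ?_⟩
  rwa [(Projectivization.mk_eq_mk_iff' ℂ (c • v) v (smul_ne_zero hc h) h).2 ⟨c, rfl⟩]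

theorem analyticAt_cone {F : E → V} {z : E} (hF : AnalyticAt ℂ F z) (c : ℂ) :
    AnalyticAt ℂ (fun a : ℂ × E => a.1 • F a.2) (c, z) :=
  analyticAt_fst.smul (AnalyticAt.comp (g := F) (f := Prod.snd) hF analyticAt_snd)

theorem fderiv_cone {F : E → V} {z : E} (hF : AnalyticAt ℂ F z) :
    ∀ a : ℂ × E, fderiv ℂ (fun a : ℂ × E => a.1 • F a.2) (1, z) a =
      a.1 • F z + fderiv ℂ F z a.2 := by
  intro a
  have h2 : HasFDerivAt (fun a : ℂ × E => F a.2)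
      ((fderiv ℂ F z).comp (ContinuousLinearMap.snd ℂ ℂ E)) (1, z) :=
    HasFDerivAt.comp (g := F) (f := Prod.snd) (1, z) hF.differentiableAt.hasFDerivAt
      hasFDerivAt_snd
  have := (hasFDerivAt_fst (𝕜 := ℂ) (p := ((1 : ℂ), z))).smul h2
  rw [HasFDerivAt.fderiv (f := fun a : ℂ × E => a.1 • F a.2) this]
  simp [add_comm]

variable [FiniteDimensional ℂ V] [FiniteDimensional ℂ E]

/-- An analytic map with injective differential has an analytic left inverse. -/
theorem exists_analytic_left_inverse {Φ : E → V} {a : E} (hΦ : AnalyticAt ℂ Φ a)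
    (hinj : Function.Injective (fderiv ℂ Φ a)) :
    ∃ P : V → E, AnalyticAt ℂ P (Φ a) ∧ ∀ᶠ z in 𝓝 a, P (Φ z) = z := by
  -- Composing `Φ` with a linear left inverse of its differential gives a self-map of `E` with
  -- identity differential, to which the inverse function theorem applies.
  obtain ⟨L, hL⟩ := LinearMap.exists_leftInverse_of_injective
    ((fderiv ℂ Φ a : E →L[ℂ] V) : E →ₗ[ℂ] V) (LinearMap.ker_eq_bot.2 hinj)
  set L' : V →L[ℂ] E := LinearMap.toContinuousLinearMap L
  have hLΦ : AnalyticAt ℂ (fun z => L' (Φ z)) a := (L'.analyticAt _).comp hΦ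
  have hd : HasFDerivAt (fun z => L' (Φ z)) ((ContinuousLinearEquiv.refl ℂ E : E ≃L[ℂ] E) :
      E →L[ℂ] E) a := by
    have := HasFDerivAt.comp (g := L') a L'.hasFDerivAt hΦ.differentiableAt.hasFDerivAt
    have he : L'.comp (fderiv ℂ Φ a) = (ContinuousLinearEquiv.refl ℂ E : E →L[ℂ] E) := by
      ext v
      exact congrArg (fun f => f v) hL
    rwa [he] at this
  have hs : HasStrictFDerivAt (fun z => L' (Φ z)) ((ContinuousLinearEquiv.refl ℂ E : E ≃L[ℂ] E) :
      E →L[ℂ] E) a := hd.fderiv ▸ hLΦ.hasStrictFDerivAt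
  let R := hs.toOpenPartialHomeomorph _
  have ha : a ∈ R.source := hs.mem_toOpenPartialHomeomorph_source
  have hR : AnalyticAt ℂ R.symm (L' (Φ a)) := by
    obtain ⟨p, hp⟩ := hLΦ
    refine (R.hasFPowerSeriesAt_symm ha (i := ContinuousLinearEquiv.refl ℂ E) hp ?_).analyticAt
    rw [← hd.fderiv]
    ext v
    have := hp.fderiv_eq
    rw [this]
    simp
  refine ⟨fun v => R.symm (L' v), AnalyticAt.comp (g := R.symm) (f := L') hR (L'.analyticAt _), ?_⟩
  filter_upwards [R.open_source.mem_nhds ha] with z hz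
  exact R.left_inv hz

/-- Two local parametrizations differ by a change of the lift and of the parameters. -/
theorem IsLocalParametrization.exists_reparam {X : Set (Projectivization ℂ V)}
    {x : Projectivization ℂ V} {F G : E → V} (hF : IsLocalParametrization X x F)
    (hG : IsLocalParametrization X x G) :
    ∃ (a : E → ℂ) (ψ : E → E), AnalyticAt ℂ a 0 ∧ AnalyticAt ℂ ψ 0 ∧ ψ 0 = 0 ∧
      G =ᶠ[𝓝 0] fun z => a z • F (ψ z) := by
  have hspan : Submodule.span ℂ {F 0} = Submodule.span ℂ {G 0} := hF.base.symm.trans hG.base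
  obtain ⟨u, hu⟩ := Submodule.span_singleton_eq_span_singleton.1 hspan
  set c : ℂ := (u : ℂ)
  have hc : c ≠ 0 := u.ne_zero
  have hG0 : G 0 = c • F 0 := hu.symm
  -- Immersivity of the lift is injectivity of the differential of this map onto the cone; its left
  -- inverse `P` reads off the multiplier and the parameter of a point of the cone.
  set Φ : ℂ × E → V := fun a => a.1 • F a.2
  have hΦ : AnalyticAt ℂ Φ (1, 0) := analyticAt_cone hF.immersive.1 1
  have hinj : Function.Injective (fderiv ℂ Φ (1, 0)) := by
    intro a b hab
    rw [fderiv_cone hF.immersive.1, fderiv_cone hF.immersive.1] at hab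
    exact hF.immersive.2 hab
  obtain ⟨P, hP, hPΦ⟩ := exists_analytic_left_inverse hΦ hinj
  have hΦ1 : Φ (1, 0) = F 0 := by simp [Φ]
  rw [hΦ1] at hP
  have hGa : AnalyticAt ℂ (fun z => c⁻¹ • G z) 0 := analyticAt_const.smul hG.immersive.1
  have hG0' : c⁻¹ • G 0 = F 0 := by rw [hG0, smul_smul, inv_mul_cancel₀ hc, one_smul]
  have hPG : AnalyticAt ℂ (fun z => P (c⁻¹ • G z)) 0 :=
    AnalyticAt.comp (g := P) (f := fun z => c⁻¹ • G z) (by rw [hG0']; exact hP) hGa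
  have hP0 : P (F 0) = (1, 0) := by
    have := hPΦ.self_of_nhds
    rwa [hΦ1] at this
  refine ⟨fun z => c * (P (c⁻¹ • G z)).1, fun z => (P (c⁻¹ • G z)).2,
    analyticAt_const.mul (analyticAt_fst.comp hPG), analyticAt_snd.comp hPG, ?_, ?_⟩
  · simp [hG0', hP0]
  have hcone : ∀ᶠ z in 𝓝 (0 : E), G z ∈ affineCone X := by
    have h1 : ∀ᶠ v in map (fun a : ℂ × E => a.1 • G a.2) (𝓝 (1, 0)), v ∈ affineCone X := by
      rw [hG.locally_onto]; exact self_mem_nhdsWithin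
    rw [eventually_map] at h1
    have h2 : Tendsto (fun z : E => ((1 : ℂ), z)) (𝓝 0) (𝓝 (1, 0)) :=
      (Continuous.prodMk_right (1 : ℂ)).tendsto 0
    simpa using h2.eventually h1
  -- The local surjectivity clause is what makes `P` a right inverse too, but only along the cone;
  -- that is why the values of `G` must be known to lie on the cone.
  have himg : ∀ᶠ v in 𝓝[affineCone X] (F 0), Φ (P v) = v := by
    rw [← hF.locally_onto, eventually_map]
    filter_upwards [hPΦ] with a ha
    change Φ (P (Φ a)) = Φ a
    rw [ha]
  have htend : Tendsto (fun z => c⁻¹ • G z) (𝓝 0) (𝓝[affineCone X] (F 0)) := by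
    rw [tendsto_nhdsWithin_iff]
    refine ⟨by simpa [hG0'] using hGa.continuousAt.tendsto, ?_⟩
    filter_upwards [hcone] with z hz using smul_mem_affineCone (inv_ne_zero hc) hz
  filter_upwards [htend.eventually himg] with z hz
  have : G z = c • Φ (P (c⁻¹ • G z)) := by rw [hz, smul_smul, mul_inv_cancel₀ hc, one_smul]
  rw [mul_smul]
  exact this

/-- The supremum in the definition runs over subspaces contained in a single one of them, by the
comparison of parametrizations. -/
theorem osculatingSpace_eq {X : Set (Projectivization ℂ V)} {x : Projectivization ℂ V} {F : E → V}
    (hF : IsLocalParametrization X x F) (k : ℕ) :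
    osculatingSpace E k X x = derivativeSpan k F 0 := by
  refine le_antisymm (iSup₂_le fun G hG => ?_) (le_iSup₂_of_le F hF le_rfl)
  obtain ⟨a, ψ, ha, hψ, h0, h⟩ := hF.exists_reparam hG
  exact derivativeSpan_le_of_eventuallyEq hF.immersive.1 ha hψ h0 h k

end LocalParametrization

/-! ### Osculating spaces of a union of lines joining two curves -/

section Jets

variable {V : Type*} [NormedAddCommGroup V] [NormedSpace ℂ V]

/-- The span of the derivatives of order less than `k` at `0` of a germ of a curve. -/
def jetSpan (k : ℕ) (F : ℂ → V) : Submodule ℂ V :=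
  Submodule.span ℂ (Set.range fun j : Fin k => iteratedDeriv j F 0)

theorem iteratedDeriv_mem_jetSpan {k j : ℕ} (h : j < k) (F : ℂ → V) :
    iteratedDeriv j F 0 ∈ jetSpan k F :=
  Submodule.subset_span ⟨⟨j, h⟩, rfl⟩

theorem jetSpan_le_iff {k : ℕ} {F : ℂ → V} {S : Submodule ℂ V} :
    jetSpan k F ≤ S ↔ ∀ j < k, iteratedDeriv j F 0 ∈ S := by
  rw [jetSpan, Submodule.span_le]
  constructor
  · intro h j hj
    exact h ⟨⟨j, hj⟩, rfl⟩
  · rintro h _ ⟨j, rfl⟩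
    exact h j j.2

theorem jetSpan_mono {k l : ℕ} (h : k ≤ l) (F : ℂ → V) : jetSpan k F ≤ jetSpan l F :=
  jetSpan_le_iff.2 fun _ hj => iteratedDeriv_mem_jetSpan (hj.trans_le h) F

/-- On a line the multilinear derivatives are scalar multiples of the ordinary ones. The shift
arises because `jetSpan k` stops before order `k`, so that its dimension is at most `k`. -/
theorem jetSpan_succ (k : ℕ) (F : ℂ → V) : jetSpan (k + 1) F = derivativeSpan k F 0 := by
  apply le_antisymm
  · refine jetSpan_le_iff.2 fun j hj => Submodule.subset_span ⟨j, by lia, fun _ => 1, ?_⟩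
    rw [iteratedDeriv_eq_iteratedFDeriv]
  · refine Submodule.span_le.2 ?_
    rintro _ ⟨j, hj, h, rfl⟩
    rw [iteratedFDeriv_apply_eq_iteratedDeriv_mul_prod]
    exact Submodule.smul_mem _ _ (iteratedDeriv_mem_jetSpan (by lia) F)

theorem finrank_jetSpan_le (k : ℕ) (F : ℂ → V) : Module.finrank ℂ (jetSpan k F) ≤ k := by
  have := finrank_range_le_card (R := ℂ) fun j : Fin k => iteratedDeriv j F 0
  rwa [Fintype.card_fin] at this

theorem iteratedDeriv_clm_comp {W : Type*} [NormedAddCommGroup W] [NormedSpace ℂ W]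
    [CompleteSpace V] (L : V →L[ℂ] W) {F : ℂ → V} {z : ℂ} (hF : AnalyticAt ℂ F z) (j : ℕ) :
    iteratedDeriv j (fun w => L (F w)) z = L (iteratedDeriv j F z) := by
  have := L.iteratedFDeriv_comp_left (f := F) (x := z) (n := ω) (i := j) hF.contDiffAt le_top
  rw [iteratedDeriv_eq_iteratedFDeriv, iteratedDeriv_eq_iteratedFDeriv]
  exact congrArg (fun g => g fun _ => 1) this

theorem map_jetSpan {W : Type*} [NormedAddCommGroup W] [NormedSpace ℂ W]
    [CompleteSpace V] (L : V →L[ℂ] W) {F : ℂ → V} (hF : AnalyticAt ℂ F 0) (k : ℕ) :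
    (jetSpan k F).map (L : V →ₗ[ℂ] W) = jetSpan k fun w => L (F w) := by
  rw [jetSpan, Submodule.map_span, jetSpan, ← Set.range_comp]
  congr 2
  ext j
  exact (iteratedDeriv_clm_comp L hF j).symm

theorem isBigO_pow_iff_iteratedDeriv {g : ℂ → ℂ} (hg : AnalyticAt ℂ g 0) (k : ℕ) :
    (g =O[𝓝 0] fun z => ‖z‖ ^ k) ↔ ∀ j < k, iteratedDeriv j g 0 = 0 := by
  rcases k with _ | k
  · simpa using hg.continuousAt.norm.isBoundedUnder_le.isBigO_one ℝ
  constructor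
  · intro h j hj
    rw [iteratedDeriv_eq_iteratedFDeriv]
    exact iteratedFDeriv_eq_zero_of_isBigO hg h j (by lia) _
  · intro h
    refine isBigO_of_iteratedFDeriv_eq_zero hg fun j hj v => ?_
    rw [iteratedFDeriv_apply_eq_iteratedDeriv_mul_prod, h j (by lia), smul_zero]

/-- A reparametrized curve has the same jet spans. -/
theorem jetSpan_le_of_eventuallyEq [FiniteDimensional ℂ V] {F G : ℂ → V} {a ψ : ℂ → ℂ}
    (hF : AnalyticAt ℂ F 0) (ha : AnalyticAt ℂ a 0) (hψ : AnalyticAt ℂ ψ 0) (hψ0 : ψ 0 = 0)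
    (h : G =ᶠ[𝓝 0] fun z => a z • F (ψ z)) (k : ℕ) : jetSpan k G ≤ jetSpan k F := by
  rcases k with _ | k
  · simp [jetSpan]
  · rw [jetSpan_succ, jetSpan_succ]
    exact derivativeSpan_le_of_eventuallyEq hF ha hψ hψ0 h k

end Jets

/-! ### The ruled surface joining two germs of curves -/

section Join

variable {V : Type*} [NormedAddCommGroup V] [NormedSpace ℂ V] {ι : Type*}

/-- The affine lift of the ruled surface generated by two curves, near a point of the ruling. -/
def ruledLift (F₁ F₂ : ℂ → V) (t₀ : ℂ) (z : ℂ × ℂ) : V := F₁ z.1 + (t₀ + z.2) • F₂ z.1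

theorem analyticAt_ruledLift {F₁ F₂ : ℂ → V} (h₁ : AnalyticAt ℂ F₁ 0) (h₂ : AnalyticAt ℂ F₂ 0)
    (t₀ : ℂ) : AnalyticAt ℂ (ruledLift F₁ F₂ t₀) 0 := by
  have e₁ : AnalyticAt ℂ (fun z : ℂ × ℂ => F₁ z.1) 0 :=
    AnalyticAt.comp (g := F₁) (f := Prod.fst) h₁ analyticAt_fst
  have e₂ : AnalyticAt ℂ (fun z : ℂ × ℂ => F₂ z.1) 0 :=
    AnalyticAt.comp (g := F₂) (f := Prod.fst) h₂ analyticAt_fst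
  exact e₁.add ((analyticAt_const.add analyticAt_snd).smul e₂)

/-- `F₁` and `F₂` are local lifts of two families of lines `P` and `Q`, such that members of
either family that come close to the centre belong to small parameters. -/
structure IsLocalScroll (P Q : ι → Submodule ℂ V) (F₁ F₂ : ℂ → V) : Prop where
  immersive₁ : IsImmersiveLiftAt F₁ 0
  immersive₂ : IsImmersiveLiftAt F₂ 0
  lift : ∀ᶠ z in 𝓝 (0 : ℂ), ∃ i, P i = Submodule.span ℂ {F₁ z} ∧ Q i = Submodule.span ℂ {F₂ z}
  localize₁ : ∀ U ∈ 𝓝 (0 : ℂ), ∀ᶠ v in 𝓝 (F₁ 0), ∀ i, v ∈ P i →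
    ∃ z ∈ U, P i = Submodule.span ℂ {F₁ z} ∧ Q i = Submodule.span ℂ {F₂ z}
  localize₂ : ∀ U ∈ 𝓝 (0 : ℂ), ∀ᶠ v in 𝓝 (F₂ 0), ∀ i, v ∈ Q i →
    ∃ z ∈ U, P i = Submodule.span ℂ {F₁ z} ∧ Q i = Submodule.span ℂ {F₂ z}

theorem IsLocalScroll.symm {P Q : ι → Submodule ℂ V} {F₁ F₂ : ℂ → V}
    (h : IsLocalScroll P Q F₁ F₂) : IsLocalScroll Q P F₂ F₁ where
  immersive₁ := h.immersive₂
  immersive₂ := h.immersive₁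
  lift := h.lift.mono fun _ ⟨i, h₁, h₂⟩ => ⟨i, h₂, h₁⟩
  localize₁ U hU := (h.localize₂ U hU).mono fun _ hv i hi =>
    let ⟨z, hz, h₁, h₂⟩ := hv i hi; ⟨z, hz, h₂, h₁⟩
  localize₂ U hU := (h.localize₁ U hU).mono fun _ hv i hi =>
    let ⟨z, hz, h₁, h₂⟩ := hv i hi; ⟨z, hz, h₂, h₁⟩

theorem isImmersiveLiftAt_iff {E : Type*} [NormedAddCommGroup E] [NormedSpace ℂ E]
    {F : E → V} {z : E} : IsImmersiveLiftAt F z ↔ AnalyticAt ℂ F z ∧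
      ∀ (c : ℂ) (w : E), c • F z + fderiv ℂ F z w = 0 → c = 0 ∧ w = 0 := by
  refine and_congr_right fun _ => ⟨fun h c w hcw => ?_, fun h a b hab => ?_⟩
  · have := @h (c, w) 0 (by simpa using hcw)
    simpa using this
  · have hab' : a.1 • F z + fderiv ℂ F z a.2 = b.1 • F z + fderiv ℂ F z b.2 := hab
    have := h (a.1 - b.1) (a.2 - b.2) (by
      rw [sub_smul, map_sub, sub_add_sub_comm, hab', sub_self])
    exact Prod.ext (sub_eq_zero.1 this.1) (sub_eq_zero.1 this.2)

theorem fderiv_apply_eq_smul_deriv (F : ℂ → V) (z c : ℂ) : fderiv ℂ F z c = c • deriv F z := by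
  rw [← fderiv_apply_one_eq_deriv, ← map_smul]
  simp

theorem isImmersiveLiftAt_iff_deriv {F : ℂ → V} {z : ℂ} :
    IsImmersiveLiftAt F z ↔ AnalyticAt ℂ F z ∧
      ∀ c w : ℂ, c • F z + w • deriv F z = 0 → c = 0 ∧ w = 0 := by
  simp only [isImmersiveLiftAt_iff, fderiv_apply_eq_smul_deriv]

theorem IsImmersiveLiftAt.ne_zero {E : Type*} [NormedAddCommGroup E] [NormedSpace ℂ E]
    {F : E → V} {z : E} (h : IsImmersiveLiftAt F z) : F z ≠ 0 := by
  intro h0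
  have := @h.2 (1, 0) (0, 0) (by simp [h0])
  simp at this

theorem exists_clm_eq_one {v : V} (hv : v ≠ 0) : ∃ l : V →L[ℂ] ℂ, l v = 1 := by
  obtain ⟨l, hl⟩ := SeparatingDual.exists_eq_one (R := ℂ) hv
  exact ⟨l, hl⟩

theorem joinOfCurves_comm (P Q : ι → Submodule ℂ V) : joinOfCurves P Q = joinOfCurves Q P := by
  ext x
  simp only [joinOfCurves, sup_comm]

variable {P Q : ι → Submodule ℂ V} {F₁ F₂ : ℂ → V} {p : V →L[ℂ] V}

theorem mem_affineCone_joinOfCurves {v : V} :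
    v ∈ affineCone (joinOfCurves P Q) ↔ v ≠ 0 ∧ ∃ i, v ∈ P i ⊔ Q i := by
  simp only [affineCone, joinOfCurves, Set.mem_ofPred_eq, Projectivization.submodule_mk,
    Submodule.span_singleton_le_iff_mem]
  exact ⟨fun ⟨h, h'⟩ => ⟨h, h'⟩, fun ⟨h, h'⟩ => ⟨h, h'⟩⟩

variable (hp₁ : ∀ i, ∀ v ∈ P i, p v = v) (hp₂ : ∀ i, ∀ v ∈ Q i, p v = 0)

include hp₁ in
theorem IsLocalScroll.eventually_proj₁ (h : IsLocalScroll P Q F₁ F₂) :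
    (fun z => p (F₁ z)) =ᶠ[𝓝 0] F₁ := by
  filter_upwards [h.lift] with z ⟨i, h₁, _⟩
  exact hp₁ i _ (h₁ ▸ Submodule.mem_span_singleton_self _)

include hp₂ in
theorem IsLocalScroll.eventually_proj₂ (h : IsLocalScroll P Q F₁ F₂) :
    (fun z => p (F₂ z)) =ᶠ[𝓝 0] fun _ => 0 := by
  filter_upwards [h.lift] with z ⟨i, _, h₂⟩
  exact hp₂ i _ (h₂ ▸ Submodule.mem_span_singleton_self _)

include hp₁ in
theorem IsLocalScroll.proj_iteratedDeriv₁ [CompleteSpace V] (h : IsLocalScroll P Q F₁ F₂) (j : ℕ) :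
    p (iteratedDeriv j F₁ 0) = iteratedDeriv j F₁ 0 := by
  rw [← iteratedDeriv_clm_comp p h.immersive₁.1]
  exact (h.eventually_proj₁ hp₁).iteratedDeriv_eq j

include hp₂ in
theorem IsLocalScroll.proj_iteratedDeriv₂ [CompleteSpace V] (h : IsLocalScroll P Q F₁ F₂) (j : ℕ) :
    p (iteratedDeriv j F₂ 0) = 0 := by
  rw [← iteratedDeriv_clm_comp p h.immersive₂.1]
  rw [(h.eventually_proj₂ hp₂).iteratedDeriv_eq j]
  simp

include hp₁ hp₂ in
-- Applying `p` to a tangential relation leaves a relation between `F₁` and its derivative, which is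
-- trivial by immersivity; what remains is a multiple of `F₂ 0`, which is nonzero.
theorem IsLocalScroll.immersive_ruledLift [CompleteSpace V] (h : IsLocalScroll P Q F₁ F₂)
    (t₀ : ℂ) : IsImmersiveLiftAt (ruledLift F₁ F₂ t₀) 0 := by
  have hd₁ : HasFDerivAt (fun z : ℂ × ℂ => F₁ z.1)
      ((fderiv ℂ F₁ 0).comp (ContinuousLinearMap.fst ℂ ℂ ℂ)) 0 :=
    HasFDerivAt.comp (g := F₁) (f := Prod.fst) (0 : ℂ × ℂ)
      h.immersive₁.1.differentiableAt.hasFDerivAt hasFDerivAt_fst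
  have hd₂ : HasFDerivAt (fun z : ℂ × ℂ => F₂ z.1)
      ((fderiv ℂ F₂ 0).comp (ContinuousLinearMap.fst ℂ ℂ ℂ)) 0 :=
    HasFDerivAt.comp (g := F₂) (f := Prod.fst) (0 : ℂ × ℂ)
      h.immersive₂.1.differentiableAt.hasFDerivAt hasFDerivAt_fst
  have hd := hd₁.add (((hasFDerivAt_snd (𝕜 := ℂ) (p := (0 : ℂ × ℂ))).const_add t₀).smul hd₂)
  have hd' : ∀ w : ℂ × ℂ, fderiv ℂ (ruledLift F₁ F₂ t₀) 0 w =
      w.1 • deriv F₁ 0 + t₀ • (w.1 • deriv F₂ 0) + w.2 • F₂ 0 := by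
    intro w
    rw [HasFDerivAt.fderiv (f := ruledLift F₁ F₂ t₀) hd]
    simp [add_assoc]
  rw [isImmersiveLiftAt_iff]
  refine ⟨analyticAt_ruledLift h.immersive₁.1 h.immersive₂.1 t₀, fun c w hcw => ?_⟩
  have q₁ : p (F₁ 0) = F₁ 0 := by simpa using h.proj_iteratedDeriv₁ hp₁ 0
  have q₂ : p (F₂ 0) = 0 := by simpa using h.proj_iteratedDeriv₂ hp₂ 0
  have q₁' : p (deriv F₁ 0) = deriv F₁ 0 := by simpa using h.proj_iteratedDeriv₁ hp₁ 1
  have q₂' : p (deriv F₂ 0) = 0 := by simpa using h.proj_iteratedDeriv₂ hp₂ 1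
  rw [hd'] at hcw
  have hcw' := congrArg p hcw
  simp only [ruledLift, Prod.fst_zero, Prod.snd_zero, map_add, map_smul, q₁, q₂, q₁', q₂',
    smul_zero, add_zero, map_zero] at hcw'
  obtain ⟨rfl, hw₁⟩ := (isImmersiveLiftAt_iff_deriv.1 h.immersive₁).2 c w.1 hcw'
  rw [hw₁] at hcw
  simp only [zero_smul, smul_zero, add_zero, zero_add] at hcw
  exact ⟨rfl, Prod.ext hw₁ ((smul_eq_zero.1 hcw).resolve_right h.immersive₂.ne_zero)⟩

include hp₁ hp₂ in
-- The issue is that nearby points of the cone come from nearby parameters. If `v` is close to the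
-- base vector, then `p v` is close to `F₁ 0`, and `localize₁` forces the ruling through `v` to have
-- a small parameter. The fibre coordinates are then continuous functions of `v` and this parameter.
theorem IsLocalScroll.isLocalParametrization [CompleteSpace V] (h : IsLocalScroll P Q F₁ F₂)
    {x : Projectivization ℂ V} {t₀ : ℂ}
    (hx : x.submodule = Submodule.span ℂ {F₁ 0 + t₀ • F₂ 0}) :
    IsLocalParametrization (joinOfCurves P Q) x (ruledLift F₁ F₂ t₀) := by
  have himm := h.immersive_ruledLift hp₁ hp₂ t₀
  have hF0 : ruledLift F₁ F₂ t₀ 0 = F₁ 0 + t₀ • F₂ 0 := by simp [ruledLift]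
  refine ⟨himm, by rw [hF0, hx], le_antisymm ?_ ?_⟩
  · have hcont : ContinuousAt (fun a : ℂ × (ℂ × ℂ) => a.1 • ruledLift F₁ F₂ t₀ a.2) (1, 0) :=
      (analyticAt_cone himm.1 1).continuousAt
    refine tendsto_nhdsWithin_iff.2 ⟨by simpa [ContinuousAt] using hcont, ?_⟩
    have hne : ∀ᶠ a in 𝓝 ((1 : ℂ), (0 : ℂ × ℂ)), a.1 • ruledLift F₁ F₂ t₀ a.2 ≠ 0 :=
      hcont.eventually_ne (by simpa using himm.ne_zero)
    have hl : Tendsto (fun a : ℂ × (ℂ × ℂ) => a.2.1) (𝓝 (1, 0)) (𝓝 0) :=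
      (continuous_fst.comp continuous_snd).tendsto' _ _ rfl
    filter_upwards [hne, hl.eventually h.lift] with a ha ⟨i, h₁, h₂⟩
    refine mem_affineCone_joinOfCurves.2 ⟨ha, i, Submodule.smul_mem _ _ ?_⟩
    refine Submodule.add_mem_sup ?_ (Submodule.smul_mem _ _ ?_)
    · rw [h₁]; exact Submodule.mem_span_singleton_self _
    · rw [h₂]; exact Submodule.mem_span_singleton_self _
  · obtain ⟨l₁, hl₁⟩ := exists_clm_eq_one h.immersive₁.ne_zero
    obtain ⟨l₂, hl₂⟩ := exists_clm_eq_one h.immersive₂.ne_zero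
    have q₁ : p (F₁ 0) = F₁ 0 := by simpa using h.proj_iteratedDeriv₁ hp₁ 0
    have q₂ : p (F₂ 0) = 0 := by simpa using h.proj_iteratedDeriv₂ hp₂ 0
    set v₀ := ruledLift F₁ F₂ t₀ 0
    have hpv₀ : p v₀ = F₁ 0 := by rw [hF0]; simp [q₁, q₂]
    intro S hS
    rw [mem_map] at hS
    -- If `v = a F₁(z) + b F₂(z)`, then `α (v, z) = a` and `β (v, z) = b`; the parameters of `v` are
    -- thus the multiplier `a`, the point `z` and the offset `b / a - t₀`.
    let α : V × ℂ → ℂ := fun y => l₁ (p y.1) / l₁ (F₁ y.2)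
    let β : V × ℂ → ℂ := fun y => l₂ (y.1 - p y.1) / l₂ (F₂ y.2)
    have hc₁ : ContinuousAt (fun y : V × ℂ => l₁ (F₁ y.2)) (v₀, 0) :=
      ContinuousAt.comp (g := fun z => l₁ (F₁ z)) (f := Prod.snd)
        (l₁.continuous.continuousAt.comp h.immersive₁.1.continuousAt) continuousAt_snd
    have hc₂ : ContinuousAt (fun y : V × ℂ => l₂ (F₂ y.2)) (v₀, 0) :=
      ContinuousAt.comp (g := fun z => l₂ (F₂ z)) (f := Prod.snd)
        (l₂.continuous.continuousAt.comp h.immersive₂.1.continuousAt) continuousAt_snd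
    have hα : ContinuousAt α (v₀, 0) :=
      ContinuousAt.div (by fun_prop) hc₁ (by simp [hl₁])
    have hβ : ContinuousAt β (v₀, 0) :=
      ContinuousAt.div (by fun_prop) hc₂ (by simp [hl₂])
    have hα0 : α (v₀, 0) = 1 := by simp [α, hpv₀, hl₁]
    have hβ0 : β (v₀, 0) = t₀ := by
      change l₂ (v₀ - p v₀) / l₂ (F₂ 0) = t₀
      rw [hpv₀, hF0]
      simp [hl₂]
    have hθ : ContinuousAt (fun y : V × ℂ => (α y, (y.2, β y / α y - t₀))) (v₀, 0) :=
      hα.prodMk (continuousAt_snd.prodMk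
        ((hβ.div hα (by simp [hα0])).sub continuousAt_const))
    have hev : ∀ᶠ y in 𝓝 (v₀, (0 : ℂ)), (α y, (y.2, β y / α y - t₀)) ∈
        (fun a : ℂ × (ℂ × ℂ) => a.1 • ruledLift F₁ F₂ t₀ a.2) ⁻¹' S ∧ α y ≠ 0 ∧
        l₁ (F₁ y.2) ≠ 0 ∧ l₂ (F₂ y.2) ≠ 0 := by
      refine (hθ.eventually ?_).and ((hα.eventually_ne (by simp [hα0])).and
        ((hc₁.eventually_ne (by simp [hl₁])).and (hc₂.eventually_ne (by simp [hl₂]))))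
      change ∀ᶠ y in 𝓝 (α (v₀, 0), ((0 : ℂ), β (v₀, 0) / α (v₀, 0) - t₀)), _
      rw [hα0, hβ0]
      rw [div_one, sub_self]
      exact hS
    rw [nhds_prod_eq, eventually_prod_iff] at hev
    obtain ⟨A, hA, U, hU, hAU⟩ := hev
    have hloc : ∀ᶠ v in 𝓝 v₀, ∀ i, p v ∈ P i →
        ∃ z, U z ∧ P i = Submodule.span ℂ {F₁ z} ∧ Q i = Submodule.span ℂ {F₂ z} := by
      have ht : Tendsto p (𝓝 v₀) (𝓝 (F₁ 0)) := hpv₀ ▸ p.continuous.tendsto v₀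
      exact ht.eventually (h.localize₁ _ hU)
    rw [mem_nhdsWithin_iff_eventually]
    filter_upwards [hA, hloc] with v hAv hv hcone
    obtain ⟨hv0, i, hvi⟩ := mem_affineCone_joinOfCurves.1 hcone
    obtain ⟨v₁, hv₁, v₂, hv₂, rfl⟩ := Submodule.mem_sup.1 hvi
    have hpv : p (v₁ + v₂) = v₁ := by rw [map_add, hp₁ i _ hv₁, hp₂ i _ hv₂, add_zero]
    rw [hpv] at hv
    obtain ⟨z, hUz, hP, hQ⟩ := hv i hv₁
    obtain ⟨hS', hα', hz₁, hz₂⟩ := hAU hAv hUz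
    rw [hP] at hv₁
    rw [hQ] at hv₂
    obtain ⟨a, rfl⟩ := Submodule.mem_span_singleton.1 hv₁
    obtain ⟨b, rfl⟩ := Submodule.mem_span_singleton.1 hv₂
    have ea : α (a • F₁ z + b • F₂ z, z) = a := by
      simp only [α, hpv, map_smul, smul_eq_mul]
      field_simp
    have eb : β (a • F₁ z + b • F₂ z, z) = b := by
      simp only [β, hpv, add_sub_cancel_left, map_smul, smul_eq_mul]
      field_simp
    simp only [ea, eb, Set.mem_preimage, ruledLift] at hS' hα'
    convert hS' using 1
    rw [smul_add, smul_smul]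
    congr 2
    field_simp
    ring

/-- Restricting to the zero section and to the diagonal and subtracting leaves `z f₂(z)`; division
by `z` explains why only order `k` is required of `f₂`. -/
theorem ruledLift_isBigO_iff {f₁ f₂ : ℂ → ℂ} (h₂ : AnalyticAt ℂ f₂ 0)
    (t₀ : ℂ) (k : ℕ) :
    (fun z : ℂ × ℂ => f₁ z.1 + (t₀ + z.2) * f₂ z.1) =O[𝓝 0] (fun z => ‖z‖ ^ (k + 1)) ↔
      (fun z => f₁ z + t₀ * f₂ z) =O[𝓝 0] (fun z => ‖z‖ ^ (k + 1)) ∧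
      f₂ =O[𝓝 0] fun z => ‖z‖ ^ k := by
  constructor
  · intro h
    have e₁ : Tendsto (fun z : ℂ => (z, (0 : ℂ))) (𝓝 0) (𝓝 0) :=
      (Continuous.prodMk_left (0 : ℂ)).tendsto' _ _ rfl
    have e₂ : Tendsto (fun z : ℂ => (z, z)) (𝓝 0) (𝓝 0) :=
      (continuous_id.prodMk continuous_id).tendsto' _ _ rfl
    have a₁ : (fun z => f₁ z + t₀ * f₂ z) =O[𝓝 0] (fun z => ‖z‖ ^ (k + 1)) := by
      simpa [Function.comp_def, Prod.norm_def] using h.comp_tendsto e₁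
    have a₂ : (fun z => f₁ z + (t₀ + z) * f₂ z) =O[𝓝 0] (fun z => ‖z‖ ^ (k + 1)) := by
      simpa [Function.comp_def, Prod.norm_def] using h.comp_tendsto e₂
    refine ⟨a₁, ?_⟩
    have a₃ : (fun z => z * f₂ z) =O[𝓝 0] (fun z => ‖z‖ ^ (k + 1)) :=
      (a₂.sub a₁).congr_left fun z => by ring
    rw [isBigO_pow_iff_iteratedDeriv h₂, ← natCast_le_analyticOrderAt_iff_iteratedDeriv_eq_zero h₂]
    have h₃ : AnalyticAt ℂ (fun z => z * f₂ z) 0 := analyticAt_id.mul h₂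
    rw [isBigO_pow_iff_iteratedDeriv h₃,
      ← natCast_le_analyticOrderAt_iff_iteratedDeriv_eq_zero h₃] at a₃
    have ho : analyticOrderAt (fun z : ℂ => z * f₂ z) 0 = 1 + analyticOrderAt f₂ 0 := by
      have := analyticOrderAt_mul (analyticAt_id (𝕜 := ℂ) (z := 0)) h₂
      rwa [analyticOrderAt_id] at this
    have a₄ : ((k + 1 : ℕ) : ℕ∞) ≤ analyticOrderAt (fun z : ℂ => z * f₂ z) 0 := a₃
    rw [ho, Nat.cast_add, add_comm, Nat.cast_one] at a₄
    exact (ENat.add_le_add_iff_left (by simp)).1 a₄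
  · rintro ⟨a₁, a₂⟩
    have e₁ : Tendsto (Prod.fst : ℂ × ℂ → ℂ) (𝓝 0) (𝓝 0) := continuous_fst.tendsto' _ _ rfl
    have hfst : (Prod.fst : ℂ × ℂ → ℂ) =O[𝓝 0] fun z : ℂ × ℂ => ‖z‖ :=
      Asymptotics.isBigO_fst_prod'.norm_right
    have hsnd : (Prod.snd : ℂ × ℂ → ℂ) =O[𝓝 0] fun z : ℂ × ℂ => ‖z‖ :=
      Asymptotics.isBigO_snd_prod'.norm_right
    have b₁ := (a₁.comp_tendsto e₁).trans (hfst.norm_left.pow (k + 1))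
    have b₂ := (a₂.comp_tendsto e₁).trans (hfst.norm_left.pow k)
    have b₃ := b₁.add ((hsnd.mul b₂).congr_right fun z => (pow_succ' _ _).symm)
    refine b₃.congr_left fun z => ?_
    simp only [Function.comp_apply]
    ring

variable [FiniteDimensional ℂ V]

/-- The span of the derivatives of the ruled lift. -/
theorem derivativeSpan_ruledLift (h₁ : AnalyticAt ℂ F₁ 0) (h₂ : AnalyticAt ℂ F₂ 0) (t₀ : ℂ)
    (k : ℕ) : derivativeSpan k (ruledLift F₁ F₂ t₀) 0 =
      jetSpan (k + 1) (fun z => F₁ z + t₀ • F₂ z) ⊔ jetSpan k F₂ := by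
  have h₃ : AnalyticAt ℂ (fun z => F₁ z + t₀ • F₂ z) 0 := h₁.add (analyticAt_const.smul h₂)
  have key : ∀ l : V →L[ℂ] ℂ, derivativeSpan k (ruledLift F₁ F₂ t₀) 0 ≤
      LinearMap.ker (l : V →ₗ[ℂ] ℂ) ↔ jetSpan (k + 1) (fun z => F₁ z + t₀ • F₂ z) ⊔ jetSpan k F₂ ≤
      LinearMap.ker (l : V →ₗ[ℂ] ℂ) := by
    intro l
    have hl₂ : AnalyticAt ℂ (fun z => l (F₂ z)) 0 := (l.analyticAt _).comp h₂
    have hl₃ : AnalyticAt ℂ (fun z => l (F₁ z + t₀ • F₂ z)) 0 := (l.analyticAt _).comp h₃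
    rw [derivativeSpan_le_ker_iff (analyticAt_ruledLift h₁ h₂ t₀), sup_le_iff, jetSpan_le_iff,
      jetSpan_le_iff]
    have := ruledLift_isBigO_iff (f₁ := fun z => l (F₁ z)) hl₂ t₀ k
    simp only [ruledLift, map_add, map_smul, smul_eq_mul] at this ⊢
    rw [this, isBigO_pow_iff_iteratedDeriv hl₂]
    have h4 := isBigO_pow_iff_iteratedDeriv hl₃ (k + 1)
    simp only [map_add, map_smul, smul_eq_mul] at h4
    rw [h4]
    refine and_congr (forall₂_congr fun j _ => ?_) (forall₂_congr fun j _ => ?_)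
    · have := iteratedDeriv_clm_comp l h₃ j
      simp only [map_add, map_smul, smul_eq_mul] at this
      rw [this]; rfl
    · rw [iteratedDeriv_clm_comp l h₂]; rfl
  exact le_antisymm (submodule_le_of_forall_ker fun l hl => (key l).2 hl)
    (submodule_le_of_forall_ker fun l hl => (key l).1 hl)

theorem finrank_derivativeSpan_ruledLift_le (h₁ : AnalyticAt ℂ F₁ 0) (h₂ : AnalyticAt ℂ F₂ 0)
    (t₀ : ℂ) (k : ℕ) :
    Module.finrank ℂ (derivativeSpan k (ruledLift F₁ F₂ t₀) 0) ≤ 2 * k + 1 := by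
  rw [derivativeSpan_ruledLift h₁ h₂]
  refine (Submodule.finrank_add_le_finrank_add_finrank _ _).trans ?_
  have a := finrank_jetSpan_le (k + 1) (fun z => F₁ z + t₀ • F₂ z)
  have b := finrank_jetSpan_le k F₂
  lia

theorem finrank_derivativeSpan_ruledLift_zero_le (h₁ : AnalyticAt ℂ F₁ 0)
    (h₂ : AnalyticAt ℂ F₂ 0) (k : ℕ) :
    Module.finrank ℂ (derivativeSpan k (ruledLift F₁ F₂ 0) 0) ≤
      Module.finrank ℂ (jetSpan (k + 1) F₁) + Module.finrank ℂ (jetSpan k F₂) := by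
  rw [derivativeSpan_ruledLift h₁ h₂,
    show (fun z => F₁ z + (0 : ℂ) • F₂ z) = F₁ from funext fun z => by simp]
  exact Submodule.finrank_add_le_finrank_add_finrank _ _

include hp₁ hp₂ in
-- Rank and nullity of `p` on the derivative span: the image contains the jets of `F₁`, and the
-- kernel contains the jets of `F₂`.
theorem IsLocalScroll.le_finrank_derivativeSpan (h : IsLocalScroll P Q F₁ F₂) (t₀ : ℂ) (k : ℕ) :
    Module.finrank ℂ (jetSpan (k + 1) F₁) + Module.finrank ℂ (jetSpan k F₂) ≤
      Module.finrank ℂ (derivativeSpan k (ruledLift F₁ F₂ t₀) 0) := by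
  have h₁ := h.immersive₁.1
  have h₂ := h.immersive₂.1
  have h₃ : AnalyticAt ℂ (fun z => F₁ z + t₀ • F₂ z) 0 := h₁.add (analyticAt_const.smul h₂)
  rw [derivativeSpan_ruledLift h₁ h₂]
  set D := jetSpan (k + 1) (fun z => F₁ z + t₀ • F₂ z) ⊔ jetSpan k F₂
  have hmap : jetSpan (k + 1) F₁ ≤ LinearMap.range ((p : V →ₗ[ℂ] V).domRestrict D) := by
    refine jetSpan_le_iff.2 fun j hj => ⟨⟨iteratedDeriv j (fun z => F₁ z + t₀ • F₂ z) 0,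
      Submodule.mem_sup_left (iteratedDeriv_mem_jetSpan hj _)⟩, ?_⟩
    have : (fun z => p (F₁ z + t₀ • F₂ z)) =ᶠ[𝓝 0] F₁ := by
      filter_upwards [h.eventually_proj₁ hp₁, h.eventually_proj₂ hp₂] with z hz₁ hz₂
      rw [map_add, map_smul, hz₁, hz₂, smul_zero, add_zero]
    change p (iteratedDeriv j (fun z => F₁ z + t₀ • F₂ z) 0) = _
    rw [← iteratedDeriv_clm_comp p h₃, this.iteratedDeriv_eq]
  have hker : jetSpan k F₂ ≤ (LinearMap.ker ((p : V →ₗ[ℂ] V).domRestrict D)).map D.subtype := by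
    refine jetSpan_le_iff.2 fun j hj => ⟨⟨iteratedDeriv j F₂ 0,
      Submodule.mem_sup_right (iteratedDeriv_mem_jetSpan hj _)⟩, ?_, rfl⟩
    exact h.proj_iteratedDeriv₂ hp₂ j
  have e₁ := Submodule.finrank_mono hmap
  have e₂ := Submodule.finrank_mono hker
  rw [Submodule.finrank_map_subtype_eq] at e₂
  have e₃ := LinearMap.finrank_range_add_finrank_ker ((p : V →ₗ[ℂ] V).domRestrict D)
  lia

end Join

/-! ### Wronskian determinants -/

section Wronskian

/-- The Wronskian determinant of a finite family of functions of one complex variable. -/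
def wronskianDet {n : ℕ} (f : Fin n → ℂ → ℂ) (z : ℂ) : ℂ :=
  (Matrix.of fun i j : Fin n => iteratedDeriv j (f i) z).det

theorem AnalyticAt.iteratedDeriv_analyticAt {f : ℂ → ℂ} {z : ℂ} (hf : AnalyticAt ℂ f z) (j : ℕ) :
    AnalyticAt ℂ (iteratedDeriv j f) z := by
  rw [iteratedDeriv_eq_iterate]
  exact hf.iterated_deriv j

theorem analyticAt_wronskianDet {n : ℕ} {f : Fin n → ℂ → ℂ} {z : ℂ}
    (hf : ∀ i, AnalyticAt ℂ (f i) z) : AnalyticAt ℂ (wronskianDet f) z := by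
  have : wronskianDet f = fun z => ∑ σ : Equiv.Perm (Fin n),
      ((Equiv.Perm.sign σ : ℤ) : ℂ) * ∏ i : Fin n, iteratedDeriv i (f (σ i)) z := by
    ext z
    simp [wronskianDet, Matrix.det_apply']
  rw [this]
  refine Finset.analyticAt_fun_sum _ fun σ _ => analyticAt_const.mul ?_
  exact Finset.analyticAt_fun_prod _ fun i _ => (hf _).iteratedDeriv_analyticAt _

theorem wronskianDet_congr {n : ℕ} {f g : Fin n → ℂ → ℂ} {z : ℂ}
    (h : ∀ i, f i =ᶠ[𝓝 z] g i) : wronskianDet f z = wronskianDet g z := by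
  simp only [wronskianDet]
  congr 1
  ext i j
  exact (h i).iteratedDeriv_eq j

/-- The coefficients are independent of `f`, so one triangular matrix transforms the derivatives of
a whole family at once; the leading coefficients are its diagonal and give its determinant. -/
theorem exists_iteratedDeriv_comp_expansion {g ψ : ℂ → ℂ} {z₀ : ℂ} (hg : AnalyticAt ℂ g z₀)
    (hψ : AnalyticAt ℂ ψ z₀) (j : ℕ) : ∃ c : ℕ → ℂ → ℂ, (∀ l, AnalyticAt ℂ (c l) z₀) ∧
      c j z₀ = g z₀ * deriv ψ z₀ ^ j ∧ ∀ f : ℂ → ℂ, AnalyticAt ℂ f (ψ z₀) →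
      iteratedDeriv j (fun z => g z * f (ψ z)) =ᶠ[𝓝 z₀]
        fun z => ∑ l ∈ Finset.range (j + 1), c l z * iteratedDeriv l f (ψ z) := by
  induction j with
  | zero => exact ⟨fun _ => g, fun _ => hg, by simp, fun f _ => by simp⟩
  | succ j ih =>
    obtain ⟨c, hc, hcj, hf⟩ := ih
    refine ⟨fun l z => (if l ≤ j then deriv (c l) z else 0) +
      (if 1 ≤ l then c (l - 1) z * deriv ψ z else 0), fun l => ?_, ?_, fun f hfa => ?_⟩
    · refine AnalyticAt.add ?_ ?_
      · split_ifs
        · exact (hc l).deriv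
        · exact analyticAt_const
      · split_ifs
        · exact (hc _).mul hψ.deriv
        · exact analyticAt_const
    · simp [hcj, pow_succ, mul_assoc]
    · rw [iteratedDeriv_succ]
      refine (hf f hfa).deriv.trans ?_
      have e₁ : ∀ᶠ z in 𝓝 z₀, ∀ l ∈ Finset.range (j + 1), AnalyticAt ℂ (c l) z :=
        (Finset.range (j + 1)).eventually_all.2 fun l _ => (hc l).eventually_analyticAt
      have e₂ : ∀ᶠ z in 𝓝 z₀, AnalyticAt ℂ f (ψ z) :=
        hψ.continuousAt.eventually hfa.eventually_analyticAt
      filter_upwards [e₁, e₂, hψ.eventually_analyticAt] with z h₁ h₂ h₃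
      have hd : ∀ l ∈ Finset.range (j + 1), HasDerivAt
          (fun z => c l z * iteratedDeriv l f (ψ z))
          (deriv (c l) z * iteratedDeriv l f (ψ z) +
            c l z * (iteratedDeriv (l + 1) f (ψ z) * deriv ψ z)) z := by
        intro l hl
        have a := (h₁ l hl).differentiableAt.hasDerivAt
        have b := (h₂.iteratedDeriv_analyticAt l).differentiableAt.hasDerivAt
        have d := HasDerivAt.comp (h₂ := iteratedDeriv l f) z b h₃.differentiableAt.hasDerivAt
        rw [← iteratedDeriv_succ] at d
        exact a.mul d
      rw [(HasDerivAt.fun_sum hd).deriv, Finset.sum_add_distrib]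
      simp only [add_mul, Finset.sum_add_distrib]
      congr 1
      · rw [Finset.sum_range_succ _ (j + 1)]
        simp only [show ¬ (j + 1 ≤ j) by lia, if_false, zero_mul, add_zero]
        refine Finset.sum_congr rfl fun l hl => ?_
        rw [if_pos (by simpa [Nat.lt_succ_iff] using hl)]
      · rw [Finset.sum_range_succ' _ (j + 1)]
        simp [mul_assoc, mul_comm]

/-- The behaviour of the Wronskian determinant under a change of variable and multiplication by a
function. -/
theorem wronskianDet_mul_comp {n : ℕ} {f : Fin n → ℂ → ℂ} {g ψ : ℂ → ℂ} {z₀ : ℂ}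
    (hg : AnalyticAt ℂ g z₀) (hψ : AnalyticAt ℂ ψ z₀) (hf : ∀ i, AnalyticAt ℂ (f i) (ψ z₀)) :
    wronskianDet (fun i z => g z * f i (ψ z)) z₀ =
      g z₀ ^ n * deriv ψ z₀ ^ (∑ j ∈ Finset.range n, j) * wronskianDet f (ψ z₀) := by
  choose c _ hcj hcf using fun j => exists_iteratedDeriv_comp_expansion hg hψ j
  let T : Matrix (Fin n) (Fin n) ℂ := Matrix.of fun l j => if l ≤ j then c j l z₀ else 0
  have hmul : (Matrix.of fun i j : Fin n => iteratedDeriv j (fun z => g z * f i (ψ z)) z₀) =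
      (Matrix.of fun i j : Fin n => iteratedDeriv j (f i) (ψ z₀)) * T := by
    ext i j
    have h1 := (hcf j (f i) (hf i)).self_of_nhds
    simp only [Matrix.of_apply, Matrix.mul_apply, T] at h1 ⊢
    rw [h1]
    have h2 : ∀ F : ℕ → ℂ, ∑ l ∈ Finset.range ((j : ℕ) + 1), F l =
        ∑ l : Fin n, if l ≤ j then F l else 0 := by
      intro F
      refine Eq.trans ?_ (Fin.sum_univ_eq_sum_range (fun l => if l ≤ (j : ℕ) then F l else 0) n).symm
      rw [← Finset.sum_filter]
      refine Finset.sum_congr ?_ fun _ _ => rfl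
      ext l
      simp only [Finset.mem_range, Finset.mem_filter]
      have := j.2
      lia
    rw [h2]
    refine Finset.sum_congr rfl fun l _ => ?_
    split_ifs <;> ring
  have hT : T.det = g z₀ ^ n * deriv ψ z₀ ^ (∑ j ∈ Finset.range n, j) := by
    rw [Matrix.det_of_isUpperTriangular]
    · have : ∀ i : Fin n, T i i = g z₀ * deriv ψ z₀ ^ (i : ℕ) := fun i => by simp [T, hcj]
      simp only [this, Finset.prod_mul_distrib, Finset.prod_const, Finset.card_univ,
        Fintype.card_fin, Finset.prod_pow_eq_pow_sum]
      rw [Fin.sum_univ_eq_sum_range (fun l => l) n]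
    · intro i j hij
      have : ¬ i ≤ j := not_le.2 hij
      simp [T, this]
  simp only [wronskianDet]
  rw [hmul, Matrix.det_mul, hT, mul_comm]

/-- The row of the constant function is `(1, 0, …, 0)`, and expansion along it shifts the
derivatives of the other rows. This drives the induction on the number of functions. -/
theorem wronskianDet_cons_one {n : ℕ} (q : Fin n → ℂ → ℂ) (z : ℂ) :
    wronskianDet (Fin.cons (fun _ => 1) q : Fin (n + 1) → ℂ → ℂ) z =
      wronskianDet (fun i => deriv (q i)) z := by
  simp only [wronskianDet]
  rw [Matrix.det_succ_row_zero, Finset.sum_eq_single 0]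
  · simp only [Fin.val_zero, pow_zero, one_mul, Matrix.of_apply, Fin.cons_zero, iteratedDeriv_zero]
    congr 1
    ext i j
    simp [iteratedDeriv_succ']
  · intro j _ hj
    have hj' : (j : ℕ) ≠ 0 := fun h => hj (Fin.ext h)
    simp only [Matrix.of_apply, Fin.cons_zero]
    rw [iteratedDeriv_const, if_neg hj']
    simp
  · simp

/-- Analytic functions with vanishing Wronskian determinant are linearly dependent. -/
theorem exists_relation_of_wronskianDet_eq_zero {n : ℕ} : ∀ {f : Fin n → ℂ → ℂ} {U : Set ℂ},
    IsOpen U → IsPreconnected U → U.Nonempty → (∀ i, AnalyticOnNhd ℂ (f i) U) →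
    (∀ z ∈ U, wronskianDet f z = 0) → ∃ c : Fin n → ℂ, c ≠ 0 ∧ ∀ z ∈ U, ∑ i, c i * f i z = 0 := by
  induction n with
  | zero =>
    intro f U _ _ ⟨z, hz⟩ _ h
    simpa [wronskianDet] using h z hz
  | succ n ih =>
    intro f U hU hUc _ hf hW
    by_cases h0 : ∀ z ∈ U, f 0 z = 0
    · exact ⟨Pi.single 0 1, by simp, fun z hz => by simp [Pi.single_apply, h0 z hz]⟩
    push Not at h0
    obtain ⟨z₁, hz₁, hne⟩ := h0
    obtain ⟨r, hr, hB⟩ := Metric.eventually_nhds_iff_ball.1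
      ((hU.eventually_mem hz₁).and ((hf 0 z₁ hz₁).continuousAt.eventually_ne hne))
    set B := Metric.ball z₁ r
    have hBc : IsPreconnected B := (convex_ball z₁ r).isPreconnected
    -- Dividing by `f 0`, on a ball where it has no zero, makes the first function constant. The
    -- derivatives of the other quotients have vanishing Wronskian of smaller size; a relation among
    -- them integrates to one among the quotients, and the constant of integration becomes the
    -- coefficient of `f 0`.
    let q : Fin n → ℂ → ℂ := fun i z => (f 0 z)⁻¹ * f i.succ z
    have hq : ∀ i, AnalyticOnNhd ℂ (q i) B := fun i z hz =>
      ((hf 0 z (hB z hz).1).inv (hB z hz).2).mul (hf i.succ z (hB z hz).1)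
    have hWq : ∀ z ∈ B, wronskianDet (fun i => deriv (q i)) z = 0 := by
      intro z hz
      have h1 := wronskianDet_mul_comp (f := f) (ψ := id) ((hf 0 z (hB z hz).1).inv (hB z hz).2)
        analyticAt_id (fun i => hf i z (hB z hz).1)
      rw [id, hW z (hB z hz).1, mul_zero] at h1
      rw [← wronskianDet_cons_one, ← h1]
      refine wronskianDet_congr fun i => ?_
      refine Fin.cases ?_ (fun i => ?_) i
      · filter_upwards [Metric.isOpen_ball.eventually_mem hz] with w hw
        simp [(hB w hw).2]
      · rfl
    obtain ⟨c, hc, hcz⟩ := ih Metric.isOpen_ball hBc ⟨z₁, Metric.mem_ball_self hr⟩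
      (fun i => (hq i).deriv) hWq
    have hqd : ∀ z ∈ B, HasDerivAt (fun z => ∑ i, c i * q i z) 0 z := by
      intro z hz
      rw [← hcz z hz]
      exact HasDerivAt.fun_sum fun i _ => ((hq i z hz).differentiableAt.hasDerivAt).const_mul (c i)
    obtain ⟨a, ha⟩ := Metric.isOpen_ball.exists_is_const_of_deriv_eq_zero hBc
      (fun z hz => (hqd z hz).differentiableAt.differentiableWithinAt) (fun z hz => (hqd z hz).deriv)
    refine ⟨Fin.cons (-a) c, fun h => hc ?_, ?_⟩
    · ext i
      simpa using congrFun h i.succ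
    have han : AnalyticOnNhd ℂ (fun z => ∑ i, (Fin.cons (-a) c : Fin (n + 1) → ℂ) i * f i z) U :=
      fun z hz => Finset.analyticAt_fun_sum _ fun i _ => analyticAt_const.mul (hf i z hz)
    -- The relation was found on a small ball only; the identity theorem extends it to `U`.
    refine han.eqOn_zero_of_preconnected_of_eventuallyEq_zero hUc hz₁ ?_
    filter_upwards [Metric.ball_mem_nhds z₁ hr] with z hz
    have h1 := ha z hz
    have h2 := (hB z hz).2
    simp only [q] at h1
    rw [Fin.sum_univ_succ]
    simp only [Fin.cons_zero, Fin.cons_succ, Pi.zero_apply]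
    rw [← h1, neg_mul, Finset.sum_mul, neg_add_eq_zero]
    refine Finset.sum_congr rfl fun i _ => ?_
    field_simp

theorem exists_relation_of_eventually_wronskianDet_eq_zero {n : ℕ} {f : Fin n → ℂ → ℂ} {z₀ : ℂ}
    (hf : ∀ i, AnalyticAt ℂ (f i) z₀) (hW : ∀ᶠ z in 𝓝 z₀, wronskianDet f z = 0) :
    ∃ c : Fin n → ℂ, c ≠ 0 ∧ ∀ᶠ z in 𝓝 z₀, ∑ i, c i * f i z = 0 := by
  obtain ⟨r, hr, hB⟩ := Metric.eventually_nhds_iff_ball.1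
    (hW.and (eventually_all.2 fun i => (hf i).eventually_analyticAt))
  obtain ⟨c, hc, hcz⟩ := exists_relation_of_wronskianDet_eq_zero Metric.isOpen_ball
    (convex_ball z₀ r).isPreconnected ⟨z₀, Metric.mem_ball_self hr⟩
    (fun i z hz => (hB z hz).2 i) (fun z hz => (hB z hz).1)
  exact ⟨c, hc, by filter_upwards [Metric.ball_mem_nhds z₀ hr] with z hz using hcz z hz⟩

end Wronskian

/-! ### Local parameters on a Riemann surface -/

section LocalParam

variable {C : Type*} [TopologicalSpace C] [ChartedSpace ℂ C]

/-- The inverse of the preferred chart at `p`, centred at `p`. -/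
def localParam (p : C) (w : ℂ) : C := (chartAt ℂ p).symm (chartAt ℂ p p + w)

@[simp]
theorem localParam_zero (p : C) : localParam p 0 = p := by simp [localParam]

theorem eventually_mem_target (p : C) : ∀ᶠ w in 𝓝 (0 : ℂ),
    chartAt ℂ p p + w ∈ (chartAt ℂ p).target := by
  have : Tendsto (fun w => chartAt ℂ p p + w) (𝓝 0) (𝓝 (chartAt ℂ p p)) :=
    (continuous_const_add (chartAt ℂ p p)).tendsto' _ _ (add_zero _)
  exact this.eventually ((chartAt ℂ p).open_target.eventually_mem (mem_chart_target ℂ p))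

theorem map_localParam_nhds (p : C) : map (localParam p) (𝓝 0) = 𝓝 p := by
  have h : map (fun w => chartAt ℂ p p + w) (𝓝 0) = 𝓝 (chartAt ℂ p p) := by
    simp
  have := (chartAt ℂ p).symm.map_nhds_eq (mem_chart_target ℂ p)
  rw [← h, map_map, (chartAt ℂ p).left_inv (mem_chart_source ℂ p)] at this
  exact this

theorem tendsto_localParam (p : C) : Tendsto (localParam p) (𝓝 0) (𝓝 p) :=
  (map_localParam_nhds p).le

theorem eventually_nhds_iff_localParam {p : C} {P : C → Prop} :
    (∀ᶠ q in 𝓝 p, P q) ↔ ∀ᶠ w in 𝓝 (0 : ℂ), P (localParam p w) := by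
  rw [← map_localParam_nhds p, eventually_map]

theorem eventually_mem_chart_source (p : C) : ∀ᶠ w in 𝓝 (0 : ℂ),
    localParam p w ∈ (chartAt ℂ p).source :=
  (tendsto_localParam p).eventually
    ((chartAt ℂ p).open_source.eventually_mem (mem_chart_source ℂ p))

variable [IsManifold 𝓘(ℂ) ω C]

theorem analyticAt_chart_transition (p q : C) {z : ℂ} (hz : z ∈ (chartAt ℂ q).target)
    (hz' : (chartAt ℂ q).symm z ∈ (chartAt ℂ p).source) :
    AnalyticAt ℂ (fun w => chartAt ℂ p ((chartAt ℂ q).symm w)) z := by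
  have h := contDiffWithinAt_ext_coord_change (I := 𝓘(ℂ)) (n := ω) p q (y := z) (by
    simp [hz, hz'])
  have h2 : ContDiffAt ℂ ω (fun w => chartAt ℂ p ((chartAt ℂ q).symm w)) z := by
    simpa [contDiffWithinAt_univ, Function.comp_def] using h
  exact h2.analyticAt

/-- The parameter at a nearby point and the one at `p` differ by a local biholomorphism. This is the
device that turns statements in the single parameter at `p` into statements about all nearby points.
-/
theorem exists_transition (p : C) : ∀ᶠ w in 𝓝 (0 : ℂ), ∃ ψ : ℂ → ℂ, AnalyticAt ℂ ψ 0 ∧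
    ψ 0 = w ∧ deriv ψ 0 ≠ 0 ∧
    localParam (localParam p w) =ᶠ[𝓝 0] fun u => localParam p (ψ u) := by
  filter_upwards [eventually_mem_target p, eventually_mem_chart_source p] with w hw hs
  set q := localParam p w
  have hqq := mem_chart_target ℂ q
  let χ : ℂ → ℂ := fun v => chartAt ℂ q ((chartAt ℂ p).symm v)
  let θ : ℂ → ℂ := fun v => chartAt ℂ p ((chartAt ℂ q).symm v)
  have hθ : AnalyticAt ℂ θ (chartAt ℂ q q) :=
    analyticAt_chart_transition p q hqq (by simpa using hs)
  have hχ : AnalyticAt ℂ χ (chartAt ℂ p p + w) :=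
    analyticAt_chart_transition q p hw (mem_chart_source ℂ q)
  have hθq : θ (chartAt ℂ q q) = chartAt ℂ p p + w := by
    simp only [θ, (chartAt ℂ q).left_inv (mem_chart_source ℂ q)]
    exact (chartAt ℂ p).right_inv hw
  have hχw : χ (chartAt ℂ p p + w) = chartAt ℂ q q := rfl
  have hdθ : HasDerivAt θ (deriv θ (chartAt ℂ q q)) (chartAt ℂ q q) :=
    hθ.differentiableAt.hasDerivAt
  have hinv : (fun v => θ (χ v)) =ᶠ[𝓝 (chartAt ℂ p p + w)] id := by
    have h1 : ∀ᶠ v in 𝓝 (chartAt ℂ p p + w), (chartAt ℂ p).symm v ∈ (chartAt ℂ q).source :=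
      ((chartAt ℂ p).continuousAt_symm hw).eventually
        ((chartAt ℂ q).open_source.eventually_mem (mem_chart_source ℂ q))
    filter_upwards [h1, (chartAt ℂ p).open_target.eventually_mem hw] with v hv hv'
    simp only [θ, χ, (chartAt ℂ q).left_inv hv, (chartAt ℂ p).right_inv hv', id]
  have hne : deriv θ (chartAt ℂ q q) ≠ 0 := by
    intro h0
    have h1 : HasDerivAt (fun v => θ (χ v)) (deriv θ (chartAt ℂ q q) *
        deriv χ (chartAt ℂ p p + w)) (chartAt ℂ p p + w) :=
      HasDerivAt.comp (h₂ := θ) _ hdθ hχ.differentiableAt.hasDerivAt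
    rw [h0, zero_mul] at h1
    have h2 := (h1.congr_of_eventuallyEq hinv.symm).unique (hasDerivAt_id _)
    exact one_ne_zero h2.symm
  have hθ' : AnalyticAt ℂ (fun u => θ (chartAt ℂ q q + u)) 0 :=
    AnalyticAt.comp (g := θ) (f := fun u => chartAt ℂ q q + u) (by simpa using hθ)
      (analyticAt_const.add analyticAt_id)
  refine ⟨fun u => θ (chartAt ℂ q q + u) - chartAt ℂ p p, hθ'.sub analyticAt_const, ?_, ?_, ?_⟩
  · simp [hθq]
  · rw [deriv_sub_const, deriv_comp_const_add, add_zero]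
    exact hne
  · have h1 : ∀ᶠ u in 𝓝 (0 : ℂ), localParam q u ∈ (chartAt ℂ p).source :=
      (tendsto_localParam q).eventually ((chartAt ℂ p).open_source.eventually_mem hs)
    filter_upwards [h1] with u hu
    simp only [localParam, θ, add_sub_cancel]
    exact ((chartAt ℂ p).left_inv hu).symm

/-- A function on a compact connected Riemann surface that is holomorphic in all local parameters
is constant. -/
theorem exists_eq_const_of_analyticAt [CompactSpace C] [PreconnectedSpace C] {h : C → ℂ}
    (hh : ∀ p, AnalyticAt ℂ (fun w => h (localParam p w)) 0) : ∃ c, ∀ p, h p = c := by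
  have : IsManifold 𝓘(ℂ) 1 C := IsManifold.of_le (n := ω) le_top
  have hd : MDifferentiable 𝓘(ℂ) 𝓘(ℂ) h := by
    intro p
    rw [mdifferentiableAt_iff]
    have hchart : (fun z => h ((chartAt ℂ p).symm z)) =
        (fun w => h (localParam p w)) ∘ fun z => z - chartAt ℂ p p := by
      ext z
      simp [localParam]
    have han : AnalyticAt ℂ (fun z => h ((chartAt ℂ p).symm z)) (chartAt ℂ p p) := by
      rw [hchart]
      exact AnalyticAt.comp (by simpa using hh p) (analyticAt_id.sub analyticAt_const)
    constructor
    · have h1 : Tendsto (fun w => h (localParam p w)) (𝓝 0) (𝓝 (h p)) := by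
        simpa using (hh p).continuousAt.tendsto
      rw [ContinuousAt, ← map_localParam_nhds p, tendsto_map'_iff]
      exact h1
    · exact han.differentiableAt.differentiableWithinAt
  obtain ⟨v, hv⟩ := hd.exists_eq_const_of_compactSpace
  exact ⟨v, fun p => by rw [hv]; rfl⟩

end LocalParam

/-! ### Holomorphic curves given by local lifts -/

section CurveLift

/-- The proportionality factor is a quotient of values of a linear form that does not vanish on `b
z`, hence analytic; the relation extends over the puncture by continuity. -/
theorem exists_smul_of_mem_span {V : Type*} [NormedAddCommGroup V] [NormedSpace ℂ V]
    {a b : ℂ → V} {z : ℂ} (ha : AnalyticAt ℂ a z) (hb : AnalyticAt ℂ b z) (ha0 : a z ≠ 0)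
    (hb0 : b z ≠ 0) (h : ∀ᶠ w in 𝓝[≠] z, a w ∈ Submodule.span ℂ {b w}) :
    ∃ g : ℂ → ℂ, AnalyticAt ℂ g z ∧ g z ≠ 0 ∧ a =ᶠ[𝓝 z] fun w => g w • b w := by
  obtain ⟨l, hl⟩ := exists_clm_eq_one hb0
  have hla : AnalyticAt ℂ (fun w => l (a w)) z := (l.analyticAt _).comp ha
  have hlb : AnalyticAt ℂ (fun w => l (b w)) z := (l.analyticAt _).comp hb
  have hlb0 : l (b z) ≠ 0 := by rw [hl]; exact one_ne_zero
  have hg : AnalyticAt ℂ (fun w => l (a w) / l (b w)) z := hla.div hlb hlb0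
  have heq : a =ᶠ[𝓝 z] fun w => (l (a w) / l (b w)) • b w := by
    refine (ContinuousAt.eventuallyEq_nhds_iff_eventuallyEq_nhdsNE ha.continuousAt
      (hg.smul hb).continuousAt).1 ?_
    filter_upwards [h, (hlb.continuousAt.eventually_ne hlb0).filter_mono nhdsWithin_le_nhds]
      with w hw hw0
    obtain ⟨c, hc⟩ := Submodule.mem_span_singleton.1 hw
    change a w = (l (a w) / l (b w)) • b w
    rw [← hc, map_smul, smul_eq_mul, mul_div_assoc, div_self hw0, mul_one]
  refine ⟨_, hg, fun h0 => ha0 ?_, heq⟩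
  have := heq.self_of_nhds
  simp only [h0, zero_smul] at this
  exact this

variable {C : Type*} [TopologicalSpace C] [ChartedSpace ℂ C]
variable {V : Type*} [NormedAddCommGroup V] [NormedSpace ℂ V]

/-- A family of local lifts of a holomorphic map from a Riemann surface to projective space:
`G p` is a lift in the local parameter at `p`, and different lifts differ by an invertible
function. -/
structure IsCurveLift (G : C → ℂ → V) : Prop where
  analytic : ∀ p, AnalyticAt ℂ (G p) 0
  ne_zero : ∀ p, G p 0 ≠ 0
  compat : ∀ p, ∀ᶠ w in 𝓝 (0 : ℂ), ∃ g ψ : ℂ → ℂ, AnalyticAt ℂ g 0 ∧ g 0 ≠ 0 ∧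
    AnalyticAt ℂ ψ 0 ∧ ψ 0 = w ∧ deriv ψ 0 ≠ 0 ∧
    localParam (localParam p w) =ᶠ[𝓝 0] (fun u => localParam p (ψ u)) ∧
    G (localParam p w) =ᶠ[𝓝 0] fun u => g u • G p (ψ u)

theorem IsCurveLift.comp {W : Type*} [NormedAddCommGroup W] [NormedSpace ℂ W] {G : C → ℂ → V}
    (hG : IsCurveLift G) (L : V →L[ℂ] W) (hL : ∀ p, L (G p 0) ≠ 0) :
    IsCurveLift fun p w => L (G p w) where
  analytic p := (L.analyticAt _).comp (hG.analytic p)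
  ne_zero := hL
  compat p := by
    filter_upwards [hG.compat p] with w ⟨g, ψ, h₁, h₂, h₃, h₄, h₅, h₆, h₇⟩
    refine ⟨g, ψ, h₁, h₂, h₃, h₄, h₅, h₆, ?_⟩
    filter_upwards [h₇] with u hu
    rw [hu, map_smul]

theorem IsHolomorphicEmbedding.exists_isCurveLift [CompleteSpace V] [IsManifold 𝓘(ℂ) ω C]
    {φ : C → Projectivization ℂ V} (hφ : IsHolomorphicEmbedding φ) :
    ∃ G : C → ℂ → V, IsCurveLift G ∧ (∀ p, IsImmersiveLiftAt (G p) 0) ∧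
      ∀ p, ∀ᶠ w in 𝓝 (0 : ℂ), (φ (localParam p w)).submodule = Submodule.span ℂ {G p w} := by
  choose F hF hFφ using hφ.immersion
  let G : C → ℂ → V := fun p w => F p (chartAt ℂ p p + w)
  have himm : ∀ p, IsImmersiveLiftAt (G p) 0 := by
    intro p
    obtain ⟨h1, h2⟩ := isImmersiveLiftAt_iff_deriv.1 (hF p)
    rw [isImmersiveLiftAt_iff_deriv]
    refine ⟨AnalyticAt.comp (g := F p) (f := fun w => chartAt ℂ p p + w) (by simpa using h1)
      (analyticAt_const.add analyticAt_id), ?_⟩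
    simp only [G]
    rw [deriv_comp_const_add, add_zero]
    exact h2
  have hlift : ∀ p, ∀ᶠ w in 𝓝 (0 : ℂ),
      (φ (localParam p w)).submodule = Submodule.span ℂ {G p w} := by
    intro p
    have : Tendsto (fun w => chartAt ℂ p p + w) (𝓝 0) (𝓝 (chartAt ℂ p p)) :=
      (continuous_const_add (chartAt ℂ p p)).tendsto' _ _ (add_zero _)
    exact this.eventually (hFφ p)
  refine ⟨G, ⟨fun p => (himm p).1, fun p => (himm p).ne_zero, fun p => ?_⟩, himm, hlift⟩
  filter_upwards [exists_transition p, (himm p).1.eventually_analyticAt,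
    (himm p).1.continuousAt.eventually_ne (himm p).ne_zero, (hlift p).eventually_nhds]
    with w ⟨ψ, hψ, hψ0, hψ', hloc⟩ han hne hl
  have hGψ : AnalyticAt ℂ (fun u => G p (ψ u)) 0 :=
    AnalyticAt.comp (g := G p) (f := ψ) (by rwa [hψ0]) hψ
  obtain ⟨g, hg, hg0, hgG⟩ := exists_smul_of_mem_span (himm (localParam p w)).1 hGψ
    (himm (localParam p w)).ne_zero (by rwa [hψ0]) (by
      have h1 : ∀ᶠ u in 𝓝 (0 : ℂ),
          (φ (localParam p (ψ u))).submodule = Submodule.span ℂ {G p (ψ u)} :=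
        (hψ0 ▸ hψ.continuousAt.tendsto : Tendsto ψ (𝓝 0) (𝓝 w)).eventually hl
      refine Eventually.filter_mono nhdsWithin_le_nhds ?_
      filter_upwards [h1, hloc, hlift (localParam p w)] with u hu hu' hu''
      rw [← hu, ← hu', hu'']
      exact Submodule.mem_span_singleton_self _)
  exact ⟨g, ψ, hg, hg0, hψ, hψ0, hψ', hloc, hgG⟩

/-- A homogeneous analytic function of degree `e`. -/
structure IsForm (e : ℕ) (u : V → ℂ) : Prop where
  analytic : ∀ v, AnalyticAt ℂ u v
  smul : ∀ (c : ℂ) v, u (c • v) = c ^ e * u v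

theorem ContinuousLinearMap.isForm (l : V →L[ℂ] ℂ) : IsForm 1 (fun v => l v) :=
  ⟨fun v => l.analyticAt v, fun c v => by simp⟩

theorem IsForm.mul {e e' : ℕ} {u u' : V → ℂ} (h : IsForm e u) (h' : IsForm e' u') :
    IsForm (e + e') fun v => u v * u' v :=
  ⟨fun v => (h.analytic v).mul (h'.analytic v), fun c v => by rw [h.smul, h'.smul]; ring⟩

theorem IsForm.sum {e : ℕ} {ι : Type*} (s : Finset ι) (c : ι → ℂ) {u : ι → V → ℂ}
    (h : ∀ i, IsForm e (u i)) : IsForm e fun v => ∑ i ∈ s, c i * u i v :=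
  ⟨fun v => Finset.analyticAt_fun_sum _ fun i _ => analyticAt_const.mul ((h i).analytic v),
    fun a v => by
      rw [Finset.mul_sum]
      exact Finset.sum_congr rfl fun i _ => by rw [(h i).smul]; ring⟩

namespace IsCurveLift

variable {G : C → ℂ → V} (hG : IsCurveLift G)
include hG

theorem analyticAt_form {e : ℕ} {u : V → ℂ} (hu : IsForm e u) (p : C) :
    AnalyticAt ℂ (fun w => u (G p w)) 0 :=
  AnalyticAt.comp (g := u) (f := G p) (hu.analytic _) (hG.analytic p)

theorem eventually_apply_zero (p : C) : ∀ᶠ w in 𝓝 (0 : ℂ), ∃ c : ℂ, c ≠ 0 ∧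
    G (localParam p w) 0 = c • G p w := by
  filter_upwards [hG.compat p] with w ⟨g, ψ, _, h₂, _, h₄, _, _, h₇⟩
  exact ⟨g 0, h₂, by simpa [h₄] using h₇.self_of_nhds⟩

/-- The identity theorem for forms along a holomorphic curve. -/
theorem eventually_ne_zero [PreconnectedSpace C] {e : ℕ} {u : V → ℂ} (hu : IsForm e u)
    (hne : ∃ p, u (G p 0) ≠ 0) (p : C) : ∀ᶠ w in 𝓝[≠] (0 : ℂ), u (G p w) ≠ 0 := by
  -- The set of points near which the form vanishes identically is open by the transition maps, and
  -- closed because zeros of a nonzero germ are isolated; connectedness then decides.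
  let Z : Set C := {p | ∀ᶠ w in 𝓝 (0 : ℂ), u (G p w) = 0}
  have hopen : IsOpen Z := by
    rw [isOpen_iff_mem_nhds]
    intro p hp
    change ∀ᶠ q in 𝓝 p, q ∈ Z
    rw [eventually_nhds_iff_localParam]
    filter_upwards [hG.compat p, eventually_eventually_nhds.2 hp]
      with w ⟨g, ψ, _, _, h₃, h₄, _, _, h₇⟩ hw
    have h1 : ∀ᶠ v in 𝓝 (0 : ℂ), u (G p (ψ v)) = 0 :=
      (h₄ ▸ h₃.continuousAt.tendsto : Tendsto ψ (𝓝 0) (𝓝 w)).eventually hw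
    change ∀ᶠ v in 𝓝 (0 : ℂ), u (G (localParam p w) v) = 0
    filter_upwards [h1, h₇] with v hv hv'
    rw [hv', hu.smul, hv, mul_zero]
  have hclosed : IsClosed Z := by
    rw [← isOpen_compl_iff, isOpen_iff_mem_nhds]
    intro p hp
    change ∀ᶠ q in 𝓝 p, q ∈ Zᶜ
    rw [eventually_nhds_iff_localParam]
    have h1 : ∀ᶠ w in 𝓝[≠] (0 : ℂ), u (G p w) ≠ 0 :=
      (hG.analyticAt_form hu p).eventually_eq_zero_or_eventually_ne_zero.resolve_left hp
    rw [eventually_nhdsWithin_iff] at h1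
    filter_upwards [h1, hG.eventually_apply_zero p] with w hw ⟨c, hc, hcw⟩
    by_cases hw0 : w = 0
    · subst hw0; simpa using hp
    · intro hmem
      have h2 : u (G (localParam p w) 0) = 0 := Eventually.self_of_nhds (p := fun v => u (G (localParam p w) v) = 0) hmem
      rw [hcw, hu.smul] at h2
      exact hw hw0 ((mul_eq_zero.1 h2).resolve_left (pow_ne_zero _ hc))
  refine (hG.analyticAt_form hu p).eventually_eq_zero_or_eventually_ne_zero.resolve_left ?_
  intro hp
  have huniv : Z = Set.univ := IsClopen.eq_univ ⟨hclosed, hopen⟩ ⟨p, hp⟩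
  obtain ⟨q, hq⟩ := hne
  have : q ∈ Z := huniv ▸ Set.mem_univ q
  exact hq (Eventually.self_of_nhds (p := fun v => u (G q v) = 0) this)

/-- A Wronskian vanishing identically near one point gives a local linear relation among the forms;
the identity theorem makes it global, against independence. -/
theorem eventually_wronskianDet_ne_zero [PreconnectedSpace C] {e n : ℕ} {u : Fin n → V → ℂ}
    (hu : ∀ i, IsForm e (u i))
    (hind : ∀ c : Fin n → ℂ, (∀ p, ∑ i, c i * u i (G p 0) = 0) → c = 0) (p : C) :
    ∀ᶠ w in 𝓝[≠] (0 : ℂ), wronskianDet (fun i w => u i (G p w)) w ≠ 0 := by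
  refine (analyticAt_wronskianDet fun i => hG.analyticAt_form (hu i)
    p).eventually_eq_zero_or_eventually_ne_zero.resolve_left fun h0 => ?_
  obtain ⟨c, hc, hcz⟩ := exists_relation_of_eventually_wronskianDet_eq_zero
    (fun i => hG.analyticAt_form (hu i) p) h0
  have hex : ∃ q, ∑ i, c i * u i (G q 0) ≠ 0 := by
    by_contra hcon
    push Not at hcon
    exact hc (hind c hcon)
  have := hG.eventually_ne_zero (IsForm.sum Finset.univ c hu) hex p
  obtain ⟨w, hw, hw'⟩ := (this.and (hcz.filter_mono nhdsWithin_le_nhds)).exists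
  exact hw hw'

omit hG in
-- The Wronskian of `n` forms of degree `e` transforms as a section of the `en`-th power of the
-- hyperplane bundle times the `n(n-1)/2`-th power of the canonical bundle.
theorem wronskianDet_localParam {e n : ℕ} {u : Fin n → V → ℂ} (hu : ∀ i, IsForm e (u i))
    (p : C) {w : ℂ} (hw : AnalyticAt ℂ (G p) w) {g ψ : ℂ → ℂ} (hg : AnalyticAt ℂ g 0)
    (hψ : AnalyticAt ℂ ψ 0) (hψ0 : ψ 0 = w)
    (h : G (localParam p w) =ᶠ[𝓝 0] fun v => g v • G p (ψ v)) :
    wronskianDet (fun i v => u i (G (localParam p w) v)) 0 =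
      (g 0 ^ e) ^ n * deriv ψ 0 ^ (∑ j ∈ Finset.range n, j) *
        wronskianDet (fun i v => u i (G p v)) w := by
  have h1 := wronskianDet_mul_comp (f := fun i v => u i (G p v)) (hg.pow e) hψ (fun i =>
    AnalyticAt.comp (g := u i) (f := G p) ((hu i).analytic _) (by rwa [hψ0]))
  rw [hψ0] at h1
  simp only [Pi.pow_apply] at h1
  rw [← h1]
  refine wronskianDet_congr fun i => ?_
  filter_upwards [h] with v hv
  rw [hv, (hu i).smul]

end IsCurveLift

end CurveLift

/-! ### Holomorphic curves without inflection points -/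

section Flexless

variable {V : Type*} [NormedAddCommGroup V] [NormedSpace ℂ V] [FiniteDimensional ℂ V]

/-- The Wronskian of the coordinate functions is the determinant, in the basis `b`, of the vectors
of derivatives. -/
theorem wronskianDet_coord_ne_zero_iff {n : ℕ} (b : Module.Basis (Fin n) ℂ V) {F : ℂ → V} {z : ℂ}
    (hF : AnalyticAt ℂ F z) :
    wronskianDet (fun i w => b.coord i (F w)) z ≠ 0 ↔
      ⊤ ≤ Submodule.span ℂ (Set.range fun j : Fin n => iteratedDeriv j F z) := by
  have h1 : wronskianDet (fun i w => b.coord i (F w)) z =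
      b.det fun j : Fin n => iteratedDeriv j F z := by
    rw [Module.Basis.det_apply, wronskianDet]
    congr 1
    ext i j
    exact iteratedDeriv_clm_comp (LinearMap.toContinuousLinearMap (b.coord i)) hF j
  rw [h1, ← isUnit_iff_ne_zero, ← Module.Basis.is_basis_iff_det]
  refine ⟨fun h => h.2.ge, fun h => ⟨?_, top_le_iff.1 h⟩⟩
  exact linearIndependent_of_top_le_span_of_card_eq_finrank h
    (Module.finrank_eq_card_basis b).symm

/-- Functions with vanishing orders `0, 1, …, n - 1` have a triangular matrix of derivatives with
nonzero diagonal. -/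
theorem eq_zero_of_analyticOrderAt_eq {n : ℕ} {f : Fin n → ℂ → ℂ}
    (hf : ∀ k, AnalyticAt ℂ (f k) 0) (ho : ∀ k : Fin n, analyticOrderAt (f k) 0 = (k : ℕ))
    {c : Fin n → ℂ} (hc : ∀ᶠ w in 𝓝 (0 : ℂ), ∑ k, c k * f k w = 0) : c = 0 := by
  have hj : ∀ j : ℕ, ∑ k, c k * iteratedDeriv j (f k) 0 = 0 := by
    intro j
    have h1 : iteratedDeriv j (fun w => ∑ k, c k * f k w) 0 = 0 := by
      rw [EventuallyEq.iteratedDeriv_eq (g := fun _ => 0) j hc]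
      simp
    have h2 : ∀ k ∈ Finset.univ, ContDiffAt ℂ j (fun w => c k * f k w) 0 :=
      fun k _ => (analyticAt_const.mul (hf k)).contDiffAt
    rw [iteratedDeriv_fun_sum h2] at h1
    refine Eq.trans (Finset.sum_congr rfl fun k _ => ?_) h1
    rw [iteratedDeriv_const_mul_field]
  have hord := fun k => (analyticOrderAt_eq_nat_iff_iteratedDeriv_eq_zero (hf k)).1 (ho k)
  have key : ∀ j : ℕ, ∀ h : j < n, c ⟨j, h⟩ = 0 := by
    intro j
    induction j using Nat.strong_induction_on with
    | _ j ih =>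
      intro h
      have h1 := hj j
      rw [Finset.sum_eq_single ⟨j, h⟩] at h1
      · exact (mul_eq_zero.1 h1).resolve_right (hord ⟨j, h⟩).2
      · intro k _ hk
        rcases lt_trichotomy (k : ℕ) j with hlt | heq | hgt
        · rw [ih k hlt k.2, zero_mul]
        · exact absurd (Fin.ext heq) hk
        · rw [(hord k).1 j hgt, mul_zero]
      · simp
  ext k
  exact key k k.2

variable {C : Type*} [TopologicalSpace C] [ChartedSpace ℂ C] {G : C → ℂ → V}

omit [FiniteDimensional ℂ V] in
theorem IsCurveLift.eventually_form_eq_zero (hG : IsCurveLift G) {e : ℕ} {u : V → ℂ}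
    (hu : IsForm e u) (h : ∀ p, u (G p 0) = 0) (p : C) : ∀ᶠ w in 𝓝 (0 : ℂ), u (G p w) = 0 := by
  filter_upwards [hG.eventually_apply_zero p] with w ⟨c, hc, hcw⟩
  have := h (localParam p w)
  rw [hcw, hu.smul] at this
  exact (mul_eq_zero.1 this).resolve_left (pow_ne_zero _ hc)

variable [IsManifold 𝓘(ℂ) ω C] [CompactSpace C] [PreconnectedSpace C]

/-- A curve in `ℙ^m` without inflection points imposes at most `2m+1` conditions on quadrics. -/
theorem IsCurveLift.exists_quadric_relation (hG : IsCurveLift G) {m : ℕ}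
    {l : Fin (m + 1) → V → ℂ} (hl : ∀ i, IsForm 1 (l i))
    (hflex : ∀ p, wronskianDet (fun i w => l i (G p w)) 0 ≠ 0)
    {u : Fin (2 * m + 2) → V → ℂ} (hu : ∀ i, IsForm 2 (u i))
    {s : V → ℂ} (hs : IsForm 1 s) {p₀ p₁ : C} (hs₀ : s (G p₀ 0) = 0) (hs₁ : s (G p₁ 0) ≠ 0) :
    ∃ c : Fin (2 * m + 2) → ℂ, c ≠ 0 ∧ ∀ p, ∑ i, c i * u i (G p 0) = 0 := by
  by_contra hcon
  have hind : ∀ c : Fin (2 * m + 2) → ℂ, (∀ p, ∑ i, c i * u i (G p 0) = 0) → c = 0 := by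
    intro c hc
    by_contra hne
    exact hcon ⟨c, hne, hc⟩
  -- The exponents are chosen so that both weights cancel: the canonical weight is `m(m+1)(2m+1)`
  -- above and below, and the scaling weight is `4m(m+1) + (2m+2) = (m+1)(4m+2)`. Thus `K` at the
  -- origin of each parameter is a global function, holomorphic since the denominator never
  -- vanishes. The factor `s` makes it vanish at `p₀`.
  let K : C → ℂ → ℂ := fun p w => wronskianDet (fun i v => u i (G p v)) w ^ m *
    s (G p w) ^ (2 * m + 2) / wronskianDet (fun i v => l i (G p v)) w ^ (4 * m + 2)
  have hK : ∀ p, AnalyticAt ℂ (K p) 0 := by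
    intro p
    have h1 := analyticAt_wronskianDet fun i => hG.analyticAt_form (hu i) p
    have h2 := analyticAt_wronskianDet fun i => hG.analyticAt_form (hl i) p
    have h3 := hG.analyticAt_form hs p
    exact ((h1.pow m).mul (h3.pow _)).div (h2.pow _) (pow_ne_zero _ (hflex p))
  have hKloc : ∀ p, (fun w => K (localParam p w) 0) =ᶠ[𝓝 0] K p := by
    intro p
    filter_upwards [hG.compat p, (hG.analytic p).eventually_analyticAt]
      with w ⟨g, ψ, h₁, h₂, h₃, h₄, h₅, _, h₇⟩ han
    have e₁ := IsCurveLift.wronskianDet_localParam hu p han h₁ h₃ h₄ h₇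
    have e₂ := IsCurveLift.wronskianDet_localParam hl p han h₁ h₃ h₄ h₇
    have e₃ : s (G (localParam p w) 0) = g 0 * s (G p w) := by
      have := h₇.self_of_nhds
      rw [this, hs.smul, pow_one, h₄]
    have e₄ : (∑ j ∈ Finset.range (2 * m + 2), j) * m =
        (∑ j ∈ Finset.range (m + 1), j) * (4 * m + 2) := by
      have a₁ := Finset.sum_range_id_mul_two (2 * m + 2)
      have a₂ := Finset.sum_range_id_mul_two (m + 1)
      simp only [Nat.add_sub_cancel, show 2 * m + 2 - 1 = 2 * m + 1 by lia] at a₁ a₂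
      have : (∑ j ∈ Finset.range (2 * m + 2), j) * 2 * m =
          (∑ j ∈ Finset.range (m + 1), j) * 2 * (4 * m + 2) := by
        rw [a₁, a₂]; ring
      nlinarith
    simp only [K]
    rw [e₁, e₂, e₃]
    simp only [mul_pow, ← pow_mul]
    rw [e₄]
    have hne₂ : deriv ψ 0 ^ ((∑ j ∈ Finset.range (m + 1), j) * (4 * m + 2)) ≠ 0 :=
      pow_ne_zero _ h₅
    have e₅ : g 0 ^ (1 * (m + 1) * (4 * m + 2)) =
        g 0 ^ (2 * (2 * m + 2) * m) * g 0 ^ (2 * m + 2) := by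
      rw [← pow_add]
      congr 1
      ring
    rw [e₅]
    have hne₃ : g 0 ^ (2 * (2 * m + 2) * m) ≠ 0 := pow_ne_zero _ h₂
    have hne₄ : g 0 ^ (2 * m + 2) ≠ 0 := pow_ne_zero _ h₂
    refine Eq.trans ?_ (mul_div_mul_left _ _ (mul_ne_zero (mul_ne_zero hne₃ hne₄) hne₂))
    congr 1
    · ring
  obtain ⟨c, hc⟩ := exists_eq_const_of_analyticAt (h := fun p => K p 0)
    fun p => (hK p).congr (hKloc p).symm
  have hc0 : c = 0 := by
    rw [← hc p₀]
    simp [K, hs₀]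
  obtain ⟨w, h1, h2, h3, h4⟩ := ((hG.eventually_wronskianDet_ne_zero hu hind p₁).and
    ((hG.eventually_ne_zero hs ⟨p₁, hs₁⟩ p₁).and
    (((hKloc p₁).filter_mono nhdsWithin_le_nhds).and
    (((analyticAt_wronskianDet fun i => hG.analyticAt_form (hl i)
      p₁).continuousAt.eventually_ne (hflex p₁)).filter_mono nhdsWithin_le_nhds)))).exists
  have h5 : K p₁ w = 0 := by rw [← h3]; exact (hc _).trans hc0
  exact (div_ne_zero (mul_ne_zero (pow_ne_zero _ h1) (pow_ne_zero _ h2)) (pow_ne_zero _ h4)) h5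

/-- An osculating hyperplane of a curve without inflection points meets the curve only at the
point of osculation. -/
theorem IsCurveLift.apply_ne_zero_of_osculating (hG : IsCurveLift G) {m : ℕ} (hm : 2 ≤ m)
    (hV : Module.finrank ℂ V = m + 1) (hflex : ∀ p, jetSpan (m + 1) (G p) = ⊤)
    (hinj : ∀ p q, G p 0 ∈ Submodule.span ℂ {G q 0} → p = q) {p : C} {s : V →L[ℂ] ℂ}
    (hs : ∀ j < m, s (iteratedDeriv j (G p) 0) = 0) (hsm : s (iteratedDeriv m (G p) 0) ≠ 0)
    {q : C} (hq : q ≠ p) : s (G q 0) ≠ 0 := by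
  intro hsq
  let b₀ : Module.Basis (Fin (m + 1)) ℂ V := Module.finBasisOfFinrankEq ℂ V hV
  let B : Module.Basis (Fin (m + 1)) ℂ V := Module.Basis.mk
    (linearIndependent_of_top_le_span_of_card_eq_finrank (hflex p).ge (by simp [hV]))
    (hflex p).ge
  have hB : ∀ j, B j = iteratedDeriv j (G p) 0 := fun j => Module.Basis.mk_apply _ _ j
  -- Linear forms with vanishing orders exactly `0, …, m` at `p`: the dual basis of the derivatives
  -- below index `m`, and the given osculating form at index `m`.
  let t : ℕ → V →L[ℂ] ℂ := fun i =>
    if h : i < m then LinearMap.toContinuousLinearMap (B.coord ⟨i, by lia⟩) else s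
  have ht : ∀ i ≤ m, analyticOrderAt (fun w => t i (G p w)) 0 = i := by
    intro i hi
    rw [analyticOrderAt_eq_nat_iff_iteratedDeriv_eq_zero
      (hG.analyticAt_form (t i).isForm p)]
    simp only [iteratedDeriv_clm_comp (t i) (hG.analytic p)]
    by_cases h : i < m
    · have h1 : ∀ j (hj : j < m + 1), t i (iteratedDeriv j (G p) 0) = if j = i then 1 else 0 := by
        intro j hj
        rw [show iteratedDeriv j (G p) 0 = B ⟨j, hj⟩ from (hB ⟨j, hj⟩).symm]
        simp [t, h, Finsupp.single_apply, Fin.ext_iff]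
      refine ⟨fun j hj => ?_, ?_⟩
      · rw [h1 j (by lia), if_neg (by lia)]
      · rw [h1 i (by lia), if_pos rfl]; exact one_ne_zero
    · obtain rfl : i = m := by lia
      simpa [t] using ⟨hs, hsm⟩
  have htm : t m = s := by simp [t]
  have hpq : G p 0 ∉ Submodule.span ℂ {G q 0} := fun h => hq (hinj p q h).symm
  obtain ⟨u₀, hu₀, hu₀'⟩ := Submodule.exists_le_ker_of_notMem hpq
  let u : V →L[ℂ] ℂ := LinearMap.toContinuousLinearMap u₀
  have hup : u (G p 0) ≠ 0 := hu₀
  have huq : u (G q 0) = 0 := hu₀' (Submodule.mem_span_singleton_self _)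
  obtain ⟨v, hv⟩ := exists_clm_eq_one (hG.ne_zero q)
  -- The quadrics `u t₀, …, u t_m, s t₁, …, s t_m` have orders `0, …, 2m` at `p`, since `u` does not
  -- vanish there and `s` has order `m`. All vanish at `q`, because `u` and `s` do; together with
  -- the square of a form nonzero at `q` they are `2m + 2` quadrics independent on the curve.
  let e : Fin (2 * m + 1) → V → ℂ := fun k x =>
    (if (k : ℕ) ≤ m then u x else s x) * t (if (k : ℕ) ≤ m then k else k - m) x
  have he : ∀ k, IsForm 2 (e k) := by
    intro k
    by_cases hk : (k : ℕ) ≤ m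
    · simpa [e, hk] using u.isForm.mul (t k).isForm
    · simpa [e, hk] using s.isForm.mul (t (k - m)).isForm
  have heo : ∀ k, analyticOrderAt (fun w => e k (G p w)) 0 = (k : ℕ) := by
    intro k
    by_cases hk : (k : ℕ) ≤ m
    · have h1 : analyticOrderAt (fun w => u (G p w)) 0 = 0 :=
        (hG.analyticAt_form u.isForm p).analyticOrderAt_eq_zero.2 hup
      have h2 := analyticOrderAt_mul (hG.analyticAt_form u.isForm p)
        (hG.analyticAt_form (t k).isForm p)
      rw [h1, ht k hk, zero_add] at h2
      simpa [e, hk, Pi.mul_def] using h2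
    · have h1 := ht m le_rfl
      rw [htm] at h1
      have h2 := analyticOrderAt_mul (hG.analyticAt_form s.isForm p)
        (hG.analyticAt_form (t (k - m)).isForm p)
      have hk2 := k.2
      rw [h1, ht (k - m) (by lia), ← Nat.cast_add, show m + ((k : ℕ) - m) = k by lia] at h2
      simpa [e, hk, Pi.mul_def] using h2
  have heq : ∀ k, e k (G q 0) = 0 := by
    intro k
    by_cases hk : (k : ℕ) ≤ m <;> simp [e, hk, huq, hsq]
  obtain ⟨r, hr⟩ : ∃ r, s (G r 0) ≠ 0 := by
    by_contra hcon
    push Not at hcon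
    have h1 := ht m le_rfl
    rw [htm, analyticOrderAt_eq_top.2 (hG.eventually_form_eq_zero s.isForm hcon p)] at h1
    exact ENat.top_ne_natCast m h1
  obtain ⟨c, hc, hcz⟩ := hG.exists_quadric_relation (m := m)
    (l := fun i x => b₀.coord i x) (u := Fin.snoc e fun x => v x * v x) (s := fun x => s x)
    (p₀ := p) (p₁ := r)
    (fun i => (LinearMap.toContinuousLinearMap (b₀.coord i)).isForm)
    (fun p' => (wronskianDet_coord_ne_zero_iff b₀ (hG.analytic p')).2 (hflex p').ge)
    (fun i => by
      refine Fin.lastCases ?_ (fun k => ?_) i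
      · simpa using v.isForm.mul v.isForm
      · simpa using he k)
    s.isForm (by simpa using hs 0 (by lia)) hr
  refine hc ?_
  have hlast : c (Fin.last (2 * m + 1)) = 0 := by
    have := hcz q
    rw [Fin.sum_univ_castSucc] at this
    simpa [heq, hv] using this
  have hsum : ∀ r, ∑ k : Fin (2 * m + 1), c k.castSucc * e k (G r 0) = 0 := by
    intro r
    have := hcz r
    rw [Fin.sum_univ_castSucc, hlast] at this
    simpa using this
  have hzero := eq_zero_of_analyticOrderAt_eq (fun k => hG.analyticAt_form (he k) p) heo
    (hG.eventually_form_eq_zero (IsForm.sum Finset.univ (fun k => c (Fin.castSucc k)) he) hsum p)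
  ext i
  refine Fin.lastCases hlast (fun k => ?_) i
  exact congrFun hzero k

end Flexless

/-! ### Meromorphic functions on a Riemann surface with a coordinate having one simple pole -/

section Coordinate

theorem exists_eq_mul_of_apply_zero {f y : ℂ → ℂ} (hf : AnalyticAt ℂ f 0) (hf0 : f 0 = 0)
    (hy : AnalyticAt ℂ y 0) (hy1 : analyticOrderAt y 0 = 1) :
    ∃ g : ℂ → ℂ, AnalyticAt ℂ g 0 ∧ ∀ᶠ w in 𝓝 (0 : ℂ), f w = y w * g w := by
  obtain ⟨u, hu, hu0, huy⟩ := (hy.analyticOrderAt_eq_natCast (n := 1)).1 (by simpa using hy1)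
  have h1 : (1 : ℕ) ≤ analyticOrderAt f 0 := by
    rw [Nat.cast_one, Order.one_le_iff_ne_zero]
    exact hf.analyticOrderAt_ne_zero.2 hf0
  obtain ⟨v, hv, hvf⟩ := (natCast_le_analyticOrderAt hf).1 h1
  refine ⟨fun w => v w / u w, hv.div hu hu0, ?_⟩
  filter_upwards [huy, hvf, hu.continuousAt.eventually_ne hu0] with w h1 h2 h3
  simp only [h1, h2, sub_zero, pow_one, smul_eq_mul]
  field_simp

variable {C : Type*} [TopologicalSpace C] [ChartedSpace ℂ C]

/-- A function on a Riemann surface that is holomorphic at `q` up to a removable singularity. -/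
def IsRegularAt (h : C → ℂ) (q : C) : Prop :=
  ∃ r : ℂ → ℂ, AnalyticAt ℂ r 0 ∧ ∀ᶠ w in 𝓝[≠] (0 : ℂ), h (localParam q w) = r w

/-- A function on a Riemann surface that is meromorphic at all points. -/
def IsMero (h : C → ℂ) : Prop := ∀ q, MeromorphicAt (fun w => h (localParam q w)) 0

/-- `x` is holomorphic except for a simple pole at `p`, and `y` represents `1 / x` in the local
parameter at `p`. -/
structure IsCoordinate (p : C) (x : C → ℂ) (y : ℂ → ℂ) : Prop where
  analytic : ∀ q, q ≠ p → AnalyticAt ℂ (fun w => x (localParam q w)) 0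
  analytic_inv : AnalyticAt ℂ y 0
  order_inv : analyticOrderAt y 0 = 1
  eq_inv : ∀ᶠ w in 𝓝[≠] (0 : ℂ), x (localParam p w) = (y w)⁻¹
  eventually_ne : ∀ q c, ∀ᶠ w in 𝓝[≠] (0 : ℂ), x (localParam q w) ≠ c

theorem IsMero.exists_pow_mul {h : C → ℂ} (hh : IsMero h) (q : C) {f : ℂ → ℂ}
    (hf : AnalyticAt ℂ f 0) (hf0 : f 0 = 0) :
    ∃ (n : ℕ) (r : ℂ → ℂ), AnalyticAt ℂ r 0 ∧
      ∀ᶠ w in 𝓝 (0 : ℂ), f w ^ n * h (localParam q w) = r w := by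
  obtain ⟨n, hn⟩ := hh q
  obtain ⟨g, hg, hfg⟩ := exists_eq_mul_of_apply_zero hf hf0 analyticAt_id analyticOrderAt_id
  refine ⟨n, _, (hg.pow n).mul hn, ?_⟩
  filter_upwards [hfg] with w hw
  simp only [hw, id, mul_pow, Pi.mul_apply, Pi.pow_apply, sub_zero, smul_eq_mul]
  ring

variable {p : C} {x : C → ℂ} {y : ℂ → ℂ}

namespace IsCoordinate

variable (hx : IsCoordinate p x y)
include hx

theorem inv_zero : y 0 = 0 := by
  have := hx.order_inv
  exact apply_eq_zero_of_analyticOrderAt_ne_zero (by rw [this]; exact one_ne_zero)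

theorem eventually_inv_ne_zero : ∀ᶠ w in 𝓝[≠] (0 : ℂ), y w ≠ 0 := by
  refine hx.analytic_inv.eventually_eq_zero_or_eventually_ne_zero.resolve_left fun h => ?_
  rw [← analyticOrderAt_eq_top, hx.order_inv] at h
  exact ENat.one_ne_top h

theorem isMero : IsMero x := by
  intro q
  by_cases hq : q = p
  · subst hq
    exact (hx.analytic_inv.meromorphicAt.inv).congr (hx.eq_inv.mono fun w hw => hw.symm)
  · exact (hx.analytic q hq).meromorphicAt

theorem isMero_eval_mul (P : Polynomial ℂ) {h : C → ℂ} (hh : IsMero h) :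
    IsMero fun q => P.eval (x q) * h q := by
  intro q
  refine MeromorphicAt.fun_mul ?_ (hh q)
  simp only [Polynomial.eval_eq_sum_range]
  exact MeromorphicAt.fun_sum fun i _ =>
    (MeromorphicAt.const _ 0).fun_mul ((hx.isMero q).fun_pow i)

theorem analyticAt_eval (P : Polynomial ℂ) {q : C} (hq : q ≠ p) :
    AnalyticAt ℂ (fun w => P.eval (x (localParam q w))) 0 := by
  simp only [Polynomial.eval_eq_sum_range]
  exact Finset.analyticAt_fun_sum _ fun i _ => analyticAt_const.mul ((hx.analytic q hq).pow i)

theorem eventually_eval_ne_zero {P : Polynomial ℂ} (hP : P ≠ 0) (q : C) :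
    ∀ᶠ w in 𝓝[≠] (0 : ℂ), P.eval (x (localParam q w)) ≠ 0 := by
  have h1 : ∀ᶠ w in 𝓝[≠] (0 : ℂ), ∀ c ∈ P.roots.toFinset, x (localParam q w) ≠ c :=
    (Finset.eventually_all _).2 fun c _ => hx.eventually_ne q c
  filter_upwards [h1] with w hw h0
  exact hw _ (by simpa [hP] using h0) rfl

/-- Away from `p` the function `x - x q` is holomorphic with a zero at `q`, so a power of it cancels
the pole of `h` there. -/
theorem exists_clear_pole {h : C → ℂ} (hh : IsMero h) {q : C} (hq : q ≠ p) :
    ∃ D : Polynomial ℂ, D ≠ 0 ∧ IsRegularAt (fun q => D.eval (x q) * h q) q := by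
  obtain ⟨n, r, hr, hrh⟩ := hh.exists_pow_mul q ((hx.analytic q hq).sub analyticAt_const)
    (f := fun w => x (localParam q w) - x q) (by simp)
  refine ⟨(Polynomial.X - Polynomial.C (x q)) ^ n,
    pow_ne_zero _ (Polynomial.X_sub_C_ne_zero _), r, hr, ?_⟩
  filter_upwards [hrh.filter_mono nhdsWithin_le_nhds] with w hw
  simpa using hw

end IsCoordinate

variable [IsManifold 𝓘(ℂ) ω C] [CompactSpace C]

/-- The local extensions over removable singularities agree on overlaps, so their central values
form a globally holomorphic function. The values of `h` itself at isolated points are arbitrary,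
hence the punctured neighbourhoods. -/
theorem exists_const_of_isRegularAt [PreconnectedSpace C] {h : C → ℂ}
    (hh : ∀ q, IsRegularAt h q) :
    ∃ c, ∀ q, ∀ᶠ w in 𝓝[≠] (0 : ℂ), h (localParam q w) = c := by
  choose r hr hrh using hh
  have hloc : ∀ q, (fun w => r (localParam q w) 0) =ᶠ[𝓝 0] r q := by
    intro q
    have h1 := eventually_eventually_nhdsWithin.2 (hrh q)
    rw [eventually_nhdsWithin_iff] at h1
    filter_upwards [h1, exists_transition q, (hr q).eventually_analyticAt]
      with w hw ⟨ψ, hψ, hψ0, _, hψl⟩ hrw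
    by_cases hw0 : w = 0
    · subst hw0; simp
    have hw' : ∀ᶠ v in 𝓝 w, h (localParam q v) = r q v := by
      have := hw hw0
      rwa [nhdsWithin_eq_nhds.2] at this
      exact isOpen_compl_singleton.mem_nhds hw0
    have h2 : ∀ᶠ u in 𝓝 (0 : ℂ), h (localParam q (ψ u)) = r q (ψ u) :=
      (hψ0 ▸ hψ.continuousAt.tendsto : Tendsto ψ (𝓝 0) (𝓝 w)).eventually hw'
    have h3 : (r (localParam q w)) =ᶠ[𝓝[≠] 0] fun u => r q (ψ u) := by
      filter_upwards [h2.filter_mono nhdsWithin_le_nhds, hrh (localParam q w),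
        hψl.filter_mono nhdsWithin_le_nhds] with u hu hu' hu''
      rw [← hu', ← hu, hu'']
    have hcont : ContinuousAt (fun u => r q (ψ u)) 0 :=
      ContinuousAt.comp (g := r q) (by rw [hψ0]; exact hrw.continuousAt) hψ.continuousAt
    have h4 := (ContinuousAt.eventuallyEq_nhds_iff_eventuallyEq_nhdsNE
      (hr (localParam q w)).continuousAt hcont).1 h3
    simpa [hψ0] using h4.self_of_nhds
  obtain ⟨c, hc⟩ := exists_eq_const_of_analyticAt (h := fun q => r q 0)
    fun q => (hr q).congr (hloc q).symm
  refine ⟨c, fun q => ?_⟩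
  filter_upwards [hrh q, (hloc q).filter_mono nhdsWithin_le_nhds] with w h1 h2
  rw [h1, ← h2]
  exact hc _

/-- Every point has a neighbourhood with no pole except possibly the point itself; compactness
leaves finitely many. -/
theorem IsMero.finite_poles {h : C → ℂ} (hh : IsMero h) : {q | ¬ IsRegularAt h q}.Finite := by
  have hnear : ∀ q, ∀ᶠ q' in 𝓝 q, q' ≠ q → IsRegularAt h q' := by
    intro q
    rw [eventually_nhds_iff_localParam]
    have h1 := eventually_nhdsWithin_iff.1 (hh q).eventually_analyticAt
    filter_upwards [h1, exists_transition q] with w hw ⟨ψ, hψ, hψ0, _, hψl⟩ hne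
    have hw0 : w ≠ 0 := fun h0 => hne (by rw [h0, localParam_zero])
    have h2 : AnalyticAt ℂ (fun u => h (localParam q (ψ u))) 0 :=
      AnalyticAt.comp (g := fun w => h (localParam q w)) (f := ψ) (by rw [hψ0]; exact hw hw0) hψ
    exact ⟨_, h2, (hψl.mono fun u hu => congrArg h hu).filter_mono nhdsWithin_le_nhds⟩
  obtain ⟨t, -, ht⟩ := isCompact_univ.elim_nhds_subcover (fun q => {q' | q' ≠ q → IsRegularAt h q'})
    fun q _ => hnear q
  refine t.finite_toSet.subset fun q hq => ?_
  obtain ⟨q', hq', hmem⟩ := Set.mem_iUnion₂.1 (ht (Set.mem_univ q))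
  by_contra hcon
  exact hq (hmem fun h => hcon (h ▸ hq'))

namespace IsCoordinate

variable (hx : IsCoordinate p x y) [PreconnectedSpace C]
include hx

/-- A meromorphic function with poles only at `p` is a polynomial in the coordinate. -/
theorem exists_polynomial {k : ℕ} : ∀ {h : C → ℂ}, (∀ q, q ≠ p → IsRegularAt h q) →
    (∃ r : ℂ → ℂ, AnalyticAt ℂ r 0 ∧
      ∀ᶠ w in 𝓝[≠] (0 : ℂ), y w ^ k * h (localParam p w) = r w) →
    ∃ P : Polynomial ℂ, ∀ q, ∀ᶠ w in 𝓝[≠] (0 : ℂ),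
      h (localParam q w) = P.eval (x (localParam q w)) := by
  induction k with
  | zero =>
    intro h ho hp
    obtain ⟨c, hc⟩ := exists_const_of_isRegularAt (h := h) fun q => by
      by_cases hq : q = p
      · subst hq; simpa [IsRegularAt] using hp
      · exact ho q hq
    exact ⟨Polynomial.C c, by simpa using hc⟩
  | succ k ih =>
    intro h ho ⟨r, hr, hrh⟩
    obtain ⟨g, hg, hrg⟩ := exists_eq_mul_of_apply_zero (f := fun w => r w - r 0)
      (hr.sub analyticAt_const) (sub_self _) hx.analytic_inv hx.order_inv
    -- As `x` is `1 / y` near `p`, the leading polar coefficient of `h` is `r 0`; subtracting `r 0 *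
    -- x ^ (k + 1)` lowers the pole order by one and creates no other pole.
    obtain ⟨P, hP⟩ := ih (h := fun q => h q - r 0 * x q ^ (k + 1)) (fun q hq => by
      obtain ⟨f, hf, hfh⟩ := ho q hq
      refine ⟨fun w => f w - r 0 * x (localParam q w) ^ (k + 1),
        hf.sub (analyticAt_const.mul ((hx.analytic q hq).pow (k + 1))), ?_⟩
      filter_upwards [hfh] with w hw
      rw [hw]) (by
      refine ⟨g, hg, ?_⟩
      filter_upwards [hrh, hrg.filter_mono nhdsWithin_le_nhds, hx.eq_inv,
        hx.eventually_inv_ne_zero] with w h1 h2 h3 h4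
      have h5 : y w * (y w ^ k * (h (localParam p w) - r 0 * x (localParam p w) ^ (k + 1))) =
          y w * g w := by
        rw [← h2, ← h1, h3, inv_pow]
        have h6 : y w ^ (k + 1) * (y w ^ (k + 1))⁻¹ = 1 := mul_inv_cancel₀ (pow_ne_zero _ h4)
        linear_combination -r 0 * h6
      exact mul_left_cancel₀ h4 h5)
    refine ⟨P + Polynomial.C (r 0) * Polynomial.X ^ (k + 1), fun q => ?_⟩
    filter_upwards [hP q] with w hw
    simp [← hw]

/-- Meromorphic functions are rational functions of the coordinate. -/
theorem exists_rational {h : C → ℂ} (hh : IsMero h) :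
    ∃ N D : Polynomial ℂ, D ≠ 0 ∧ ∀ q, ∀ᶠ w in 𝓝[≠] (0 : ℂ),
      D.eval (x (localParam q w)) * h (localParam q w) = N.eval (x (localParam q w)) := by
  classical
  have hD : ∀ q : C, ∃ D : Polynomial ℂ, D ≠ 0 ∧
      (q ≠ p → IsRegularAt (fun q => D.eval (x q) * h q) q) := by
    intro q
    by_cases hq : q = p
    · exact ⟨1, one_ne_zero, fun h => absurd hq h⟩
    · obtain ⟨D, h1, h2⟩ := hx.exists_clear_pole hh hq
      exact ⟨D, h1, fun _ => h2⟩
  choose D hD0 hDr using hD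
  let S := hh.finite_poles.toFinset
  have hreg : ∀ q, q ≠ p → IsRegularAt (fun q => (∏ i ∈ S, D i).eval (x q) * h q) q := by
    intro q hq
    by_cases hS : q ∈ S
    · obtain ⟨r, hr, hrh⟩ := hDr q hq
      refine ⟨_, (hx.analyticAt_eval (∏ i ∈ S.erase q, D i) hq).mul hr, ?_⟩
      filter_upwards [hrh] with w hw
      simp only [Pi.mul_apply]
      rw [← hw, ← Finset.mul_prod_erase S D hS, Polynomial.eval_mul]
      ring
    · have hq' : IsRegularAt h q := by
        by_contra hcon
        exact hS (hh.finite_poles.mem_toFinset.2 hcon)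
      obtain ⟨r, hr, hrh⟩ := hq'
      refine ⟨_, (hx.analyticAt_eval (∏ i ∈ S, D i) hq).mul hr, ?_⟩
      filter_upwards [hrh] with w hw
      simp only [Pi.mul_apply, hw]
  obtain ⟨k, r, hr, hrh⟩ := (hx.isMero_eval_mul (∏ i ∈ S, D i) hh).exists_pow_mul p
    hx.analytic_inv hx.inv_zero
  -- After multiplication by the product of the clearing polynomials the only pole left is at `p`,
  -- where a power of `y` removes it.
  obtain ⟨N, hN⟩ := hx.exists_polynomial hreg ⟨r, hr, hrh.filter_mono nhdsWithin_le_nhds⟩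
  exact ⟨N, _, Finset.prod_ne_zero_iff.2 fun i _ => hD0 i, hN⟩

/-- If the value `c` were omitted, `(x - c)⁻¹` would be holomorphic everywhere, hence constant, and
zero because it vanishes at the pole `p`; but `(x - c)⁻¹` is nonzero near `p` away from `p`. -/
theorem exists_apply_eq (c : ℂ) : ∃ q, q ≠ p ∧ x q = c := by
  by_contra hcon
  push Not at hcon
  have hp : ∀ᶠ w in 𝓝[≠] (0 : ℂ), (x (localParam p w) - c)⁻¹ = y w / (1 - c * y w) := by
    filter_upwards [hx.eq_inv, hx.eventually_inv_ne_zero, hx.eventually_ne p c] with w h1 h2 h3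
    have h4 : 1 - c * y w ≠ 0 := by
      intro h0
      apply h3
      rw [h1]
      field_simp
      linear_combination h0
    have h5 : (y w)⁻¹ - c ≠ 0 := by rw [← h1]; exact sub_ne_zero.2 h3
    rw [h1]
    rw [inv_eq_iff_eq_inv, inv_div]
    field_simp
  have hden : AnalyticAt ℂ (fun w => y w / (1 - c * y w)) 0 :=
    hx.analytic_inv.div (analyticAt_const.sub (analyticAt_const.mul hx.analytic_inv)) (by
      simp [hx.inv_zero])
  obtain ⟨a, ha⟩ := exists_const_of_isRegularAt (h := fun q => (x q - c)⁻¹) fun q => by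
    by_cases hq : q = p
    · subst hq
      exact ⟨_, hden, hp⟩
    · refine ⟨_, ((hx.analytic q hq).sub analyticAt_const).inv ?_,
        Eventually.of_forall fun w => rfl⟩
      simpa [sub_eq_zero] using hcon q hq
  have h1 : (fun w => y w / (1 - c * y w)) =ᶠ[𝓝 0] fun _ => a := by
    refine (ContinuousAt.eventuallyEq_nhds_iff_eventuallyEq_nhdsNE hden.continuousAt
      continuousAt_const).1 ?_
    filter_upwards [hp, ha p] with w h1 h2
    rw [← h1, h2]
  have ha0 : a = 0 := by simpa [hx.inv_zero] using h1.self_of_nhds.symm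
  obtain ⟨w, h2, h3⟩ := ((ha p).and (hx.eventually_ne p c)).exists
  rw [ha0] at h2
  exact h3 (by simpa [sub_eq_zero] using h2)

end IsCoordinate

open Classical in
/-- Homogeneous coordinates of the coordinate `x` near `q`. -/
def coordPoint (p : C) (x : C → ℂ) (y : ℂ → ℂ) (q : C) (w : ℂ) : ℂ × ℂ :=
  if q = p then (y w, 1) else (1, x (localParam q w))

end Coordinate

section RationalParametrization

theorem veronese_smul (d : ℕ) (c : ℂ) (s : ℂ × ℂ) : veronese d (c • s) = c ^ d • veronese d s := by
  ext i
  have hi : (i : ℕ) ≤ d := Nat.lt_succ_iff.1 i.2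
  simp only [veronese, Prod.smul_fst, Prod.smul_snd, smul_eq_mul, mul_pow, Pi.smul_apply]
  rw [show c ^ d = c ^ (d - i) * c ^ (i : ℕ) by rw [← pow_add]; congr 1; lia]
  ring

theorem analyticAt_veronese (d : ℕ) (s : ℂ × ℂ) : AnalyticAt ℂ (veronese d) s := by
  rw [analyticAt_pi_iff]
  intro i
  exact (analyticAt_fst.pow _).mul (analyticAt_snd.pow _)

/-- A vector of polynomials with no common factor, made homogeneous. -/
theorem exists_linearMap_veronese {W : Type*} [AddCommGroup W] [Module ℂ W] {n : ℕ}
    (b : Module.Basis (Fin n) ℂ W) {P : Fin n → Polynomial ℂ} (hP : P ≠ 0) :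
    ∃ (d : ℕ) (π : (Fin (d + 1) → ℂ) →ₗ[ℂ] W) (g : Polynomial ℂ), g ≠ 0 ∧
      (∀ s : ℂ × ℂ, s ≠ 0 → π (veronese d s) ≠ 0) ∧
      ∀ X, ∑ j, (P j).eval X • b j = g.eval X • π (veronese d (1, X)) := by
  -- The generator `g` is the greatest common divisor. Bézout's identity for the cofactors `Q`
  -- excludes common zeros on the affine line, and taking for `d` the largest of their degrees
  -- excludes one at infinity.
  let I : Ideal (Polynomial ℂ) := Ideal.span (Set.range P)
  let g := Submodule.IsPrincipal.generator I
  have hmem : ∀ j, P j ∈ I := fun j => Ideal.subset_span ⟨j, rfl⟩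
  have hdvd : ∀ j, g ∣ P j := fun j => (Submodule.IsPrincipal.mem_iff_generator_dvd I).1 (hmem j)
  have hg : g ≠ 0 := by
    intro h0
    apply hP
    funext j
    have := hdvd j
    rw [h0, zero_dvd_iff] at this
    exact this
  choose Q hQ using hdvd
  obtain ⟨a, ha⟩ := (Ideal.mem_span_range_iff_exists_fun).1
    (Submodule.IsPrincipal.generator_mem I : g ∈ Ideal.span (Set.range P))
  have hone : ∑ j, a j * Q j = 1 := by
    apply mul_left_cancel₀ hg
    rw [Finset.mul_sum, mul_one]
    conv_rhs => rw [show g = ∑ i, a i * P i from ha.symm]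
    exact Finset.sum_congr rfl fun j _ => by rw [hQ j]; ring
  let d := Finset.univ.sup fun j => (Q j).natDegree
  have hd : ∀ j, (Q j).natDegree ≤ d := fun j =>
    Finset.le_sup (f := fun j => (Q j).natDegree) (Finset.mem_univ j)
  let π : (Fin (d + 1) → ℂ) →ₗ[ℂ] W :=
    Fintype.linearCombination ℂ fun i : Fin (d + 1) => ∑ j, (Q j).coeff i • b j
  have hπ : ∀ c : Fin (d + 1) → ℂ, π c = ∑ j, (∑ i, c i * (Q j).coeff i) • b j := by
    intro c
    simp only [π, Fintype.linearCombination_apply, Finset.smul_sum, smul_smul, Finset.sum_smul]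
    exact Finset.sum_comm
  have hcoord : ∀ c j, b.coord j (π c) = ∑ i, c i * (Q j).coeff i := by
    intro c j
    rw [hπ]
    simp [Finsupp.single_apply]
  have hev : ∀ X j, ∑ i, veronese d (1, X) i * (Q j).coeff i = (Q j).eval X := by
    intro X j
    rw [Polynomial.eval_eq_sum_range' (Nat.lt_succ_iff.2 (hd j)), ← Fin.sum_univ_eq_sum_range
      (fun i => (Q j).coeff i * X ^ i)]
    exact Finset.sum_congr rfl fun i _ => by simp [veronese, mul_comm]
  have haff : ∀ X, π (veronese d (1, X)) ≠ 0 := by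
    intro X h0
    have h1 : ∀ j, (Q j).eval X = 0 := by
      intro j
      rw [← hev, ← hcoord, h0, map_zero]
    have h2 := congrArg (Polynomial.eval X) hone
    simp [Polynomial.eval_finsetSum, h1] at h2
  refine ⟨d, π, g, hg, fun s hs => ?_, fun X => ?_⟩
  · by_cases h1 : s.1 = 0
    · intro h0
      have h2 : s.2 ≠ 0 := fun h2 => hs (Prod.ext h1 h2)
      -- At infinity only the last Veronese coordinate survives, and it reads off the coefficient of
      -- degree `d`; not all of these vanish, since `d` is attained or, for `d = 0`, by Bézout.
      have h3 : ∀ j, (Q j).coeff d = 0 := by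
        intro j
        have h4 := hcoord (veronese d s) j
        rw [h0, map_zero, Finset.sum_eq_single (Fin.last d)] at h4
        · simpa [veronese, h2] using h4.symm
        · intro i _ hi
          have : d - (i : ℕ) ≠ 0 := by
            have := Fin.lt_last_iff_ne_last.2 hi
            have h5 : (i : ℕ) < d := this
            lia
          simp [veronese, h1, this]
        · simp
      rcases Nat.eq_zero_or_pos d with hd0 | hd0
      · have h4 : ∀ j, Q j = 0 := by
          intro j
          have h6 := Polynomial.eq_C_of_natDegree_eq_zero (Nat.le_zero.1 (hd0 ▸ hd j))
          have h7 := h3 j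
          rw [hd0] at h7
          rwa [h7, Polynomial.C_0] at h6
        simp [h4] at hone
      · have hne : (Finset.univ : Finset (Fin n)).Nonempty := by
          rw [Finset.nonempty_iff_ne_empty]
          intro he
          simp [d, he] at hd0
        obtain ⟨j, -, hj⟩ := Finset.exists_mem_eq_sup _ hne fun j => (Q j).natDegree
        have h4 := h3 j
        change (Q j).coeff (Finset.univ.sup fun j => (Q j).natDegree) = 0 at h4
        rw [hj, Polynomial.coeff_natDegree, Polynomial.leadingCoeff_eq_zero] at h4
        have h5 : d = (Q j).natDegree := hj
        simp [h5, h4] at hd0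
    · have : s = s.1 • ((1 : ℂ), s.2 / s.1) := by
        ext
        · simp
        · simp; field_simp
      rw [this, veronese_smul, map_smul]
      exact smul_ne_zero (pow_ne_zero _ h1) (haff _)
  · rw [hπ, Finset.smul_sum]
    refine Finset.sum_congr rfl fun j _ => ?_
    rw [hev, smul_smul, ← Polynomial.eval_mul, ← hQ]

variable {C : Type*} [TopologicalSpace C] [ChartedSpace ℂ C] [IsManifold 𝓘(ℂ) ω C]
  [CompactSpace C] [PreconnectedSpace C] {p : C} {x : C → ℂ} {y : ℂ → ℂ}

/-- In terms of a coordinate with a single simple pole, a holomorphic curve in projective space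
is given by binary forms. -/
theorem IsCoordinate.exists_rational_parametrization (hx : IsCoordinate p x y)
    {V : Type*} [NormedAddCommGroup V] [NormedSpace ℂ V] [FiniteDimensional ℂ V]
    {G : C → ℂ → V} (hG : IsCurveLift G) :
    ∃ (d : ℕ) (π : (Fin (d + 1) → ℂ) →ₗ[ℂ] V),
      (∀ s : ℂ × ℂ, s ≠ 0 → π (veronese d s) ≠ 0) ∧
      ∀ q, ∃ κ : ℂ → ℂ, AnalyticAt ℂ κ 0 ∧ κ 0 ≠ 0 ∧
        G q =ᶠ[𝓝 0] fun w => κ w • π (veronese d (coordPoint p x y q w)) := by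
  let n := Module.finrank ℂ V
  let b : Module.Basis (Fin n) ℂ V := Module.finBasis ℂ V
  let l : Fin n → V →L[ℂ] ℂ := fun j => LinearMap.toContinuousLinearMap (b.coord j)
  obtain ⟨j₀, hj₀⟩ : ∃ j, l j (G p 0) ≠ 0 := by
    by_contra hcon
    push Not at hcon
    exact hG.ne_zero p (b.ext_elem fun j => by simpa [l] using hcon j)
  have hl₀ := hG.eventually_ne_zero (l j₀).isForm ⟨p, hj₀⟩
  -- Quotients of coordinates do not depend on the lift, so they are meromorphic functions on `C`
  -- and thus rational in `x`.
  let h : Fin n → C → ℂ := fun j q => l j (G q 0) / l j₀ (G q 0)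
  have hloc : ∀ j q, ∀ᶠ w in 𝓝 (0 : ℂ),
      h j (localParam q w) = l j (G q w) / l j₀ (G q w) := by
    intro j q
    filter_upwards [hG.eventually_apply_zero q] with w ⟨c, hc, hcw⟩
    simp only [h, hcw, map_smul, smul_eq_mul]
    exact mul_div_mul_left _ _ hc
  have hmero : ∀ j, IsMero (h j) := by
    intro j q
    refine MeromorphicAt.congr (f := fun w => l j (G q w) / l j₀ (G q w)) ?_
      (((hloc j q).mono fun w hw => hw.symm).filter_mono nhdsWithin_le_nhds)
    exact (hG.analyticAt_form (l j).isForm q).meromorphicAt.fun_div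
      (hG.analyticAt_form (l j₀).isForm q).meromorphicAt
  choose N D hD hND using fun j => hx.exists_rational (hmero j)
  -- Numerators of the coordinate quotients over the common denominator `∏ D`.
  let P : Fin n → Polynomial ℂ := fun j => N j * ∏ i ∈ Finset.univ.erase j, D i
  have hDP : ∏ i, D i ≠ 0 := Finset.prod_ne_zero_iff.2 fun i _ => hD i
  have hGP : ∀ q, ∀ᶠ w in 𝓝[≠] (0 : ℂ), (∏ i, D i).eval (x (localParam q w)) • G q w =
      l j₀ (G q w) • ∑ j, (P j).eval (x (localParam q w)) • b j := by
    intro q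
    have h1 : ∀ᶠ w in 𝓝[≠] (0 : ℂ), ∀ j, (D j).eval (x (localParam q w)) *
        h j (localParam q w) = (N j).eval (x (localParam q w)) :=
      eventually_all.2 fun j => hND j q
    have h2 : ∀ᶠ w in 𝓝[≠] (0 : ℂ), ∀ j,
        h j (localParam q w) = l j (G q w) / l j₀ (G q w) :=
      eventually_all.2 fun j => (hloc j q).filter_mono nhdsWithin_le_nhds
    filter_upwards [h1, h2, hl₀ q] with w h1 h2 h3
    apply b.ext_elem
    intro j
    have h4 : b.repr (∑ j, (P j).eval (x (localParam q w)) • b j) j =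
        (P j).eval (x (localParam q w)) := by
      simp [Finsupp.single_apply]
    rw [map_smul, map_smul, Finsupp.smul_apply, Finsupp.smul_apply, h4]
    simp only [P]
    rw [Polynomial.eval_mul, ← h1 j, h2 j, ← Finset.mul_prod_erase _ D (Finset.mem_univ j),
      Polynomial.eval_mul]
    have h5 : b.repr (G q w) j = l j (G q w) := rfl
    rw [h5, smul_eq_mul, smul_eq_mul]
    field_simp
  have hP : P ≠ 0 := by
    intro h0
    obtain ⟨w, h1, h2, h3⟩ := ((hGP p).and ((hx.eventually_eval_ne_zero hDP p).and
      (((hG.analytic p).continuousAt.eventually_ne (hG.ne_zero p)).filter_mono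
        nhdsWithin_le_nhds))).exists
    simp only [h0, Pi.zero_apply, Polynomial.eval_zero, zero_smul, Finset.sum_const_zero,
      smul_zero] at h1
    exact (smul_ne_zero h2 h3) h1
  obtain ⟨d, π, g, hg, hπ, hπP⟩ := exists_linearMap_veronese b hP
  refine ⟨d, π, hπ, fun q => ?_⟩
  have hspan : ∀ᶠ w in 𝓝[≠] (0 : ℂ),
      G q w ∈ Submodule.span ℂ {π (veronese d (1, x (localParam q w)))} := by
    filter_upwards [hGP q, hx.eventually_eval_ne_zero hDP q] with w h1 h2
    rw [hπP, smul_smul] at h1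
    refine (Submodule.smul_mem_iff _ h2).1 ?_
    rw [h1]
    exact Submodule.smul_mem _ _ (Submodule.mem_span_singleton_self _)
  have han : ∀ {f : ℂ → ℂ × ℂ}, AnalyticAt ℂ f 0 →
      AnalyticAt ℂ (fun w => π (veronese d (f w))) 0 := fun {f} hf =>
    AnalyticAt.comp (g := fun s => π (veronese d s)) (f := f)
      (((LinearMap.toContinuousLinearMap π).analyticAt _).comp (analyticAt_veronese d _)) hf
  by_cases hq : q = p
  · subst hq
    refine exists_smul_of_mem_span (hG.analytic q) (han (f := coordPoint q x y q) ?_)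
      (hG.ne_zero q) (hπ _ ?_) ?_
    · have h1 : coordPoint q x y q = fun w => (y w, 1) := by funext w; simp [coordPoint]
      rw [h1]
      exact hx.analytic_inv.prod analyticAt_const
    · simp [coordPoint]
    · filter_upwards [hspan, hx.eq_inv, hx.eventually_inv_ne_zero] with w h1 h2 h3
      have h4 : coordPoint q x y q w = y w • ((1 : ℂ), x (localParam q w)) := by
        ext <;> simp [coordPoint, h2, h3]
      rw [h4, veronese_smul, map_smul,
        Submodule.span_singleton_smul_eq (pow_ne_zero _ h3).isUnit]
      exact h1
  · refine exists_smul_of_mem_span (hG.analytic q) (han (f := coordPoint p x y q) ?_)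
      (hG.ne_zero q) (hπ _ ?_) ?_
    · have h1 : coordPoint p x y q = fun w => (1, x (localParam q w)) := by
        funext w; simp [coordPoint, hq]
      rw [h1]
      exact analyticAt_const.prod (hx.analytic q hq)
    · simp [coordPoint, hq]
    · simpa [coordPoint, hq] using hspan

end RationalParametrization

/-! ### Curves without inflection points are rational normal curves -/

section RationalNormal

variable {V : Type*} [NormedAddCommGroup V] [NormedSpace ℂ V] [FiniteDimensional ℂ V]
variable {C : Type*} [TopologicalSpace C] [ChartedSpace ℂ C] {G : C → ℂ → V}

theorem iteratedDeriv_mem_of_eventually {S : Submodule ℂ V} {F : ℂ → V}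
    (hF : AnalyticAt ℂ F 0) (h : ∀ᶠ w in 𝓝 (0 : ℂ), F w ∈ S) (j : ℕ) :
    iteratedDeriv j F 0 ∈ S := by
  by_contra hcon
  obtain ⟨l, hl, hlS⟩ := Submodule.exists_le_ker_of_notMem hcon
  apply hl
  rw [← LinearMap.coe_toContinuousLinearMap' l, ← iteratedDeriv_clm_comp _ hF,
    EventuallyEq.iteratedDeriv_eq (f := fun w => LinearMap.toContinuousLinearMap l (F w))
      (g := fun _ => 0) j (h.mono fun w hw => LinearMap.mem_ker.1 (hlS hw))]
  simp

theorem apply_veronese (d : ℕ) (l : (Fin (d + 1) → ℂ) →ₗ[ℂ] ℂ) (s : ℂ × ℂ) :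
    l (veronese d s) = ∑ i : Fin (d + 1), s.1 ^ (d - (i : ℕ)) * s.2 ^ (i : ℕ) *
      l (Pi.single i 1) := by
  conv_lhs => rw [pi_eq_sum_univ' (veronese d s), map_sum]
  refine Finset.sum_congr rfl fun i _ => ?_
  rw [map_smul, smul_eq_mul]
  congr 2

/-- A binary form without roots in the affine line is a multiple of a power of the coordinate at
infinity. -/
theorem apply_veronese_of_forall_ne_zero (d : ℕ) (l : (Fin (d + 1) → ℂ) →ₗ[ℂ] ℂ)
    (h : ∀ X, l (veronese d (1, X)) ≠ 0) : ∃ c, c ≠ 0 ∧ ∀ s, l (veronese d s) = c * s.1 ^ d := by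
  let R : Polynomial ℂ := ∑ i : Fin (d + 1),
    Polynomial.C (l (Pi.single i 1)) * Polynomial.X ^ (i : ℕ)
  have hR : ∀ X, R.eval X = l (veronese d (1, X)) := by
    intro X
    rw [apply_veronese]
    simp only [R, Polynomial.eval_finsetSum]
    exact Finset.sum_congr rfl fun i _ => by
      rw [Polynomial.eval_mul, Polynomial.eval_C, Polynomial.eval_pow, Polynomial.eval_X, one_pow,
        one_mul, mul_comm]
  have hdeg : R.degree = 0 := by
    by_contra hdeg
    obtain ⟨X, hX⟩ := IsAlgClosed.exists_root R hdeg
    exact h X (by rw [← hR]; exact hX)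
  have hcoeff : ∀ i : Fin (d + 1), R.coeff i = l (Pi.single i 1) := by
    intro i
    simp [R, Polynomial.coeff_X_pow, Fin.val_inj]
  have hzero : ∀ i : Fin (d + 1), i ≠ 0 → l (Pi.single i 1) = 0 := by
    intro i hi
    rw [← hcoeff]
    refine Polynomial.coeff_eq_zero_of_degree_lt ?_
    rw [hdeg]
    exact_mod_cast Nat.pos_of_ne_zero fun h0 => hi (Fin.ext h0)
  have hform : ∀ s, l (veronese d s) = l (Pi.single 0 1) * s.1 ^ d := by
    intro s
    rw [apply_veronese, Finset.sum_eq_single 0]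
    · simp [mul_comm]
    · intro i _ hi
      rw [hzero i hi, mul_zero]
    · simp
  exact ⟨_, fun h0 => h 0 (by rw [hform, h0, zero_mul]), hform⟩

variable [IsManifold 𝓘(ℂ) ω C] [CompactSpace C] [PreconnectedSpace C]

/-- Here `x = s' / s` for linear forms of vanishing orders `m - 1` and `m` at `p`. The osculating
form `s` has no zero away from `p`, so the only pole is the simple one at `p`. -/
theorem IsCurveLift.exists_isCoordinate (hG : IsCurveLift G) {m : ℕ} (hm : 2 ≤ m)
    (hV : Module.finrank ℂ V = m + 1) (hflex : ∀ p, jetSpan (m + 1) (G p) = ⊤)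
    (hinj : ∀ p q, G p 0 ∈ Submodule.span ℂ {G q 0} → p = q) (p : C) :
    ∃ (x : C → ℂ) (y : ℂ → ℂ) (s : V →L[ℂ] ℂ), IsCoordinate p x y ∧
      analyticOrderAt (fun w => s (G p w)) 0 = m ∧ ∀ q, q ≠ p → s (G q 0) ≠ 0 := by
  let B : Module.Basis (Fin (m + 1)) ℂ V := Module.Basis.mk
    (linearIndependent_of_top_le_span_of_card_eq_finrank (hflex p).ge (by simp [hV]))
    (hflex p).ge
  have hB : ∀ j, B j = iteratedDeriv j (G p) 0 := fun j => Module.Basis.mk_apply _ _ j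
  let t : Fin (m + 1) → V →L[ℂ] ℂ := fun i => LinearMap.toContinuousLinearMap (B.coord i)
  have htj : ∀ i j : Fin (m + 1), t i (iteratedDeriv j (G p) 0) = if j = i then 1 else 0 := by
    intro i j
    rw [← hB]
    simp [t, Finsupp.single_apply]
  have ht : ∀ i, analyticOrderAt (fun w => t i (G p w)) 0 = (i : ℕ) := by
    intro i
    rw [analyticOrderAt_eq_nat_iff_iteratedDeriv_eq_zero
      (hG.analyticAt_form (t i).isForm p)]
    simp only [iteratedDeriv_clm_comp (t i) (hG.analytic p)]
    refine ⟨fun j hj => ?_, ?_⟩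
    · have := htj i ⟨j, hj.trans i.2⟩
      rw [if_neg (fun h => hj.ne (congrArg Fin.val h))] at this
      exact this
    · rw [htj, if_pos rfl]; exact one_ne_zero
  let s := t (Fin.last m)
  let s' := t ⟨m - 1, by lia⟩
  have hso := ht (Fin.last m)
  have hso' := ht ⟨m - 1, by lia⟩
  have hne : ∀ q, q ≠ p → s (G q 0) ≠ 0 := fun q hq =>
    hG.apply_ne_zero_of_osculating hm hV hflex hinj (fun j hj => by
      have := htj (Fin.last m) ⟨j, by lia⟩
      rw [if_neg (fun h => hj.ne (congrArg Fin.val h))] at this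
      exact this) (by
      have := htj (Fin.last m) (Fin.last m)
      rw [if_pos rfl] at this
      exact this.symm ▸ one_ne_zero) hq
  have hsne := fun q => hG.eventually_ne_zero s.isForm (by
    by_contra hcon
    push Not at hcon
    have h1 := hso
    rw [analyticOrderAt_eq_top.2 (hG.eventually_form_eq_zero s.isForm hcon p)] at h1
    exact ENat.top_ne_natCast _ h1) q
  let x : C → ℂ := fun q => s' (G q 0) / s (G q 0)
  have hloc : ∀ q, ∀ᶠ w in 𝓝 (0 : ℂ), x (localParam q w) = s' (G q w) / s (G q w) := by
    intro q
    filter_upwards [hG.eventually_apply_zero q] with w ⟨c, hc, hcw⟩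
    simp only [x, hcw, map_smul, smul_eq_mul]
    exact mul_div_mul_left _ _ hc
  obtain ⟨u, hu, hu0, hus⟩ := ((hG.analyticAt_form s.isForm p).analyticOrderAt_eq_natCast).1 hso
  obtain ⟨v, hv, hv0, hvs⟩ := ((hG.analyticAt_form s'.isForm p).analyticOrderAt_eq_natCast).1 hso'
  have hy : AnalyticAt ℂ (fun w => w * (u w / v w)) 0 := analyticAt_id.mul (hu.div hv hv0)
  refine ⟨x, fun w => w * (u w / v w), s, ⟨fun q hq => ?_, hy, ?_, ?_, fun q c => ?_⟩, hso, hne⟩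
  · exact ((hG.analyticAt_form s'.isForm q).div (hG.analyticAt_form s.isForm q)
      (hne q hq)).congr ((hloc q).mono fun w hw => hw.symm)
  · refine (hy.analyticOrderAt_eq_natCast (n := 1)).2
      ⟨_, hu.div hv hv0, div_ne_zero hu0 hv0, Eventually.of_forall fun w => by simp⟩
  · filter_upwards [(hloc p).filter_mono nhdsWithin_le_nhds, hus.filter_mono nhdsWithin_le_nhds,
      hvs.filter_mono nhdsWithin_le_nhds, self_mem_nhdsWithin] with w h1 h2 h3 h4
    have hw : w ≠ 0 := h4
    rw [h1, h2, h3]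
    simp only [sub_zero, smul_eq_mul, Fin.val_last]
    have h5 : w ^ m = w ^ (m - 1) * w := by rw [← pow_succ]; congr 1; lia
    rw [h5, mul_assoc, mul_div_mul_left _ _ (pow_ne_zero _ hw), ← mul_div_assoc, inv_div]
  · let f := s' - c • s
    have hf : ∃ r, f (G r 0) ≠ 0 := by
      by_contra hcon
      push Not at hcon
      have h1 : iteratedDeriv (m - 1) (fun w => f (G p w)) 0 = 0 := by
        rw [EventuallyEq.iteratedDeriv_eq (g := fun _ => 0) (m - 1)
          (hG.eventually_form_eq_zero f.isForm hcon p)]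
        simp
      rw [iteratedDeriv_clm_comp f (hG.analytic p)] at h1
      have h2 := htj (Fin.last m) ⟨m - 1, by lia⟩
      have h3 := htj ⟨m - 1, by lia⟩ ⟨m - 1, by lia⟩
      rw [if_pos rfl] at h3
      rw [if_neg (fun h => by have := congrArg Fin.val h; simp at this; lia)] at h2
      have h4 : s' (iteratedDeriv (m - 1) (G p) 0) - c * s (iteratedDeriv (m - 1) (G p) 0) = 0 := h1
      have h5 : s (iteratedDeriv (m - 1) (G p) 0) = 0 := h2
      have h6 : s' (iteratedDeriv (m - 1) (G p) 0) = 1 := h3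
      simp [h5, h6] at h4
    filter_upwards [hG.eventually_ne_zero f.isForm hf q, hsne q,
      (hloc q).filter_mono nhdsWithin_le_nhds] with w h1 h2 h3 h4
    apply h1
    rw [h3, div_eq_iff h2] at h4
    change s' (G q w) - c * s (G q w) = 0
    rw [h4, sub_self]

/-- A curve in `ℙ^m` without inflection points is a rational normal curve. -/
theorem IsCurveLift.exists_rationalNormal (hG : IsCurveLift G) {m : ℕ} (hm : 2 ≤ m)
    (hV : Module.finrank ℂ V = m + 1) (hflex : ∀ p, jetSpan (m + 1) (G p) = ⊤)
    (hinj : ∀ p q, G p 0 ∈ Submodule.span ℂ {G q 0} → p = q) (p : C) :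
    ∃ (x : C → ℂ) (y : ℂ → ℂ), IsCoordinate p x y ∧
      (∀ q q', q ≠ p → q' ≠ p → x q = x q' → q = q') ∧
      ∃ π : (Fin (m + 1) → ℂ) ≃ₗ[ℂ] V, ∀ q, ∃ κ : ℂ → ℂ, AnalyticAt ℂ κ 0 ∧ κ 0 ≠ 0 ∧
        G q =ᶠ[𝓝 0] fun w => κ w • π (veronese m (coordPoint p x y q w)) := by
  obtain ⟨x, y, s, hx, hso, hne⟩ := hG.exists_isCoordinate hm hV hflex hinj p
  obtain ⟨d, π, hπ, hGπ⟩ := hx.exists_rational_parametrization hG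
  have hsurj : Function.Surjective π := by
    rw [← LinearMap.range_eq_top, ← top_le_iff, ← hflex p, jetSpan_le_iff]
    intro j hj
    obtain ⟨κ, -, -, hκ⟩ := hGπ p
    exact iteratedDeriv_mem_of_eventually (hG.analytic p) (hκ.mono fun w hw => by
      rw [hw]; exact Submodule.smul_mem _ _ (LinearMap.mem_range_self _ _)) j
  have hGx : ∀ q, q ≠ p → ∃ c : ℂ, c ≠ 0 ∧ G q 0 = c • π (veronese d (1, x q)) := by
    intro q hq
    obtain ⟨κ, -, h1, h2⟩ := hGπ q
    exact ⟨κ 0, h1, by simpa [coordPoint, hq] using h2.self_of_nhds⟩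
  -- Every finite value of `x` is attained away from `p`, where `s` does not vanish; the pulled back
  -- binary form therefore has no affine root.
  obtain ⟨c, hc, hcs⟩ := apply_veronese_of_forall_ne_zero d (s.toLinearMap ∘ₗ π) (by
    intro X
    obtain ⟨q, hq, rfl⟩ := hx.exists_apply_eq X
    obtain ⟨c, hc, hcq⟩ := hGx q hq
    have h1 := hne q hq
    rw [hcq, map_smul] at h1
    exact right_ne_zero_of_smul h1)
  -- Near `p` the homogeneous coordinates are `(y, 1)`, so `s` along the curve is a unit times `y ^
  -- d`; its order there is `m`.
  have hd : d = m := by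
    obtain ⟨κ, hκ, hκ0, h1⟩ := hGπ p
    have h2 : (fun w => s (G p w)) =ᶠ[𝓝 0] fun w => (κ w * c) * y w ^ d := by
      filter_upwards [h1] with w hw
      have := hcs (coordPoint p x y p w)
      simp only [LinearMap.comp_apply, ContinuousLinearMap.coe_coe] at this
      rw [hw, map_smul, this]
      simp [coordPoint, mul_assoc]
    have h3 : analyticOrderAt (fun w => s (G p w)) 0 = d := by
      rw [analyticOrderAt_congr h2]
      have h4 := analyticOrderAt_mul (hκ.mul (analyticAt_const (v := c)))
        (hx.analytic_inv.pow d)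
      rw [analyticOrderAt_pow hx.analytic_inv, hx.order_inv,
        (hκ.mul (analyticAt_const (v := c))).analyticOrderAt_eq_zero.2 (mul_ne_zero hκ0 hc)] at h4
      simpa [Pi.mul_def, Pi.pow_def] using h4
    exact_mod_cast h3.symm.trans hso
  subst hd
  refine ⟨x, y, hx, fun q q' hq hq' hqq => ?_, LinearEquiv.ofBijective π
    ⟨(LinearMap.injective_iff_surjective_of_finrank_eq_finrank (by simp [hV])).2 hsurj, hsurj⟩,
    hGπ⟩
  obtain ⟨c, hc, h1⟩ := hGx q hq
  obtain ⟨c', hc', h2⟩ := hGx q' hq'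
  apply hinj
  rw [h1, h2, hqq, Submodule.span_singleton_smul_eq hc'.isUnit]
  exact Submodule.smul_mem _ _ (Submodule.mem_span_singleton_self _)

end RationalNormal

/-! ### The rational normal curve -/

section RationalNormalCurve

/-- An affine coordinate of `ℙ¹` centred at a point of `ℂ ∪ {∞}`. -/
def affinePoint : Option ℂ → ℂ → ℂ × ℂ
  | none, w => (w, 1)
  | some X, w => (1, X + w)

theorem affinePoint_ne_zero (o : Option ℂ) (w : ℂ) : affinePoint o w ≠ 0 := by
  cases o <;> simp [affinePoint]

theorem exists_eq_smul_affinePoint {s : ℂ × ℂ} (hs : s ≠ 0) :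
    ∃ (o : Option ℂ) (c : ℂ), c ≠ 0 ∧ s = c • affinePoint o 0 := by
  by_cases h1 : s.1 = 0
  · refine ⟨none, s.2, fun h2 => hs (Prod.ext h1 h2), ?_⟩
    ext <;> simp [affinePoint, h1]
  · refine ⟨some (s.2 / s.1), s.1, h1, ?_⟩
    ext
    · simp [affinePoint]
    · simp only [affinePoint, add_zero, Prod.smul_snd, smul_eq_mul]
      field_simp

theorem analyticAt_affinePoint (o : Option ℂ) (w : ℂ) : AnalyticAt ℂ (affinePoint o) w := by
  cases o
  · exact analyticAt_id.prod analyticAt_const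
  · exact analyticAt_const.prod (analyticAt_const.add analyticAt_id)

theorem analyticAt_veronese_affinePoint (d : ℕ) (o : Option ℂ) (w : ℂ) :
    AnalyticAt ℂ (fun w => veronese d (affinePoint o w)) w :=
  AnalyticAt.comp (g := veronese d) (f := affinePoint o) (analyticAt_veronese d _)
    (analyticAt_affinePoint o w)

/-- Affine coordinates on the rational normal curve, as quotients of linear forms. -/
theorem exists_chart_veronese {d : ℕ} (hd : 1 ≤ d) (o : Option ℂ) :
    ∃ l k : (Fin (d + 1) → ℂ) →L[ℂ] ℂ, (∀ w, l (veronese d (affinePoint o w)) = 1) ∧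
      (∀ w, k (veronese d (affinePoint o w)) = w) ∧
      ∀ s, l (veronese d s) ≠ 0 → ∃ c w : ℂ, c ≠ 0 ∧ s = c • affinePoint o w := by
  let e : Fin (d + 1) → (Fin (d + 1) → ℂ) →L[ℂ] ℂ := fun i => ContinuousLinearMap.proj i
  have hd0 : d ≠ 0 := by lia
  cases o with
  | none =>
    refine ⟨e (Fin.last d), e ⟨d - 1, by lia⟩, fun w => ?_, fun w => ?_, fun s hs => ?_⟩
    · simp [e, veronese, affinePoint]
    · simp [e, veronese, affinePoint, Nat.sub_sub_self hd]
    · have h2 : s.2 ≠ 0 := by simpa [e, veronese, hd0] using hs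
      refine ⟨s.2, s.1 / s.2, h2, ?_⟩
      ext
      · simp only [affinePoint, Prod.smul_fst, smul_eq_mul]
        field_simp
      · simp [affinePoint]
  | some X =>
    refine ⟨e 0, e ⟨1, by lia⟩ - X • e 0, fun w => ?_, fun w => ?_, fun s hs => ?_⟩
    · simp [e, veronese, affinePoint]
    · simp [e, veronese, affinePoint]
    · have h1 : s.1 ≠ 0 := by simpa [e, veronese, hd0] using hs
      refine ⟨s.1, s.2 / s.1 - X, h1, ?_⟩
      ext
      · simp [affinePoint]
      · simp only [affinePoint, add_sub_cancel, Prod.smul_snd, smul_eq_mul]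
        field_simp

theorem isImmersiveLiftAt_of_functionals {V : Type*} [NormedAddCommGroup V] [NormedSpace ℂ V]
    [CompleteSpace V] {F : ℂ → V} (hF : AnalyticAt ℂ F 0) (l k : V →L[ℂ] ℂ)
    (hl : ∀ w, l (F w) = 1) (hk : ∀ w, k (F w) = w) : IsImmersiveLiftAt F 0 := by
  rw [isImmersiveLiftAt_iff_deriv]
  refine ⟨hF, fun a b hab => ?_⟩
  have h1 : l (deriv F 0) = 0 := by
    have := iteratedDeriv_clm_comp l hF 1
    simp only [iteratedDeriv_one, hl, deriv_const] at this
    exact this.symm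
  have h2 : k (deriv F 0) = 1 := by
    have := iteratedDeriv_clm_comp k hF 1
    simp only [iteratedDeriv_one, hk] at this
    exact this.symm.trans (deriv_id 0)
  have ha := congrArg l hab
  have hb := congrArg k hab
  simp only [map_add, map_smul, hl, hk, h1, h2, map_zero, smul_eq_mul, mul_one, mul_zero,
    add_zero, zero_add] at ha hb
  exact ⟨ha, hb⟩

theorem isImmersiveLiftAt_veronese {d : ℕ} (hd : 1 ≤ d) (o : Option ℂ) :
    IsImmersiveLiftAt (fun w => veronese d (affinePoint o w)) 0 := by
  obtain ⟨l, k, hl, hk, -⟩ := exists_chart_veronese hd o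
  exact isImmersiveLiftAt_of_functionals (analyticAt_veronese_affinePoint d o 0) l k hl hk

/-- A line of the cone over the rational normal curve that is not in the hyperplane at infinity of
the chart. -/
theorem exists_eq_smul_veronese {d : ℕ} (hd : 1 ≤ d) (o : Option ℂ) :
    ∃ l k : (Fin (d + 1) → ℂ) →L[ℂ] ℂ, l (veronese d (affinePoint o 0)) = 1 ∧
      k (veronese d (affinePoint o 0)) = 0 ∧ ∀ (s : ℂ × ℂ) (c : ℂ), l (c • veronese d s) ≠ 0 →
      (∃ b : ℂ, b ≠ 0 ∧ s = b • affinePoint o (k (c • veronese d s) / l (c • veronese d s))) ∧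
      c • veronese d s = l (c • veronese d s) •
        veronese d (affinePoint o (k (c • veronese d s) / l (c • veronese d s))) := by
  obtain ⟨l, k, hl, hk, hs⟩ := exists_chart_veronese hd o
  refine ⟨l, k, hl 0, hk 0, fun s c hlc => ?_⟩
  rw [map_smul] at hlc
  obtain ⟨b, w, hb, rfl⟩ := hs s (right_ne_zero_of_smul hlc)
  have h1 : k (c • veronese d (b • affinePoint o w)) / l (c • veronese d (b • affinePoint o w))
      = w := by
    simp only [veronese_smul, map_smul, hl, hk, smul_eq_mul] at hlc ⊢
    rw [mul_one] at hlc ⊢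
    rw [← mul_assoc, mul_div_cancel_left₀ _ hlc]
  rw [h1]
  refine ⟨⟨b, hb, rfl⟩, ?_⟩
  simp only [veronese_smul, map_smul, hl, smul_smul, smul_eq_mul, mul_one]

theorem isLocalParametrization_rationalNormalCurve {d : ℕ} (hd : 1 ≤ d) (o : Option ℂ)
    {y : Projectivization ℂ (Fin (d + 1) → ℂ)}
    (hy : y.submodule = Submodule.span ℂ {veronese d (affinePoint o 0)}) :
    IsLocalParametrization (rationalNormalCurve d) y fun w => veronese d (affinePoint o w) := by
  have himm := isImmersiveLiftAt_veronese hd o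
  refine ⟨himm, hy, le_antisymm ?_ ?_⟩
  · have hcont := (analyticAt_cone himm.1 1).continuousAt
    refine tendsto_nhdsWithin_iff.2 ⟨by simpa [ContinuousAt] using hcont, ?_⟩
    filter_upwards [hcont.eventually_ne (by simpa using himm.ne_zero)] with a ha
    refine ⟨ha, affinePoint o a.2, affinePoint_ne_zero o _, ?_⟩
    rw [Projectivization.submodule_mk,
      Submodule.span_singleton_smul_eq (left_ne_zero_of_smul ha).isUnit]
  · obtain ⟨l, k, hl, hk, h⟩ := exists_eq_smul_veronese hd o
    set v₀ := veronese d (affinePoint o 0)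
    have hθ : ContinuousAt (fun v => (l v, k v / l v)) v₀ :=
      l.continuous.continuousAt.prodMk
        (k.continuous.continuousAt.div l.continuous.continuousAt (by rw [hl]; exact one_ne_zero))
    intro S hS
    rw [mem_map] at hS
    have h1 : ∀ᶠ v in 𝓝 v₀, (l v, k v / l v) ∈
        (fun a : ℂ × ℂ => a.1 • veronese d (affinePoint o a.2)) ⁻¹' S := by
      refine hθ.eventually (p := fun a => a ∈
        (fun a : ℂ × ℂ => a.1 • veronese d (affinePoint o a.2)) ⁻¹' S) ?_
      change ∀ᶠ y in 𝓝 (l v₀, k v₀ / l v₀), _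
      rw [hl, hk, zero_div]
      exact hS
    rw [mem_nhdsWithin_iff_eventually]
    filter_upwards [h1, l.continuous.continuousAt.eventually_ne (by rw [hl]; exact one_ne_zero)]
      with v hv hlv ⟨hv0, s, hs, hvs⟩
    rw [Projectivization.submodule_mk] at hvs
    obtain ⟨c, rfl⟩ := Submodule.mem_span_singleton.1
      (hvs ▸ Submodule.mem_span_singleton_self v)
    rw [(h s c hlv).2]
    exact hv

theorem finrank_jetSpan_of_top_le {V : Type*} [NormedAddCommGroup V] [NormedSpace ℂ V]
    [FiniteDimensional ℂ V] {F : ℂ → V} (h : ⊤ ≤ jetSpan (Module.finrank ℂ V) F) (k : ℕ) :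
    Module.finrank ℂ (jetSpan k F) = min k (Module.finrank ℂ V) := by
  rcases le_total k (Module.finrank ℂ V) with hk | hk
  · have hli := linearIndependent_of_top_le_span_of_card_eq_finrank h (by simp)
    have h1 := hli.comp (Fin.castLE hk) (Fin.castLE_injective hk)
    rw [min_eq_left hk]
    have := finrank_span_eq_card h1
    rw [Fintype.card_fin] at this
    exact this
  · rw [min_eq_right hk]
    have : jetSpan k F = ⊤ := top_le_iff.1 (h.trans (jetSpan_mono hk F))
    rw [this, finrank_top]

theorem iteratedDeriv_polynomial_eval (P : Polynomial ℂ) (j : ℕ) :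
    iteratedDeriv j (fun w => P.eval w) = fun w => (Polynomial.derivative^[j] P).eval w := by
  induction j with
  | zero => simp
  | succ j ih =>
    rw [iteratedDeriv_succ, ih]
    funext w
    rw [Polynomial.deriv, Function.iterate_succ_apply']

theorem eq_zero_of_apply_veronese_affinePoint {d : ℕ} {l : (Fin (d + 1) → ℂ) →ₗ[ℂ] ℂ}
    (o : Option ℂ) (h : ∀ w, l (veronese d (affinePoint o w)) = 0) : l = 0 := by
  let R : Polynomial ℂ := ∑ i : Fin (d + 1),
    Polynomial.C (l (Pi.single i 1)) * Polynomial.X ^ (i : ℕ)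
  have hR : ∀ X, R.eval X = l (veronese d (1, X)) := by
    intro X
    rw [apply_veronese]
    simp only [R, Polynomial.eval_finsetSum]
    exact Finset.sum_congr rfl fun i _ => by
      rw [Polynomial.eval_mul, Polynomial.eval_C, Polynomial.eval_pow, Polynomial.eval_X, one_pow,
        one_mul, mul_comm]
  -- The chart at infinity does not see the point `X = 0`; the extra factor takes care of it.
  have h0 : R * Polynomial.X = 0 := by
    refine Polynomial.funext fun X => ?_
    rw [Polynomial.eval_mul, Polynomial.eval_X, hR, Polynomial.eval_zero, mul_eq_zero]
    by_cases hX : X = 0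
    · exact Or.inr hX
    left
    cases o with
    | none =>
      have h1 : ((1 : ℂ), X) = X • affinePoint none X⁻¹ := by
        ext <;> simp [affinePoint, hX]
      rw [h1, veronese_smul, map_smul, h, smul_zero]
    | some Y =>
      have h1 : ((1 : ℂ), X) = affinePoint (some Y) (X - Y) := by
        ext <;> simp [affinePoint]
      rw [h1, h]
  have hR0 : R = 0 := (mul_eq_zero.1 h0).resolve_right Polynomial.X_ne_zero
  refine LinearMap.pi_ext' fun i => LinearMap.ext_ring ?_
  have : R.coeff i = l (Pi.single i 1) := by
    simp [R, Polynomial.coeff_X_pow, Fin.val_inj]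
  simp only [LinearMap.comp_apply, LinearMap.single_apply, LinearMap.zero_apply]
  rw [← this, hR0, Polynomial.coeff_zero]

theorem exists_polynomial_veronese {d : ℕ} (l : (Fin (d + 1) → ℂ) →ₗ[ℂ] ℂ) (o : Option ℂ) :
    ∃ R : Polynomial ℂ, R.natDegree ≤ d ∧ ∀ w, R.eval w = l (veronese d (affinePoint o w)) := by
  cases o with
  | none =>
    refine ⟨∑ i : Fin (d + 1), Polynomial.C (l (Pi.single i 1)) * Polynomial.X ^ (d - (i : ℕ)),
      Polynomial.natDegree_sum_le_of_forall_le _ _ fun i _ =>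
        (Polynomial.natDegree_C_mul_X_pow_le _ _).trans (by lia), fun w => ?_⟩
    rw [apply_veronese, Polynomial.eval_finsetSum]
    exact Finset.sum_congr rfl fun i _ => by
      simp only [affinePoint, Polynomial.eval_mul, Polynomial.eval_C, Polynomial.eval_pow,
        Polynomial.eval_X, one_pow, mul_one, mul_comm]
  | some X =>
    refine ⟨∑ i : Fin (d + 1), Polynomial.C (l (Pi.single i 1)) *
      (Polynomial.X + Polynomial.C X) ^ (i : ℕ),
      Polynomial.natDegree_sum_le_of_forall_le _ _ fun i _ => ?_, fun w => ?_⟩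
    · refine (Polynomial.natDegree_C_mul_le _ _).trans ?_
      rw [Polynomial.natDegree_pow, Polynomial.natDegree_X_add_C]
      lia
    · rw [apply_veronese, Polynomial.eval_finsetSum]
      exact Finset.sum_congr rfl fun i _ => by
        simp only [affinePoint, Polynomial.eval_mul, Polynomial.eval_C, Polynomial.eval_pow,
          Polynomial.eval_add, Polynomial.eval_X, one_pow]
        ring

/-- A linear form killing all these derivatives restricts to a polynomial of degree at most `d` with
a root of multiplicity greater than `d` at the origin. -/
theorem jetSpan_veronese (d : ℕ) (o : Option ℂ) :
    jetSpan (d + 1) (fun w => veronese d (affinePoint o w)) = ⊤ := by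
  refine top_le_iff.1 (submodule_le_of_forall_ker fun l hl => ?_)
  obtain ⟨R, hRd, hR⟩ := exists_polynomial_veronese (l : (Fin (d + 1) → ℂ) →ₗ[ℂ] ℂ) o
  have h1 : ∀ j < d + 1, (Polynomial.derivative^[j] R).eval 0 = 0 := by
    intro j hj
    have h2 := jetSpan_le_iff.1 hl j hj
    rw [← congrFun (iteratedDeriv_polynomial_eval R j) 0, funext hR]
    exact (iteratedDeriv_clm_comp l (analyticAt_veronese_affinePoint d o 0) j).trans h2
  have h2 : R = 0 := by
    by_contra hR0
    have h3 := (Polynomial.lt_rootMultiplicity_iff_isRoot_iterate_derivative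
      (n := d) (t := 0) hR0).2 fun j hj => h1 j (Nat.lt_succ_iff.2 hj)
    have h4 : R.rootMultiplicity 0 ≤ d := by
      rw [← Polynomial.count_roots]
      exact (Multiset.count_le_card _ _).trans (R.card_roots'.trans hRd)
    exact absurd h3 (not_lt.2 h4)
  have h3 : (l : (Fin (d + 1) → ℂ) →ₗ[ℂ] ℂ) = 0 :=
    eq_zero_of_apply_veronese_affinePoint o fun w => by rw [← hR, h2, Polynomial.eval_zero]
  rw [h3, LinearMap.ker_zero]

theorem finrank_jetSpan_veronese {d k : ℕ} (hk : k ≤ d + 1) (o : Option ℂ) :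
    Module.finrank ℂ (jetSpan k fun w => veronese d (affinePoint o w)) = k := by
  have := finrank_jetSpan_of_top_le (F := fun w => veronese d (affinePoint o w)) (by
    rw [Module.finrank_fin_fun]
    exact (jetSpan_veronese d o).ge) k
  rw [this, Module.finrank_fin_fun, min_eq_left hk]

theorem osculatingSpace_rationalNormalCurve {d : ℕ} (hd : 1 ≤ d) (k : ℕ) (o : Option ℂ)
    {y : Projectivization ℂ (Fin (d + 1) → ℂ)}
    (hy : y.submodule = Submodule.span ℂ {veronese d (affinePoint o 0)}) :
    osculatingSpace ℂ k (rationalNormalCurve d) y =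
      jetSpan (k + 1) fun w => veronese d (affinePoint o w) := by
  rw [osculatingSpace_eq (isLocalParametrization_rationalNormalCurve hd o hy), jetSpan_succ]

theorem exists_affinePoint_of_mem_rationalNormalCurve {d : ℕ}
    {y : Projectivization ℂ (Fin (d + 1) → ℂ)} (hy : y ∈ rationalNormalCurve d) :
    ∃ o, y.submodule = Submodule.span ℂ {veronese d (affinePoint o 0)} := by
  obtain ⟨s, hs, hys⟩ := hy
  obtain ⟨o, c, hc, rfl⟩ := exists_eq_smul_affinePoint hs
  exact ⟨o, by rw [hys, veronese_smul, Submodule.span_singleton_smul_eq (pow_ne_zero _ hc).isUnit]⟩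

end RationalNormalCurve

/-! ### Families of lines -/

section Families

variable {V : Type*} [NormedAddCommGroup V] [NormedSpace ℂ V]

/-- With `l (g i) = 1`, non-proportionality is witnessed by the vector `l (g i) • v - l v • g i`
being nonzero, an open condition. -/
theorem eventually_notMem_span {K : Type*} [TopologicalSpace K] {g : K → V} {i : K} {v₀ : V}
    (hg : ContinuousAt g i) (hg0 : g i ≠ 0) (h : v₀ ∉ Submodule.span ℂ {g i}) :
    ∀ᶠ z in 𝓝 v₀ ×ˢ 𝓝 i, z.1 ∉ Submodule.span ℂ {g z.2} := by
  obtain ⟨l, hl⟩ := exists_clm_eq_one hg0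
  have hg' : ContinuousAt (fun z : V × K => g z.2) (v₀, i) :=
    ContinuousAt.comp (g := g) (f := Prod.snd) hg continuousAt_snd
  have hc : ContinuousAt (fun z : V × K => l (g z.2) • z.1 - l z.1 • g z.2) (v₀, i) :=
    ((l.continuous.continuousAt.comp hg').smul continuousAt_fst).sub
      ((l.continuous.continuousAt.comp continuousAt_fst).smul hg')
  have hne : l (g i) • v₀ - l v₀ • g i ≠ 0 := by
    intro h0
    rw [hl, one_smul, sub_eq_zero] at h0
    exact h (h0 ▸ Submodule.smul_mem _ _ (Submodule.mem_span_singleton_self _))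
  rw [← nhds_prod_eq]
  filter_upwards [hc.eventually_ne hne] with z hz hmem
  obtain ⟨c, hcz⟩ := Submodule.mem_span_singleton.1 hmem
  apply hz
  rw [← hcz, map_smul, smul_smul, smul_eq_mul, mul_comm c, sub_self]

/-- In a continuous family of lines parametrized by a compact space, the lines that come close to
a point of exactly one of them have parameters close to that line. -/
theorem eventually_forall_mem_imp {K : Type*} [TopologicalSpace K] [CompactSpace K]
    {P : K → Submodule ℂ V} {v₀ : V} {N : Set K}
    (hP : ∀ i, v₀ ∉ P i → ∀ᶠ z in 𝓝 v₀ ×ˢ 𝓝 i, z.1 ∉ P z.2) (hN : ∀ i, v₀ ∈ P i → N ∈ 𝓝 i) :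
    ∀ᶠ v in 𝓝 v₀, ∀ i, v ∈ P i → i ∈ N := by
  have := (isCompact_univ (X := K)).eventually_forall_of_forall_eventually (x₀ := v₀)
    (P := fun v i => v ∈ P i → i ∈ N) fun i _ => by
      rw [nhds_prod_eq]
      by_cases h : v₀ ∈ P i
      · filter_upwards [prod_mem_prod univ_mem (hN i h)] with z hz _
        exact hz.2
      · filter_upwards [hP i h] with z hz hz'
        exact absurd hz' hz
  filter_upwards [this] with v hv i
  exact hv i (Set.mem_univ i)

end Families

/-! ### Linear isomorphisms and unions of lines -/

section ProjectiveMaps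

theorem Projectivization.submodule_map {V W : Type*} [AddCommGroup V] [Module ℂ V]
    [AddCommGroup W] [Module ℂ W] (f : V →ₗ[ℂ] W) (hf : Function.Injective f)
    (x : Projectivization ℂ V) : (Projectivization.map f hf x).submodule = x.submodule.map f := by
  induction x using Projectivization.ind with
  | h v hv =>
    rw [Projectivization.map_mk, Projectivization.submodule_mk, Projectivization.submodule_mk,
      Submodule.map_span, Set.image_singleton]

theorem image_joinOfCurves {V W : Type*} [AddCommGroup V] [Module ℂ V]
    [AddCommGroup W] [Module ℂ W] (e : V ≃ₗ[ℂ] W) {ι κ : Type*} {P Q : ι → Submodule ℂ V}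
    {P' Q' : κ → Submodule ℂ W}
    (h₁ : ∀ i, ∃ j, (P i).map e.toLinearMap = P' j ∧ (Q i).map e.toLinearMap = Q' j)
    (h₂ : ∀ j, ∃ i, (P i).map e.toLinearMap = P' j ∧ (Q i).map e.toLinearMap = Q' j) :
    Projectivization.map e.toLinearMap e.injective '' joinOfCurves P Q = joinOfCurves P' Q' := by
  ext y
  constructor
  · rintro ⟨x, ⟨i, hi⟩, rfl⟩
    obtain ⟨j, hj₁, hj₂⟩ := h₁ i
    refine ⟨j, ?_⟩
    rw [Projectivization.submodule_map, ← hj₁, ← hj₂, ← Submodule.map_sup]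
    exact Submodule.map_mono hi
  · rintro ⟨j, hj⟩
    obtain ⟨i, hi₁, hi₂⟩ := h₂ j
    refine ⟨Projectivization.map e.symm.toLinearMap e.symm.injective y, ⟨i, ?_⟩, ?_⟩
    · rw [← hi₁, ← hi₂, ← Submodule.map_sup] at hj
      rw [Projectivization.submodule_map]
      refine (Submodule.map_mono hj).trans (le_of_eq ?_)
      rw [← Submodule.map_comp]
      simp
    · apply Projectivization.submodule_injective
      rw [Projectivization.submodule_map, Projectivization.submodule_map, ← Submodule.map_comp]
      simp

end ProjectiveMaps

/-! ### Decomposable scrolls without inflection points -/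

section Immersive

/-- Euler's relation, obtained by differentiating `a ↦ π (veronese d (a • s))` at `a = 1`. -/
theorem isHomogeneous_fderiv_veronese {W : Type*} [NormedAddCommGroup W] [NormedSpace ℂ W] {d : ℕ}
    (π : (Fin (d + 1) → ℂ) →L[ℂ] W) (s : ℂ × ℂ) :
    fderiv ℂ (fun s => π (veronese d s)) s s = (d : ℂ) • π (veronese d s) := by
  have hB : HasFDerivAt (fun s => π (veronese d s)) (fderiv ℂ (fun s => π (veronese d s)) s)
      ((1 : ℂ) • s) := by
    rw [one_smul]
    exact ((π.analyticAt _).comp (analyticAt_veronese d s)).differentiableAt.hasFDerivAt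
  have h1 : HasDerivAt (fun a : ℂ => a • s) ((1 : ℂ) • s) 1 :=
    (hasDerivAt_id (1 : ℂ)).smul_const s
  have h2 := hB.comp_hasDerivAt (1 : ℂ) h1
  have h3 : HasDerivAt (fun a : ℂ => a ^ d • π (veronese d s))
      (((d : ℂ) * 1 ^ (d - 1)) • π (veronese d s)) 1 :=
    (hasDerivAt_pow d (1 : ℂ)).smul_const _
  have h4 : ((fun s => π (veronese d s)) ∘ fun a : ℂ => a • s) =
      fun a : ℂ => a ^ d • π (veronese d s) := by
    funext a
    simp [veronese_smul]
  rw [h4] at h2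
  simpa using h2.unique h3

theorem injective_fderiv_smul {W : Type*} [NormedAddCommGroup W] [NormedSpace ℂ W] {d : ℕ}
    (π : (Fin (d + 1) → ℂ) →L[ℂ] W) {s : ℂ × ℂ} {a : ℂ} (ha : a ≠ 0)
    (h : Function.Injective (fderiv ℂ (fun s => π (veronese d s)) s)) :
    Function.Injective (fderiv ℂ (fun s => π (veronese d s)) (a • s)) := by
  have hB : ∀ s, HasFDerivAt (fun s => π (veronese d s)) (fderiv ℂ (fun s => π (veronese d s)) s)
      s := fun s => ((π.analyticAt _).comp (analyticAt_veronese d s)).differentiableAt.hasFDerivAt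
  have h1 : HasFDerivAt (fun s : ℂ × ℂ => a • s) (a • ContinuousLinearMap.id ℂ (ℂ × ℂ)) s :=
    (hasFDerivAt_id s).const_smul a
  have h2 := (hB (a • s)).comp s h1
  have h3 : ((fun s => π (veronese d s)) ∘ fun s : ℂ × ℂ => a • s) =
      fun s => a ^ d • π (veronese d s) := by
    funext s
    simp [veronese_smul]
  rw [h3] at h2
  have h4 := h2.unique ((hB s).const_smul (a ^ d))
  rw [injective_iff_map_eq_zero] at h ⊢
  intro v hv
  have h5 := congrArg (fun L : (ℂ × ℂ) →L[ℂ] W => L (a⁻¹ • v)) h4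
  simp only [ContinuousLinearMap.comp_apply, smul_apply,
    ContinuousLinearMap.id_apply, smul_inv_smul₀ ha, hv] at h5
  have h6 := h _ ((smul_eq_zero.1 h5.symm).resolve_left (pow_ne_zero _ ha))
  exact (smul_eq_zero.1 h6).resolve_left (inv_ne_zero ha)

/-- The range of the differential contains `F 0` by Euler's relation and `deriv F 0` by the chain
rule. These are independent, so a linear map from a plane with this range is injective. -/
theorem injective_fderiv_of_isImmersiveLiftAt {W : Type*} [NormedAddCommGroup W] [NormedSpace ℂ W]
    {d : ℕ} (hd : 1 ≤ d) (π : (Fin (d + 1) → ℂ) →L[ℂ] W) {F : ℂ → W}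
    (hF : IsImmersiveLiftAt F 0) {κ : ℂ → ℂ} {c : ℂ → ℂ × ℂ} (hκ : AnalyticAt ℂ κ 0)
    (hc : AnalyticAt ℂ c 0) (h : F =ᶠ[𝓝 0] fun w => κ w • π (veronese d (c w))) :
    Function.Injective (fderiv ℂ (fun s => π (veronese d s)) (c 0)) := by
  set D := fderiv ℂ (fun s => π (veronese d s)) (c 0)
  have hB : HasFDerivAt (fun s => π (veronese d s)) D (c 0) :=
    ((π.analyticAt _).comp (analyticAt_veronese d _)).differentiableAt.hasFDerivAt
  have hd0 : (d : ℂ) ≠ 0 := by exact_mod_cast (by lia : d ≠ 0)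
  have h0 : π (veronese d (c 0)) ∈ LinearMap.range (D : (ℂ × ℂ) →ₗ[ℂ] W) := by
    refine ⟨(d : ℂ)⁻¹ • c 0, ?_⟩
    rw [map_smul]
    change (d : ℂ)⁻¹ • D (c 0) = _
    rw [isHomogeneous_fderiv_veronese, inv_smul_smul₀ hd0]
  have h1 : HasDerivAt F (κ 0 • D (deriv c 0) + deriv κ 0 • π (veronese d (c 0))) 0 := by
    refine HasDerivAt.congr_of_eventuallyEq ?_ h
    exact hκ.differentiableAt.hasDerivAt.smul
      (hB.comp_hasDerivAt (0 : ℂ) hc.differentiableAt.hasDerivAt)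
  have hF0 : F 0 ∈ LinearMap.range (D : (ℂ × ℂ) →ₗ[ℂ] W) := by
    rw [h.self_of_nhds]
    exact Submodule.smul_mem _ _ h0
  have hF1 : deriv F 0 ∈ LinearMap.range (D : (ℂ × ℂ) →ₗ[ℂ] W) := by
    rw [h1.deriv]
    exact Submodule.add_mem _ (Submodule.smul_mem _ _ ⟨_, rfl⟩) (Submodule.smul_mem _ _ h0)
  have hli : LinearIndependent ℂ ![F 0, deriv F 0] :=
    LinearIndependent.pair_iff.2 (isImmersiveLiftAt_iff_deriv.1 hF).2
  have h2 := finrank_span_eq_card hli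
  have h3 : Submodule.span ℂ (Set.range ![F 0, deriv F 0]) ≤
      LinearMap.range (D : (ℂ × ℂ) →ₗ[ℂ] W) := by
    rw [Submodule.span_le]
    rintro _ ⟨i, rfl⟩
    fin_cases i
    · exact hF0
    · exact hF1
  have h4 := Submodule.finrank_mono h3
  have h5 := LinearMap.finrank_range_add_finrank_ker (D : (ℂ × ℂ) →ₗ[ℂ] W)
  rw [h2, Fintype.card_fin] at h4
  rw [Module.finrank_prod, Module.finrank_self] at h5
  have h6 : LinearMap.ker (D : (ℂ × ℂ) →ₗ[ℂ] W) = ⊥ := by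
    rw [← Submodule.finrank_eq_zero (R := ℂ)]
    lia
  exact LinearMap.ker_eq_bot.1 h6

end Immersive

/-! ### Decomposable scrolls near a directrix -/

section Scroll

variable {V : Type*} [NormedAddCommGroup V] [NormedSpace ℂ V]

theorem Projectivization.submodule_eq_span {x : Projectivization ℂ V} {v : V} (hv : v ≠ 0)
    (h : v ∈ x.submodule) : x.submodule = Submodule.span ℂ {v} := by
  rw [x.submodule_eq] at h ⊢
  obtain ⟨c, rfl⟩ := Submodule.mem_span_singleton.1 h
  rw [Submodule.span_singleton_smul_eq (left_ne_zero_of_smul hv).isUnit]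

theorem IsLocalScroll.finrank_osculatingSpace [FiniteDimensional ℂ V] {ι : Type*}
    {P Q : ι → Submodule ℂ V} {F₁ F₂ : ℂ → V} {p : V →L[ℂ] V} (hp₁ : ∀ i, ∀ v ∈ P i, p v = v)
    (hp₂ : ∀ i, ∀ v ∈ Q i, p v = 0) (h : IsLocalScroll P Q F₁ F₂) {x : Projectivization ℂ V}
    (hx : x.submodule = Submodule.span ℂ {F₁ 0}) (k : ℕ) :
    Module.finrank ℂ (osculatingSpace (ℂ × ℂ) k (joinOfCurves P Q) x) =
      Module.finrank ℂ (jetSpan (k + 1) F₁) + Module.finrank ℂ (jetSpan k F₂) := by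
  have : CompleteSpace V := FiniteDimensional.complete ℂ V
  rw [osculatingSpace_eq (h.isLocalParametrization hp₁ hp₂ (t₀ := 0) (by simpa using hx))]
  exact le_antisymm (finrank_derivativeSpan_ruledLift_zero_le h.immersive₁.1 h.immersive₂.1 k)
    (h.le_finrank_derivativeSpan hp₁ hp₂ 0 k)

variable {C : Type*} [TopologicalSpace C] [ChartedSpace ℂ C] [CompactSpace C]
  {φ₁ φ₂ : C → Projectivization ℂ V} {G₁ G₂ : C → ℂ → V}

omit [CompactSpace C] in
theorem eventually_notMem_of_lift {φ : C → Projectivization ℂ V} {G : ℂ → V} {i : C}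
    (hG : AnalyticAt ℂ G 0) (hG0 : G 0 ≠ 0)
    (hl : ∀ᶠ w in 𝓝 (0 : ℂ), (φ (localParam i w)).submodule = Submodule.span ℂ {G w}) {v₀ : V}
    (hv : v₀ ∉ (φ i).submodule) : ∀ᶠ z in 𝓝 v₀ ×ˢ 𝓝 i, z.1 ∉ (φ z.2).submodule := by
  have h0 := hl.self_of_nhds
  rw [localParam_zero] at h0
  have h1 := eventually_notMem_span hG.continuousAt hG0 (h0 ▸ hv)
  rw [eventually_prod_iff] at h1
  obtain ⟨A, hA, U, hU, hAU⟩ := h1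
  refine eventually_prod_iff.2 ⟨A, hA, fun j => ∃ w, U w ∧ j = localParam i w ∧
    (φ (localParam i w)).submodule = Submodule.span ℂ {G w}, ?_, ?_⟩
  · rw [eventually_nhds_iff_localParam]
    filter_upwards [hU, hl] with w h1 h2
    exact ⟨w, h1, rfl, h2⟩
  · rintro v hv j ⟨w, hw, rfl, hl⟩
    simp only [hl]
    exact hAU hv hw

/-- By injectivity only the centre `q` has its line through the base vector, and compactness of `C`
then excludes distant parameters near that vector. -/
theorem isLocalScroll_of_lifts (hφ₁ : Function.Injective φ₁) (hφ₂ : Function.Injective φ₂)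
    (hG₁ : ∀ p, IsImmersiveLiftAt (G₁ p) 0) (hG₂ : ∀ p, IsImmersiveLiftAt (G₂ p) 0)
    (hl₁ : ∀ p, ∀ᶠ w in 𝓝 (0 : ℂ), (φ₁ (localParam p w)).submodule = Submodule.span ℂ {G₁ p w})
    (hl₂ : ∀ p, ∀ᶠ w in 𝓝 (0 : ℂ), (φ₂ (localParam p w)).submodule = Submodule.span ℂ {G₂ p w})
    (q : C) : IsLocalScroll (fun p => (φ₁ p).submodule) (fun p => (φ₂ p).submodule)
      (G₁ q) (G₂ q) := by
  have hN : ∀ U ∈ 𝓝 (0 : ℂ), {i | ∃ z ∈ U, (φ₁ i).submodule = Submodule.span ℂ {G₁ q z} ∧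
      (φ₂ i).submodule = Submodule.span ℂ {G₂ q z}} ∈ 𝓝 q := by
    intro U hU
    change ∀ᶠ i in 𝓝 q, ∃ z ∈ U, (φ₁ i).submodule = Submodule.span ℂ {G₁ q z} ∧
      (φ₂ i).submodule = Submodule.span ℂ {G₂ q z}
    rw [eventually_nhds_iff_localParam]
    filter_upwards [hU, hl₁ q, hl₂ q] with w h1 h2 h3
    exact ⟨w, h1, h2, h3⟩
  have huniq : ∀ {φ : C → Projectivization ℂ V} {G : C → ℂ → V}, Function.Injective φ →
      (∀ p, IsImmersiveLiftAt (G p) 0) →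
      (∀ p, ∀ᶠ w in 𝓝 (0 : ℂ), (φ (localParam p w)).submodule = Submodule.span ℂ {G p w}) →
      ∀ i, G q 0 ∈ (φ i).submodule → i = q := by
    intro φ G hφ hG hl i hi
    have h0 := (hl q).self_of_nhds
    rw [localParam_zero] at h0
    exact hφ (Projectivization.submodule_injective
      ((Projectivization.submodule_eq_span (hG q).ne_zero hi).trans h0.symm))
  refine ⟨hG₁ q, hG₂ q, ?_, fun U hU => ?_, fun U hU => ?_⟩
  · filter_upwards [hl₁ q, hl₂ q] with w h1 h2
    exact ⟨_, h1, h2⟩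
  · exact eventually_forall_mem_imp (fun i hi => eventually_notMem_of_lift (hG₁ i).1
      (hG₁ i).ne_zero (hl₁ i) hi) fun i hi => huniq hφ₁ hG₁ hl₁ i hi ▸ hN U hU
  · exact eventually_forall_mem_imp (fun i hi => eventually_notMem_of_lift (hG₂ i).1
      (hG₂ i).ne_zero (hl₂ i) hi) fun i hi => huniq hφ₂ hG₂ hl₂ i hi ▸ hN U hU

end Scroll

/-! ### Jets at a general point -/

section Generic

variable {W : Type*} [NormedAddCommGroup W] [NormedSpace ℂ W] [FiniteDimensional ℂ W]
  {C : Type*} [TopologicalSpace C] [ChartedSpace ℂ C] [PreconnectedSpace C]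

/-- A nondegenerate curve has maximal jets at a general point. -/
theorem IsCurveLift.eventually_top_le_jetSpan {H : C → ℂ → W} (hH : IsCurveLift H)
    (hnd : ∀ l : W →ₗ[ℂ] ℂ, (∀ q, l (H q 0) = 0) → l = 0) (p : C) :
    ∀ᶠ w in 𝓝[≠] (0 : ℂ), ⊤ ≤ jetSpan (Module.finrank ℂ W) (H (localParam p w)) := by
  let b := Module.finBasis ℂ W
  have hu : ∀ i, IsForm 1 (fun v => b.coord i v) :=
    fun i => (LinearMap.toContinuousLinearMap (b.coord i)).isForm
  have h1 := hH.eventually_wronskianDet_ne_zero hu (fun c hc => by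
    have h2 := hnd (∑ i, c i • b.coord i) (fun q => by
      simpa [LinearMap.sum_apply] using hc q)
    ext j
    have h3 := congrArg (fun l : W →ₗ[ℂ] ℂ => l (b j)) h2
    simpa [LinearMap.sum_apply, Finsupp.single_apply] using h3) p
  filter_upwards [h1, (hH.compat p).filter_mono nhdsWithin_le_nhds,
    ((hH.analytic p).eventually_analyticAt).filter_mono nhdsWithin_le_nhds]
    with w hw ⟨g, ψ, h₁, h₂, h₃, h₄, h₅, _, h₇⟩ han
  refine (wronskianDet_coord_ne_zero_iff b (hH.analytic _)).1 ?_
  rw [IsCurveLift.wronskianDet_localParam hu p han h₁ h₃ h₄ h₇]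
  exact mul_ne_zero (mul_ne_zero (pow_ne_zero _ (pow_ne_zero _ h₂)) (pow_ne_zero _ h₅)) hw

end Generic

/-! ### Classification of decomposable scrolls without inflection points -/

section Classification

theorem projectivelyEquivalent_rationalScroll {V U₁ U₂ : Type*} [AddCommGroup V] [Module ℂ V]
    [AddCommGroup U₁] [Module ℂ U₁] [AddCommGroup U₂] [Module ℂ U₂] (e : V ≃ₗ[ℂ] U₁ × U₂)
    {ι : Type*} {P Q : ι → Submodule ℂ V} {A : ℂ × ℂ → U₁} {B : ℂ × ℂ → U₂} {pt : ι → ℂ × ℂ}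
    (hpt0 : ∀ i, pt i ≠ 0) (hpt : ∀ s, s ≠ 0 → ∃ i, ∃ c : ℂ, c ≠ 0 ∧ s = c • pt i) {a b : ℕ}
    (hA : ∀ (c : ℂ) s, A (c • s) = c ^ a • A s) (hB : ∀ (c : ℂ) s, B (c • s) = c ^ b • B s)
    (hP : ∀ i, (P i).map e.toLinearMap = Submodule.span ℂ {(A (pt i), 0)})
    (hQ : ∀ i, (Q i).map e.toLinearMap = Submodule.span ℂ {(0, B (pt i))}) :
    ProjectivelyEquivalent (joinOfCurves P Q) (rationalScroll A B) := by
  refine ⟨e, image_joinOfCurves e (fun i => ⟨⟨pt i, hpt0 i⟩, hP i, hQ i⟩) fun ⟨s, hs⟩ => ?_⟩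
  obtain ⟨i, c, hc, rfl⟩ := hpt s hs
  refine ⟨i, ?_, ?_⟩
  · rw [hP, hA, show (c ^ a • A (pt i), (0 : U₂)) = c ^ a • (A (pt i), (0 : U₂)) by simp,
      Submodule.span_singleton_smul_eq (pow_ne_zero _ hc).isUnit]
  · rw [hQ, hB, show ((0 : U₁), c ^ b • B (pt i)) = c ^ b • ((0 : U₁), B (pt i)) by simp,
      Submodule.span_singleton_smul_eq (pow_ne_zero _ hc).isUnit]

section Coord

variable {C : Type*} [TopologicalSpace C] [ChartedSpace ℂ C] {p : C} {x : C → ℂ} {y : ℂ → ℂ}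

theorem IsCoordinate.exists_eq_affinePoint (hx : IsCoordinate p x y) (q : C) :
    ∃ (o : Option ℂ) (ξ : ℂ → ℂ), AnalyticAt ℂ ξ 0 ∧ ξ 0 = 0 ∧
      coordPoint p x y q = fun w => affinePoint o (ξ w) := by
  by_cases hq : q = p
  · exact ⟨none, y, hx.analytic_inv, hx.inv_zero, by funext w; simp [coordPoint, hq, affinePoint]⟩
  · exact ⟨some (x q), fun w => x (localParam q w) - x q, (hx.analytic q hq).sub analyticAt_const,
      by simp, by funext w; simp [coordPoint, hq, affinePoint]⟩

theorem coordPoint_ne_zero (q : C) (w : ℂ) : coordPoint p x y q w ≠ 0 := by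
  by_cases hq : q = p <;> simp [coordPoint, hq]

theorem IsCoordinate.exists_eq_smul_coordPoint [IsManifold 𝓘(ℂ) ω C] [CompactSpace C]
    [PreconnectedSpace C] (hx : IsCoordinate p x y) {s : ℂ × ℂ} (hs : s ≠ 0) :
    ∃ q, ∃ c : ℂ, c ≠ 0 ∧ s = c • coordPoint p x y q 0 := by
  obtain ⟨o, c, hc, rfl⟩ := exists_eq_smul_affinePoint hs
  cases o with
  | none => exact ⟨p, c, hc, by simp [coordPoint, affinePoint, hx.inv_zero]⟩
  | some X =>
    obtain ⟨q, hq, rfl⟩ := hx.exists_apply_eq X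
    exact ⟨q, c, hc, by simp [coordPoint, affinePoint, hq]⟩

end Coord

variable {V : Type*} [NormedAddCommGroup V] [NormedSpace ℂ V] [FiniteDimensional ℂ V]
variable {C : Type*} [TopologicalSpace C] [ChartedSpace ℂ C] [CompactSpace C]
  [IsManifold 𝓘(ℂ) ω C] [ConnectedSpace C] {φ₁ φ₂ : C → Projectivization ℂ V}

/-- The first directrix is a rational normal curve and supplies a coordinate on `C`; the second is
expressed by binary forms in that same coordinate, so corresponding points have the same parameter
in `ℙ¹`. The degree `d` of these forms separates the two cases. -/
theorem classification_of_flexless {m : ℕ} (hm : 2 ≤ m) {V₁ V₂ : Submodule ℂ V}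
    (hc : IsCompl V₁ V₂) (hn₁ : Module.finrank ℂ V₁ = m + 1) (hn₂ : Module.finrank ℂ V₂ = m + 2)
    (hinj₁ : Function.Injective φ₁) (hinj₂ : Function.Injective φ₂)
    {H₁ : C → ℂ → V₁} {H₂ : C → ℂ → V₂} (hH₁ : IsCurveLift H₁) (hH₂ : IsCurveLift H₂)
    (hφ₁ : ∀ q, (φ₁ q).submodule = Submodule.span ℂ {(H₁ q 0 : V)})
    (hφ₂ : ∀ q, (φ₂ q).submodule = Submodule.span ℂ {(H₂ q 0 : V)})
    (himm : ∀ q, IsImmersiveLiftAt (H₂ q) 0) (hflex₁ : ∀ q, jetSpan (m + 1) (H₁ q) = ⊤)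
    (hflex₂ : ∀ q, m + 1 ≤ Module.finrank ℂ (jetSpan (m + 1) (H₂ q)))
    (hnd₂ : ∀ l : V₂ →ₗ[ℂ] ℂ, (∀ q, l (H₂ q 0) = 0) → l = 0) :
    IsSemibalancedRationalNormalScroll m
        (joinOfCurves (fun q => (φ₁ q).submodule) fun q => (φ₂ q).submodule) ∨
      ∃ d, m + 2 ≤ d ∧ IsProjectedRationalScroll m d
        (joinOfCurves (fun q => (φ₁ q).submodule) fun q => (φ₂ q).submodule) := by
  have hspan : ∀ {U : Submodule ℂ V} {φ : C → Projectivization ℂ V} {H : C → ℂ → U},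
      Function.Injective φ → (∀ q, (φ q).submodule = Submodule.span ℂ {(H q 0 : V)}) →
      IsCurveLift H → ∀ q q', H q 0 ∈ Submodule.span ℂ {H q' 0} → q = q' := by
    intro U φ H hφ h hH q q' hqq
    apply hφ
    apply Projectivization.submodule_injective
    rw [h q, h q']
    obtain ⟨c, hc⟩ := Submodule.mem_span_singleton.1 hqq
    have hc0 : c ≠ 0 := by
      rintro rfl
      rw [zero_smul] at hc
      exact hH.ne_zero q hc.symm
    rw [← hc, Submodule.coe_smul, Submodule.span_singleton_smul_eq hc0.isUnit]
  have hinjH₁ := hspan hinj₁ hφ₁ hH₁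
  have hinjH₂ := hspan hinj₂ hφ₂ hH₂
  obtain ⟨p⟩ : Nonempty C := inferInstance
  obtain ⟨x, y, hx, -, π₁, hπ₁⟩ := hH₁.exists_rationalNormal hm hn₁ hflex₁ hinjH₁ p
  obtain ⟨d, π, hπ, hGπ⟩ := hx.exists_rational_parametrization hH₂
  let pt : C → ℂ × ℂ := fun q => coordPoint p x y q 0
  have hpt : ∀ s, s ≠ 0 → ∃ q, ∃ c : ℂ, c ≠ 0 ∧ s = c • pt q :=
    fun s hs => hx.exists_eq_smul_coordPoint hs
  have hsurj : Function.Surjective π := by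
    rw [← LinearMap.range_eq_top]
    refine top_le_iff.1 (submodule_le_of_forall_ker fun l hl => ?_)
    have hl0 : (l : V₂ →ₗ[ℂ] ℂ) = 0 := by
      refine hnd₂ _ fun q => ?_
      obtain ⟨κ, -, -, h⟩ := hGπ q
      rw [h.self_of_nhds, map_smul]
      have : l (π (veronese d (coordPoint p x y q 0))) = 0 := hl (LinearMap.mem_range_self _ _)
      exact smul_eq_zero_of_right _ this
    rw [hl0, LinearMap.ker_zero]
  have hdm : m + 1 ≤ d := by
    have := LinearMap.finrank_le_finrank_of_surjective hsurj
    rw [hn₂, Module.finrank_fin_fun] at this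
    lia
  have heq₁ : ∀ q, ∃ c : ℂ, c ≠ 0 ∧ H₁ q 0 = c • π₁ (veronese m (pt q)) := fun q =>
    let ⟨κ, _, h, h'⟩ := hπ₁ q
    ⟨κ 0, h, h'.self_of_nhds⟩
  have heq₂ : ∀ q, ∃ c : ℂ, c ≠ 0 ∧ H₂ q 0 = c • π (veronese d (pt q)) := fun q =>
    let ⟨κ, _, h, h'⟩ := hGπ q
    ⟨κ 0, h, h'.self_of_nhds⟩
  have hequiv : ∀ (n k : ℕ) (θ : V₂ ≃ₗ[ℂ] (Fin (n + 1) → ℂ)) (B : ℂ × ℂ → Fin (n + 1) → ℂ),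
      (∀ (c : ℂ) s, B (c • s) = c ^ k • B s) → (∀ s, θ (π (veronese d s)) = B s) →
      ProjectivelyEquivalent (joinOfCurves (fun q => (φ₁ q).submodule)
        fun q => (φ₂ q).submodule) (rationalScroll (veronese m) B) := by
    intro n k θ B hB hθ
    let e : V ≃ₗ[ℂ] (Fin (m + 1) → ℂ) × (Fin (n + 1) → ℂ) :=
      (V₁.prodEquivOfIsCompl V₂ hc).symm.trans (π₁.symm.prodCongr θ)
    refine projectivelyEquivalent_rationalScroll e (fun q => coordPoint_ne_zero q 0) hpt
      (veronese_smul m) hB (fun q => ?_) fun q => ?_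
    · obtain ⟨c, hc0, h⟩ := heq₁ q
      have he : e (H₁ q 0 : V) = c • (veronese m (pt q), 0) := by
        simp only [e, LinearEquiv.trans_apply, Submodule.prodEquivOfIsCompl_symm_apply_left]
        rw [h]
        simp
      rw [hφ₁, Submodule.map_span, Set.image_singleton]
      change Submodule.span ℂ {e (H₁ q 0 : V)} = _
      rw [he, Submodule.span_singleton_smul_eq hc0.isUnit]
    · obtain ⟨c, hc0, h⟩ := heq₂ q
      have he : e (H₂ q 0 : V) = c • (0, B (pt q)) := by
        simp only [e, LinearEquiv.trans_apply, Submodule.prodEquivOfIsCompl_symm_apply_right]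
        rw [h]
        simp [hθ]
      rw [hφ₂, Submodule.map_span, Set.image_singleton]
      change Submodule.span ℂ {e (H₂ q 0 : V)} = _
      rw [he, Submodule.span_singleton_smul_eq hc0.isUnit]
  rcases hdm.eq_or_lt with rfl | hdm
  · left
    have hbij : Function.Bijective π :=
      ⟨(LinearMap.injective_iff_surjective_of_finrank_eq_finrank (by simp [hn₂])).2 hsurj, hsurj⟩
    let π' := LinearEquiv.ofBijective π hbij
    exact hequiv (m + 1) (m + 1) π'.symm _ (veronese_smul _) fun s =>
      π'.symm_apply_apply (veronese (m + 1) s)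
  · right
    let θ : V₂ ≃ₗ[ℂ] (Fin (m + 2) → ℂ) := LinearEquiv.ofFinrankEq _ _ (by simp [hn₂])
    let πL : (Fin (d + 1) → ℂ) →L[ℂ] V₂ := LinearMap.toContinuousLinearMap π
    let θL : V₂ ≃L[ℂ] (Fin (m + 2) → ℂ) := θ.toContinuousLinearEquiv
    refine ⟨d, hdm, θ.toLinearMap ∘ₗ π, θ.surjective.comp hsurj,
      ⟨fun s hs => ?_, fun s t hs ht hst => ?_, fun s hs => ?_⟩, fun z hz => ?_,
      hequiv (m + 1) d θ _ (fun c s => by rw [veronese_smul, map_smul]) fun s => rfl⟩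
    · exact θ.map_ne_zero_iff.2 (hπ s hs)
    · obtain ⟨q, c, hc0, rfl⟩ := hpt s hs
      obtain ⟨q', c', hc0', rfl⟩ := hpt t ht
      obtain ⟨a, ha, hq⟩ := heq₂ q
      obtain ⟨a', ha', hq'⟩ := heq₂ q'
      simp only [veronese_smul, map_smul, Submodule.span_singleton_smul_eq
        (pow_ne_zero d hc0).isUnit, Submodule.span_singleton_smul_eq
        (pow_ne_zero d hc0').isUnit] at hst
      have h1 : q = q' := by
        apply hinjH₂
        rw [hq, hq', Submodule.span_singleton_smul_eq ha'.isUnit]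
        refine Submodule.smul_mem _ _ ?_
        obtain ⟨b, hb⟩ := Submodule.mem_span_singleton.1
          (hst ▸ Submodule.mem_span_singleton_self _ :
            (θ.toLinearMap ∘ₗ π) (veronese d (pt q)) ∈ Submodule.span ℂ
              {(θ.toLinearMap ∘ₗ π) (veronese d (pt q'))})
        refine Submodule.mem_span_singleton.2 ⟨b, θ.injective ?_⟩
        rw [map_smul]
        exact hb
      rw [h1, Submodule.span_singleton_smul_eq hc0.isUnit,
        Submodule.span_singleton_smul_eq hc0'.isUnit]
    · obtain ⟨q, c, hc0, rfl⟩ := hpt s hs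
      obtain ⟨κ, hκ, -, h⟩ := hGπ q
      obtain ⟨o, ξ, hξ, hξ0, hpo⟩ := hx.exists_eq_affinePoint q
      have han : AnalyticAt ℂ (coordPoint p x y q) 0 := by
        rw [hpo]
        exact AnalyticAt.comp (g := affinePoint o) (f := ξ) (analyticAt_affinePoint o _) hξ
      have h1 := injective_fderiv_smul πL hc0
        (injective_fderiv_of_isImmersiveLiftAt (by lia) πL (himm q) hκ han h)
      have h2 : fderiv ℂ (fun s => (θ.toLinearMap ∘ₗ π) (veronese d s)) (c • pt q) =
          (θL : V₂ →L[ℂ] (Fin (m + 2) → ℂ)).comp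
            (fderiv ℂ (fun s => πL (veronese d s)) (c • pt q)) := by
        have h3 : HasFDerivAt (fun s => πL (veronese d s)) _ (c • pt q) :=
          ((πL.analyticAt _).comp (analyticAt_veronese d _)).differentiableAt.hasFDerivAt
        exact ((θL : V₂ →L[ℂ] (Fin (m + 2) → ℂ)).hasFDerivAt.comp (c • pt q) h3).fderiv
      rw [h2]
      exact θL.injective.comp h1
    · obtain ⟨s, hs, hzs⟩ := hz
      obtain ⟨q, c, hc0, rfl⟩ := hpt s hs
      obtain ⟨κ, hκ, -, h⟩ := hGπ q
      obtain ⟨o, ξ, hξ, hξ0, hpo⟩ := hx.exists_eq_affinePoint q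
      have hpt0 : pt q = affinePoint o 0 := by
        rw [← hξ0]
        exact congrFun hpo 0
      rw [veronese_smul, Submodule.span_singleton_smul_eq (pow_ne_zero d hc0).isUnit, hpt0] at hzs
      rw [osculatingSpace_rationalNormalCurve (by lia) m o hzs, LinearMap.ker_comp,
        LinearEquiv.ker, Submodule.comap_bot]
      set S := jetSpan (m + 1) fun w => veronese d (affinePoint o w)
      have hFan := analyticAt_veronese_affinePoint d o 0
      -- The osculating space `S` has dimension at most `m + 1`, while its image contains jets of
      -- dimension at least `m + 1`; hence `π` is injective on `S`.
      have h1 : jetSpan (m + 1) (H₂ q) ≤ S.map π := by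
        have h2 := map_jetSpan πL hFan (m + 1)
        have h3 : jetSpan (m + 1) (H₂ q) ≤
            jetSpan (m + 1) fun w => πL (veronese d (affinePoint o w)) :=
          jetSpan_le_of_eventuallyEq ((πL.analyticAt _).comp hFan) hκ hξ hξ0
            (h.trans (Eventually.of_forall fun w => by simp only [hpo]; rfl)) (m + 1)
        rw [← h2] at h3
        exact h3
      have h4 := (hflex₂ q).trans (Submodule.finrank_mono h1)
      have h5 := finrank_jetSpan_le (m + 1) fun w => veronese d (affinePoint o w)
      have h6 := LinearMap.finrank_range_add_finrank_ker (π.domRestrict S)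
      rw [LinearMap.range_domRestrict] at h6
      have h7 : LinearMap.ker (π.domRestrict S) = ⊥ := by
        rw [← Submodule.finrank_eq_zero (R := ℂ)]
        change Module.finrank ℂ S ≤ m + 1 at h5
        lia
      rw [disjoint_comm, Submodule.disjoint_def]
      intro v hvS hvk
      have h8 : (⟨v, hvS⟩ : S) ∈ LinearMap.ker (π.domRestrict S) := hvk
      rw [h7] at h8
      exact congrArg Subtype.val ((Submodule.mem_bot ℂ).1 h8)

end Classification

/-! ### Reduction to directrices without inflection points -/

section Classification

variable {V : Type*} [NormedAddCommGroup V] [NormedSpace ℂ V] [FiniteDimensional ℂ V]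
variable {C : Type*} [TopologicalSpace C] [ChartedSpace ℂ C]

/-- An embedded curve, as a curve in its linear span. -/
theorem exists_curveLift_in_span [IsManifold 𝓘(ℂ) ω C]
    {φ : C → Projectivization ℂ V} (hφ : IsHolomorphicEmbedding φ) {V₁ V₂ : Submodule ℂ V}
    (hc : IsCompl V₁ V₂) (hV₁ : linearSpan (Set.range φ) = V₁) :
    ∃ H : C → ℂ → V₁, IsCurveLift H ∧ (∀ q, IsImmersiveLiftAt (H q) 0) ∧
      (∀ q, IsImmersiveLiftAt (fun w => (H q w : V)) 0) ∧
      (∀ p, ∀ᶠ w in 𝓝 (0 : ℂ), (φ (localParam p w)).submodule = Submodule.span ℂ {(H p w : V)}) ∧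
      ∀ l : V₁ →ₗ[ℂ] ℂ, (∀ q, l (H q 0) = 0) → l = 0 := by
  have : CompleteSpace V := FiniteDimensional.complete ℂ V
  obtain ⟨G, hG, himm, hl⟩ := hφ.exists_isCurveLift
  have hle : ∀ q, (φ q).submodule ≤ V₁ := fun q =>
    (le_iSup₂_of_le (φ q) ⟨q, rfl⟩ le_rfl).trans hV₁.le
  have hmem : ∀ q, ∀ᶠ w in 𝓝 (0 : ℂ), G q w ∈ V₁ := by
    intro q
    filter_upwards [hl q] with w hw
    exact hle _ (hw ▸ Submodule.mem_span_singleton_self _)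
  let ρ : V →L[ℂ] V₁ := LinearMap.toContinuousLinearMap (V₁.projectionOnto V₂ hc)
  have hρ : ∀ v (hv : v ∈ V₁), ρ v = ⟨v, hv⟩ := fun v hv =>
    Submodule.projectionOnto_apply_of_mem_left hc hv
  have hρG : ∀ q, (fun w => (ρ (G q w) : V)) =ᶠ[𝓝 0] G q := by
    intro q
    filter_upwards [hmem q] with w hw
    rw [hρ _ hw]
  have hρ0 : ∀ q, (ρ (G q 0) : V) = G q 0 := fun q => (hρG q).self_of_nhds
  have himm' : ∀ q, IsImmersiveLiftAt (fun w => (ρ (G q w) : V)) 0 := by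
    intro q
    obtain ⟨h1, h2⟩ := isImmersiveLiftAt_iff_deriv.1 (himm q)
    rw [isImmersiveLiftAt_iff_deriv]
    refine ⟨h1.congr (hρG q).symm, ?_⟩
    rw [(hρG q).deriv_eq, hρ0]
    exact h2
  refine ⟨fun q w => ρ (G q w), hG.comp ρ fun p h0 => ?_, fun q => ?_, himm', fun p => ?_,
    fun l hl0 => ?_⟩
  · have := hρ0 p
    rw [h0] at this
    exact (himm p).ne_zero this.symm
  · obtain ⟨h1, h2⟩ := isImmersiveLiftAt_iff_deriv.1 (himm' q)
    have han : AnalyticAt ℂ (fun w => ρ (G q w)) 0 := (ρ.analyticAt _).comp (hG.analytic q)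
    rw [isImmersiveLiftAt_iff_deriv]
    refine ⟨han, fun a b hab => h2 a b ?_⟩
    have h3 := iteratedDeriv_clm_comp V₁.subtypeL han 1
    simp only [iteratedDeriv_one] at h3
    have h4 : deriv (fun w => (ρ (G q w) : V)) 0 = (deriv (fun w => ρ (G q w)) 0 : V₁) := h3
    rw [h4]
    simpa using congrArg (Subtype.val) hab
  · filter_upwards [hl p, hρG p] with w h1 h2
    rw [h1, h2]
  · have h1 : V₁ ≤ LinearMap.ker (l ∘ₗ V₁.projectionOnto V₂ hc) := by
      refine hV₁.ge.trans (iSup₂_le ?_)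
      rintro _ ⟨q, rfl⟩
      have h2 := (hl q).self_of_nhds
      rw [localParam_zero] at h2
      rw [h2, Submodule.span_singleton_le_iff_mem]
      exact hl0 q
    ext v
    have h3 := h1 v.2
    rw [LinearMap.mem_ker, LinearMap.comp_apply, Submodule.projectionOnto_apply_left] at h3
    exact h3

theorem finrank_jetSpan_coe {V₁ : Submodule ℂ V} {H : ℂ → V₁} (hH : AnalyticAt ℂ H 0) (k : ℕ) :
    Module.finrank ℂ (jetSpan k fun w => (H w : V)) = Module.finrank ℂ (jetSpan k H) := by
  have : CompleteSpace V₁ := FiniteDimensional.complete ℂ V₁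
  have h1 := map_jetSpan V₁.subtypeL hH k
  change (jetSpan k H).map V₁.subtype = jetSpan k fun w => (H w : V) at h1
  rw [← h1, Submodule.finrank_map_subtype_eq]

variable [CompactSpace C] [IsManifold 𝓘(ℂ) ω C] [ConnectedSpace C]

theorem classification_of_inflectionalLocus_eq_empty {m : ℕ} (hm : 2 ≤ m)
    (hV : Module.finrank ℂ V = 2 * m + 3) {X : Set (Projectivization ℂ V)}
    (hX : IsDecomposableSurfaceScroll C X) (hinf : inflectionalLocus (ℂ × ℂ) m X = ∅) :
    IsSemibalancedRationalNormalScroll m X ∨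
      ∃ d : ℕ, m + 2 ≤ d ∧ IsProjectedRationalScroll m d X := by
  obtain ⟨φ₁, φ₂, hφ₁, hφ₂, hc, rfl⟩ := hX
  obtain ⟨V₁, hV₁⟩ : ∃ V₁, linearSpan (Set.range φ₁) = V₁ := ⟨_, rfl⟩
  obtain ⟨V₂, hV₂⟩ : ∃ V₂, linearSpan (Set.range φ₂) = V₂ := ⟨_, rfl⟩
  rw [hV₁, hV₂] at hc
  obtain ⟨H₁, hH₁, himm₁, himm₁', hl₁, hnd₁⟩ := exists_curveLift_in_span hφ₁ hc hV₁
  obtain ⟨H₂, hH₂, himm₂, himm₂', hl₂, hnd₂⟩ := exists_curveLift_in_span hφ₂ hc.symm hV₂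
  have hls := isLocalScroll_of_lifts hφ₁.injective hφ₂.injective himm₁' himm₂' hl₁ hl₂
  have hbase₁ : ∀ q, (φ₁ q).submodule = Submodule.span ℂ {(H₁ q 0 : V)} := fun q => by
    simpa using (hl₁ q).self_of_nhds
  have hbase₂ : ∀ q, (φ₂ q).submodule = Submodule.span ℂ {(H₂ q 0 : V)} := fun q => by
    simpa using (hl₂ q).self_of_nhds
  have hle₁ : ∀ q, (φ₁ q).submodule ≤ V₁ := fun q => by
    rw [hbase₁, Submodule.span_singleton_le_iff_mem]; exact (H₁ q 0).2
  have hle₂ : ∀ q, (φ₂ q).submodule ≤ V₂ := fun q => by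
    rw [hbase₂, Submodule.span_singleton_le_iff_mem]; exact (H₂ q 0).2
  let ρ₁ : V →L[ℂ] V := LinearMap.toContinuousLinearMap (V₁.projection V₂ hc)
  let ρ₂ : V →L[ℂ] V := LinearMap.toContinuousLinearMap (V₂.projection V₁ hc.symm)
  have e₁ : ∀ q, Module.finrank ℂ (osculatingSpace (ℂ × ℂ) m
      (joinOfCurves (fun p => (φ₁ p).submodule) fun p => (φ₂ p).submodule) (φ₁ q)) =
      Module.finrank ℂ (jetSpan (m + 1) (H₁ q)) + Module.finrank ℂ (jetSpan m (H₂ q)) := by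
    intro q
    rw [(hls q).finrank_osculatingSpace (p := ρ₁)
      (fun i v hv => Submodule.projection_apply_of_mem_left hc (hle₁ i hv))
      (fun i v hv => (Submodule.projection_apply_eq_zero_iff hc).2 (hle₂ i hv)) (hbase₁ q) m,
      finrank_jetSpan_coe (hH₁.analytic q), finrank_jetSpan_coe (hH₂.analytic q)]
  have e₂ : ∀ q, Module.finrank ℂ (osculatingSpace (ℂ × ℂ) m
      (joinOfCurves (fun p => (φ₁ p).submodule) fun p => (φ₂ p).submodule) (φ₂ q)) =
      Module.finrank ℂ (jetSpan (m + 1) (H₂ q)) + Module.finrank ℂ (jetSpan m (H₁ q)) := by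
    intro q
    rw [joinOfCurves_comm, (hls q).symm.finrank_osculatingSpace (p := ρ₂)
      (fun i v hv => Submodule.projection_apply_of_mem_left hc.symm (hle₂ i hv))
      (fun i v hv => (Submodule.projection_apply_eq_zero_iff hc.symm).2 (hle₁ i hv)) (hbase₂ q) m,
      finrank_jetSpan_coe (hH₁.analytic q), finrank_jetSpan_coe (hH₂.analytic q)]
  have hconst : ∀ y z, y ∈ joinOfCurves (fun p => (φ₁ p).submodule) (fun p => (φ₂ p).submodule) →
      z ∈ joinOfCurves (fun p => (φ₁ p).submodule) (fun p => (φ₂ p).submodule) →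
      Module.finrank ℂ (osculatingSpace (ℂ × ℂ) m
        (joinOfCurves (fun p => (φ₁ p).submodule) fun p => (φ₂ p).submodule) y) =
      Module.finrank ℂ (osculatingSpace (ℂ × ℂ) m
        (joinOfCurves (fun p => (φ₁ p).submodule) fun p => (φ₂ p).submodule) z) := by
    have hle : ∀ y z, y ∈ joinOfCurves (fun p => (φ₁ p).submodule) (fun p => (φ₂ p).submodule) →
        z ∈ joinOfCurves (fun p => (φ₁ p).submodule) (fun p => (φ₂ p).submodule) →
        Module.finrank ℂ (osculatingSpace (ℂ × ℂ) m
          (joinOfCurves (fun p => (φ₁ p).submodule) fun p => (φ₂ p).submodule) y) ≤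
        Module.finrank ℂ (osculatingSpace (ℂ × ℂ) m
          (joinOfCurves (fun p => (φ₁ p).submodule) fun p => (φ₂ p).submodule) z) := by
      intro y z hy hz
      by_contra hlt
      have : z ∈ inflectionalLocus (ℂ × ℂ) m
          (joinOfCurves (fun p => (φ₁ p).submodule) fun p => (φ₂ p).submodule) :=
        ⟨hz, y, hy, not_le.1 hlt⟩
      rw [hinf] at this
      exact this
    exact fun y z hy hz => le_antisymm (hle y z hy hz) (hle z y hz hy)
  have hm₁ : ∀ q, φ₁ q ∈ joinOfCurves (fun p => (φ₁ p).submodule) fun p => (φ₂ p).submodule :=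
    fun q => ⟨q, le_sup_left⟩
  have hm₂ : ∀ q, φ₂ q ∈ joinOfCurves (fun p => (φ₁ p).submodule) fun p => (φ₂ p).submodule :=
    fun q => ⟨q, le_sup_right⟩
  have hsum : Module.finrank ℂ V₁ + Module.finrank ℂ V₂ = 2 * m + 3 := by
    rw [← hV]; exact Submodule.finrank_add_eq_of_isCompl hc
  obtain ⟨p⟩ : Nonempty C := inferInstance
  obtain ⟨w, hw₁, hw₂⟩ := ((hH₁.eventually_top_le_jetSpan hnd₁ p).and
    (hH₂.eventually_top_le_jetSpan hnd₂ p)).exists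
  set r := localParam p w
  have g₁ := finrank_jetSpan_of_top_le hw₁
  have g₂ := finrank_jetSpan_of_top_le hw₂
  -- Equality of the osculating dimensions at the two points over the general parameter `r`. As the
  -- dimensions of the spans add up to `2m + 3`, this leaves only `m + 1` and `m + 2`, in either
  -- order.
  have hr : min (m + 1) (Module.finrank ℂ V₁) + min m (Module.finrank ℂ V₂) =
      min (m + 1) (Module.finrank ℂ V₂) + min m (Module.finrank ℂ V₁) := by
    rw [← g₁, ← g₂, ← g₂, ← g₁, ← e₁, ← e₂]
    exact hconst _ _ (hm₁ r) (hm₂ r)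
  have hN : ∀ y ∈ joinOfCurves (fun p => (φ₁ p).submodule) (fun p => (φ₂ p).submodule),
      Module.finrank ℂ (osculatingSpace (ℂ × ℂ) m
        (joinOfCurves (fun p => (φ₁ p).submodule) fun p => (φ₂ p).submodule) y) =
      min (m + 1) (Module.finrank ℂ V₁) + min m (Module.finrank ℂ V₂) := by
    intro y hy
    rw [hconst y (φ₁ r) hy (hm₁ r), e₁, g₁, g₂]
  -- The common osculating dimension is `2m + 1`; one directrix contributes at most `m` to it, so
  -- the other has full rank `m + 1`.
  have hq : ∀ q, m + 1 ≤ Module.finrank ℂ (jetSpan (m + 1) (H₁ q)) ∧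
      m + 1 ≤ Module.finrank ℂ (jetSpan (m + 1) (H₂ q)) := by
    intro q
    have a₁ := e₁ q
    have a₂ := e₂ q
    rw [hN _ (hm₁ q)] at a₁
    rw [hN _ (hm₂ q)] at a₂
    have b₁ := finrank_jetSpan_le m (H₁ q)
    have b₂ := finrank_jetSpan_le m (H₂ q)
    lia
  have htop : ∀ {U : Submodule ℂ V} {F : ℂ → U}, Module.finrank ℂ U = m + 1 →
      m + 1 ≤ Module.finrank ℂ (jetSpan (m + 1) F) → jetSpan (m + 1) F = ⊤ := by
    intro U F hU hF
    exact Submodule.eq_top_of_finrank_eq (le_antisymm (Submodule.finrank_le _) (hU ▸ hF))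
  have hcases : (Module.finrank ℂ V₁ = m + 1 ∧ Module.finrank ℂ V₂ = m + 2) ∨
      (Module.finrank ℂ V₂ = m + 1 ∧ Module.finrank ℂ V₁ = m + 2) := by lia
  rcases hcases with ⟨hn₁, hn₂⟩ | ⟨hn₂, hn₁⟩
  · exact classification_of_flexless hm hc hn₁ hn₂ hφ₁.injective hφ₂.injective hH₁ hH₂ hbase₁
      hbase₂ himm₂ (fun q => htop hn₁ (hq q).1) (fun q => (hq q).2) hnd₂
  · rw [joinOfCurves_comm]
    exact classification_of_flexless hm hc.symm hn₂ hn₁ hφ₂.injective hφ₁.injective hH₂ hH₁ hbase₂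
      hbase₁ himm₁ (fun q => htop hn₂ (hq q).2) (fun q => (hq q).1) hnd₁

end Classification

/-! ### Rational scrolls as complex submanifolds -/

section RationalScroll

theorem affinePoint_linearIndependent (o : Option ℂ) {a b : ℂ}
    (h : a • affinePoint o 0 + b • deriv (affinePoint o) 0 = 0) : a = 0 ∧ b = 0 := by
  cases o with
  | none =>
    have h1 : HasDerivAt (affinePoint none) (1, 0) 0 :=
      (hasDerivAt_id (0 : ℂ)).prodMk (hasDerivAt_const (0 : ℂ) (1 : ℂ))
    rw [h1.deriv] at h
    have h2 := congrArg Prod.fst h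
    have h3 := congrArg Prod.snd h
    simp [affinePoint] at h2 h3
    exact ⟨h3, h2⟩
  | some X =>
    have h1 : HasDerivAt (affinePoint (some X)) (0, 1) 0 :=
      (hasDerivAt_const (0 : ℂ) (1 : ℂ)).prodMk ((hasDerivAt_id (0 : ℂ)).const_add X)
    rw [h1.deriv] at h
    have h2 := congrArg Prod.fst h
    have h3 := congrArg Prod.snd h
    simp [affinePoint] at h2 h3
    exact ⟨h2, by simpa [h2] using h3⟩

/-- The Veronese map of degree one is the identification of `ℂ × ℂ` with its coordinate space, so
its chart functions recover the affine parameter continuously. -/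
theorem eventually_eq_smul_affinePoint (o : Option ℂ) {U : Set ℂ} (hU : U ∈ 𝓝 0) {b : ℂ}
    (hb : b ≠ 0) : ∀ᶠ s in 𝓝 (b • affinePoint o 0), ∃ z ∈ U, ∃ c : ℂ, c ≠ 0 ∧
      s = c • affinePoint o z := by
  obtain ⟨l, k, hl, hk, h⟩ := exists_eq_smul_veronese le_rfl o
  have hν : ∀ s, ContinuousAt (veronese 1) s := fun s => (analyticAt_veronese 1 s).continuousAt
  have hl0 : l (veronese 1 (b • affinePoint o 0)) = b := by
    rw [veronese_smul, map_smul, hl]; simp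
  have hk0 : k (veronese 1 (b • affinePoint o 0)) = 0 := by
    rw [veronese_smul, map_smul, hk]; simp
  have hlc : ContinuousAt (fun s => l (veronese 1 s)) (b • affinePoint o 0) :=
    l.continuous.continuousAt.comp (hν _)
  have hkc : ContinuousAt (fun s => k (veronese 1 s)) (b • affinePoint o 0) :=
    k.continuous.continuousAt.comp (hν _)
  have hne : l (veronese 1 (b • affinePoint o 0)) ≠ 0 := by rwa [hl0]
  have h1 : ∀ᶠ s in 𝓝 (b • affinePoint o 0), k (veronese 1 s) / l (veronese 1 s) ∈ U := by
    refine (hkc.div hlc hne).eventually_mem ?_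
    simpa [hk0] using hU
  filter_upwards [h1, hlc.eventually_ne hne] with s hs hs0
  obtain ⟨⟨c, hc, hcs⟩, -⟩ := h s 1 (by simpa using hs0)
  simp only [one_smul] at hcs
  exact ⟨_, hs, c, hc, hcs⟩

variable {m d : ℕ} {U : Type*} [NormedAddCommGroup U] [NormedSpace ℂ U]
  (π : (Fin (d + 1) → ℂ) →L[ℂ] U)

theorem veronese_ne_zero (m : ℕ) {s : ℂ × ℂ} (hs : s ≠ 0) : veronese m s ≠ 0 := by
  intro h0
  by_cases h1 : s.1 = 0
  · have h2 : s.2 ≠ 0 := fun h2 => hs (Prod.ext h1 h2)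
    have := congrFun h0 (Fin.last m)
    simp [veronese, h2] at this
  · have := congrFun h0 0
    simp [veronese, h1] at this

theorem isImmersiveLiftAt_comp_veronese (hd : 1 ≤ d)
    (hB : InducesEmbedding fun s => π (veronese d s)) (o : Option ℂ) :
    IsImmersiveLiftAt (fun w => π (veronese d (affinePoint o w))) 0 := by
  have hd0 : (d : ℂ) ≠ 0 := by exact_mod_cast (by lia : d ≠ 0)
  have han : AnalyticAt ℂ (fun w => π (veronese d (affinePoint o w))) 0 :=
    AnalyticAt.comp (g := π) (π.analyticAt _) (analyticAt_veronese_affinePoint d o 0)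
  rw [isImmersiveLiftAt_iff_deriv]
  refine ⟨han, fun a b hab => ?_⟩
  have h1 : HasFDerivAt (fun s => π (veronese d s))
      (fderiv ℂ (fun s => π (veronese d s)) (affinePoint o 0)) (affinePoint o 0) :=
    ((π.analyticAt _).comp (analyticAt_veronese d _)).differentiableAt.hasFDerivAt
  have h2 := (h1.comp_hasDerivAt (0 : ℂ)
    (analyticAt_affinePoint o 0).differentiableAt.hasDerivAt).deriv
  have h3 : deriv (fun w => π (veronese d (affinePoint o w))) 0 =
      fderiv ℂ (fun s => π (veronese d s)) (affinePoint o 0) (deriv (affinePoint o) 0) := h2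
  have h4 : π (veronese d (affinePoint o 0)) =
      fderiv ℂ (fun s => π (veronese d s)) (affinePoint o 0) ((d : ℂ)⁻¹ • affinePoint o 0) := by
    rw [map_smul, isHomogeneous_fderiv_veronese, inv_smul_smul₀ hd0]
  rw [h3, h4, ← map_smul, ← map_smul, ← map_add] at hab
  have h5 := hB.immersive _ (affinePoint_ne_zero o 0) (hab.trans (map_zero _).symm)
  rw [smul_smul] at h5
  obtain ⟨h6, h7⟩ := affinePoint_linearIndependent o h5
  exact ⟨(mul_eq_zero.1 h6).resolve_right (inv_ne_zero hd0), h7⟩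

theorem IsImmersiveLiftAt.comp_injective {V W : Type*} [NormedAddCommGroup V] [NormedSpace ℂ V]
    [NormedAddCommGroup W] [NormedSpace ℂ W] [CompleteSpace V] {F : ℂ → V} {z : ℂ}
    (hF : IsImmersiveLiftAt F z)
    (L : V →L[ℂ] W) (hL : Function.Injective L) : IsImmersiveLiftAt (fun w => L (F w)) z := by
  obtain ⟨h1, h2⟩ := isImmersiveLiftAt_iff_deriv.1 hF
  rw [isImmersiveLiftAt_iff_deriv]
  refine ⟨(L.analyticAt _).comp h1, fun a b hab => h2 a b (hL ?_)⟩
  have h3 := iteratedDeriv_clm_comp L h1 1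
  simp only [iteratedDeriv_one] at h3
  rw [h3] at hab
  rw [map_add, map_smul, map_smul, hab, map_zero]

theorem inducesEmbedding_veronese [CompleteSpace U] (hd : 1 ≤ d) (hπ : Function.Injective π) :
    InducesEmbedding fun s => π (veronese d s) := by
  refine ⟨fun s hs h0 => veronese_ne_zero d hs (hπ (h0.trans (map_zero _).symm)),
    fun s t hs ht hst => ?_, fun s hs => ?_⟩
  · obtain ⟨o, a, ha, rfl⟩ := exists_eq_smul_affinePoint hs
    obtain ⟨l, k, hl, hk, h⟩ := exists_eq_smul_veronese hd o
    obtain ⟨c, hc⟩ := Submodule.mem_span_singleton.1 (hst ▸ Submodule.mem_span_singleton_self _ :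
      π (veronese d (a • affinePoint o 0)) ∈ Submodule.span ℂ {π (veronese d t)})
    rw [← map_smul] at hc
    have hc' := hπ hc
    obtain ⟨⟨b, hb, hbt⟩, -⟩ := h t c (by
      rw [hc', veronese_smul, map_smul, hl]
      simpa using pow_ne_zero d ha)
    rw [hc', veronese_smul, map_smul, map_smul, hk, smul_zero, zero_div] at hbt
    rw [hbt, Submodule.span_singleton_smul_eq ha.isUnit, Submodule.span_singleton_smul_eq hb.isUnit]
  · obtain ⟨o, a, ha, rfl⟩ := exists_eq_smul_affinePoint hs
    refine injective_fderiv_smul π ha (injective_fderiv_of_isImmersiveLiftAt hd π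
      ((isImmersiveLiftAt_veronese hd o).comp_injective π hπ) (κ := fun _ => 1) analyticAt_const
      (analyticAt_affinePoint o 0) (Eventually.of_forall fun w => by simp))

end RationalScroll

/-! ### Scrolls generated by a rational normal curve and a projected one -/

section ScrollData

/-- The data of a scroll in the projective space of `V` generated by a rational normal curve of
degree `m` and a linear projection of a rational normal curve of degree `d`, in complementary
subspaces. -/
structure ScrollData (m d : ℕ) (V : Type*) [NormedAddCommGroup V] [NormedSpace ℂ V] where
  /-- The first directrix is the image of the rational normal curve under `fst`. -/
  fst : (Fin (m + 1) → ℂ) →L[ℂ] V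
  /-- The second directrix is the image of the rational normal curve under `snd`. -/
  snd : (Fin (d + 1) → ℂ) →L[ℂ] V
  /-- The projection to the span of the first directrix. -/
  proj : V →L[ℂ] V
  injective_fst : Function.Injective fst
  inducesEmbedding : InducesEmbedding fun s => snd (veronese d s)
  proj_fst : ∀ a, proj (fst a) = fst a
  proj_snd : ∀ b, proj (snd b) = 0
  sup_range : LinearMap.range (fst : (Fin (m + 1) → ℂ) →ₗ[ℂ] V) ⊔
    LinearMap.range (snd : (Fin (d + 1) → ℂ) →ₗ[ℂ] V) = ⊤

namespace ScrollData

variable {m d : ℕ} {V : Type*} [NormedAddCommGroup V] [NormedSpace ℂ V] (D : ScrollData m d V)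

/-- The first directrix. -/
def line₁ (s : {s : ℂ × ℂ // s ≠ 0}) : Submodule ℂ V := Submodule.span ℂ {D.fst (veronese m s)}

/-- The second directrix. -/
def line₂ (s : {s : ℂ × ℂ // s ≠ 0}) : Submodule ℂ V := Submodule.span ℂ {D.snd (veronese d s)}

/-- The scroll. -/
def scroll : Set (Projectivization ℂ V) := joinOfCurves D.line₁ D.line₂

/-- A local lift of the first directrix. -/
def lift₁ (o : Option ℂ) (w : ℂ) : V := D.fst (veronese m (affinePoint o w))

/-- A local lift of the second directrix. -/
def lift₂ (o : Option ℂ) (w : ℂ) : V := D.snd (veronese d (affinePoint o w))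

/-- The projection to the span of the second directrix. -/
def proj' : V →L[ℂ] V := ContinuousLinearMap.id ℂ V - D.proj

theorem fst_ne_zero {s : ℂ × ℂ} (hs : s ≠ 0) : D.fst (veronese m s) ≠ 0 := fun h0 =>
  veronese_ne_zero m hs (D.injective_fst (h0.trans (map_zero _).symm))

theorem snd_ne_zero {s : ℂ × ℂ} (hs : s ≠ 0) : D.snd (veronese d s) ≠ 0 :=
  D.inducesEmbedding.defined s hs

theorem proj_of_mem_line₁ {s : {s : ℂ × ℂ // s ≠ 0}} {v : V} (hv : v ∈ D.line₁ s) :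
    D.proj v = v ∧ D.proj' v = 0 := by
  obtain ⟨c, rfl⟩ := Submodule.mem_span_singleton.1 hv
  simp [proj', D.proj_fst]

theorem proj_of_mem_line₂ {s : {s : ℂ × ℂ // s ≠ 0}} {v : V} (hv : v ∈ D.line₂ s) :
    D.proj' v = v ∧ D.proj v = 0 := by
  obtain ⟨c, rfl⟩ := Submodule.mem_span_singleton.1 hv
  simp [proj', D.proj_snd]

theorem line_smul {s t : {s : ℂ × ℂ // s ≠ 0}} {c : ℂ} (hc : c ≠ 0)
    (h : (t : ℂ × ℂ) = c • (s : ℂ × ℂ)) : D.line₁ t = D.line₁ s ∧ D.line₂ t = D.line₂ s := by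
  constructor
  · rw [line₁, h, veronese_smul, map_smul,
      Submodule.span_singleton_smul_eq (pow_ne_zero _ hc).isUnit, line₁]
  · rw [line₂, h, veronese_smul, map_smul,
      Submodule.span_singleton_smul_eq (pow_ne_zero _ hc).isUnit, line₂]

theorem continuous_veronese (k : ℕ) : Continuous (veronese k) :=
  continuous_iff_continuousAt.2 fun s => (analyticAt_veronese k s).continuousAt

/-- Rescale a parameter to the unit sphere. -/
theorem exists_sphere (s : {s : ℂ × ℂ // s ≠ 0}) :
    ∃ i : Metric.sphere (0 : ℂ × ℂ) 1, ∃ c : ℂ, c ≠ 0 ∧ (s : ℂ × ℂ) = c • (i : ℂ × ℂ) := by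
  obtain ⟨s, hs⟩ := s
  have hs0 : (‖s‖ : ℂ) ≠ 0 := by exact_mod_cast norm_ne_zero_iff.2 hs
  refine ⟨⟨(‖s‖ : ℂ)⁻¹ • s, ?_⟩, ‖s‖, hs0, by rw [smul_inv_smul₀ hs0]⟩
  simp only [mem_sphere_zero_iff_norm, norm_smul, norm_inv, Complex.norm_real, norm_norm]
  exact inv_mul_cancel₀ (norm_ne_zero_iff.2 hs)

theorem isLocalScroll [CompleteSpace V] (hm : 1 ≤ m) (hd : 1 ≤ d) (o : Option ℂ) :
    IsLocalScroll D.line₁ D.line₂ (D.lift₁ o) (D.lift₂ o) := by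
  have hcompact : CompactSpace (Metric.sphere (0 : ℂ × ℂ) 1) :=
    isCompact_iff_compactSpace.1 (isCompact_sphere _ _)
  let pt : Metric.sphere (0 : ℂ × ℂ) 1 → {s : ℂ × ℂ // s ≠ 0} :=
    fun i => ⟨i, ne_zero_of_mem_unit_sphere i⟩
  -- The compactness argument is run on the unit sphere, which covers `ℙ¹`; rescaling a parameter
  -- does not change the corresponding line.
  have key : ∀ {n : ℕ} (β : (Fin (n + 1) → ℂ) →L[ℂ] V),
      InducesEmbedding (fun s => β (veronese n s)) → ∀ N ∈ 𝓝 (0 : ℂ),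
      ∀ᶠ v in 𝓝 (β (veronese n (affinePoint o 0))), ∀ s : {s : ℂ × ℂ // s ≠ 0},
        v ∈ Submodule.span ℂ {β (veronese n s)} →
        ∃ z ∈ N, ∃ c : ℂ, c ≠ 0 ∧ (s : ℂ × ℂ) = c • affinePoint o z := by
    intro n β hβ N hN
    have hcont : Continuous fun i : Metric.sphere (0 : ℂ × ℂ) 1 => β (veronese n i) :=
      β.continuous.comp ((continuous_veronese n).comp continuous_subtype_val)
    have key := eventually_forall_mem_imp (K := Metric.sphere (0 : ℂ × ℂ) 1)
      (v₀ := β (veronese n (affinePoint o 0)))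
      (P := fun i => Submodule.span ℂ {β (veronese n i)})
      (N := {i | ∃ z ∈ N, ∃ c : ℂ, c ≠ 0 ∧ (i : ℂ × ℂ) = c • affinePoint o z})
      (fun i hi => eventually_notMem_span
        (g := fun i : Metric.sphere (0 : ℂ × ℂ) 1 => β (veronese n i)) hcont.continuousAt
        (hβ.defined i (pt i).2) hi) (fun i hi => by
        obtain ⟨c, h1⟩ := Submodule.mem_span_singleton.1 hi
        have hc0 : c ≠ 0 := by
          rintro rfl
          rw [zero_smul] at h1
          exact hβ.defined _ (affinePoint_ne_zero o 0) h1.symm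
        have h2 := hβ.injective i _ (pt i).2 (affinePoint_ne_zero o 0) (by
          rw [← h1, Submodule.span_singleton_smul_eq hc0.isUnit])
        obtain ⟨b, hb⟩ := Submodule.mem_span_singleton.1
          (h2 ▸ Submodule.mem_span_singleton_self _ :
            (i : ℂ × ℂ) ∈ Submodule.span ℂ {affinePoint o 0})
        have hb0 : b ≠ 0 := by
          rintro rfl
          rw [zero_smul] at hb
          exact (pt i).2 hb.symm
        have h3 := eventually_eq_smul_affinePoint o hN hb0
        rw [hb] at h3
        exact continuous_subtype_val.continuousAt.eventually h3)
    filter_upwards [key] with v hv s hvs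
    obtain ⟨i, c, hc, hci⟩ := exists_sphere s
    obtain ⟨z, hz, b, hb, hbz⟩ := hv i (by
      rwa [hci, veronese_smul, map_smul,
        Submodule.span_singleton_smul_eq (pow_ne_zero _ hc).isUnit] at hvs)
    exact ⟨z, hz, c * b, mul_ne_zero hc hb, by rw [mul_smul, ← hbz, hci]⟩
  have hfst := inducesEmbedding_veronese D.fst hm D.injective_fst
  refine ⟨isImmersiveLiftAt_comp_veronese D.fst hm hfst o,
    isImmersiveLiftAt_comp_veronese D.snd hd D.inducesEmbedding o,
    Eventually.of_forall fun z => ⟨⟨affinePoint o z, affinePoint_ne_zero o z⟩, rfl, rfl⟩,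
    fun N hN => ?_, fun N hN => ?_⟩
  · filter_upwards [key D.fst hfst N hN] with v hv s hvs
    obtain ⟨z, hz, c, hc, hcz⟩ := hv s hvs
    exact ⟨z, hz, D.line_smul (s := ⟨affinePoint o z, affinePoint_ne_zero o z⟩) hc hcz⟩
  · filter_upwards [key D.snd D.inducesEmbedding N hN] with v hv s hvs
    obtain ⟨z, hz, c, hc, hcz⟩ := hv s hvs
    exact ⟨z, hz, D.line_smul (s := ⟨affinePoint o z, affinePoint_ne_zero o z⟩) hc hcz⟩

end ScrollData

end ScrollData

theorem finrank_jetSpan_comp_of_disjoint {V W : Type*} [NormedAddCommGroup V] [NormedSpace ℂ V]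
    [NormedAddCommGroup W] [NormedSpace ℂ W] [FiniteDimensional ℂ V] (L : V →L[ℂ] W) {F : ℂ → V}
    (hF : AnalyticAt ℂ F 0) {k : ℕ} (h : Disjoint (LinearMap.ker (L : V →ₗ[ℂ] W)) (jetSpan k F)) :
    Module.finrank ℂ (jetSpan k fun w => L (F w)) = Module.finrank ℂ (jetSpan k F) := by
  have : CompleteSpace V := FiniteDimensional.complete ℂ V
  rw [← map_jetSpan L hF k]
  have h1 := LinearMap.finrank_range_add_finrank_ker ((L : V →ₗ[ℂ] W).domRestrict (jetSpan k F))
  rw [LinearMap.range_domRestrict] at h1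
  have h2 : LinearMap.ker ((L : V →ₗ[ℂ] W).domRestrict (jetSpan k F)) = ⊥ := by
    rw [eq_bot_iff]
    rintro ⟨v, hv⟩ hvk
    exact (Submodule.mem_bot ℂ).2
      (Subtype.ext (Submodule.disjoint_def.1 h v (by simpa using hvk) hv))
  rw [h2, finrank_bot, add_zero] at h1
  exact h1

/-! ### Osculating spaces and global geometry of rational scrolls -/

namespace ScrollData

variable {m d : ℕ} {V : Type*} [NormedAddCommGroup V] [NormedSpace ℂ V] (D : ScrollData m d V)

theorem finrank_jetSpan_lift₁ (k : ℕ) (o : Option ℂ) :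
    Module.finrank ℂ (jetSpan k (D.lift₁ o)) = min k (m + 1) := by
  have h1 := finrank_jetSpan_comp_of_disjoint (k := k) D.fst
    (analyticAt_veronese_affinePoint m o 0) (by
      refine Disjoint.mono_left (b := ⊥) (fun v hv => ?_) disjoint_bot_left
      exact (Submodule.mem_bot ℂ).2 (D.injective_fst (hv.trans (map_zero _).symm)))
  have h2 := finrank_jetSpan_of_top_le (F := fun w => veronese m (affinePoint o w)) (by
    rw [Module.finrank_fin_fun]
    exact (jetSpan_veronese m o).ge) k
  rw [Module.finrank_fin_fun] at h2
  exact h1.trans h2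

theorem finrank_jetSpan_lift₂ {k : ℕ} (hk : k ≤ d + 1) {o : Option ℂ}
    (h : Disjoint (LinearMap.ker (D.snd : (Fin (d + 1) → ℂ) →ₗ[ℂ] V))
      (jetSpan k fun w => veronese d (affinePoint o w))) :
    Module.finrank ℂ (jetSpan k (D.lift₂ o)) = k :=
  (finrank_jetSpan_comp_of_disjoint (k := k) D.snd (analyticAt_veronese_affinePoint d o 0) h).trans
    (finrank_jetSpan_veronese hk o)

theorem mem_affineCone {v : V} : v ∈ affineCone D.scroll ↔ v ≠ 0 ∧
    ∃ s : ℂ × ℂ, s ≠ 0 ∧ ∃ a b : ℂ, v = a • D.fst (veronese m s) + b • D.snd (veronese d s) := by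
  rw [scroll, mem_affineCone_joinOfCurves]
  refine and_congr_right fun _ => ⟨?_, ?_⟩
  · rintro ⟨⟨s, hs⟩, hv⟩
    obtain ⟨_, h₁, _, h₂, rfl⟩ := Submodule.mem_sup.1 hv
    obtain ⟨a, rfl⟩ := Submodule.mem_span_singleton.1 h₁
    obtain ⟨b, rfl⟩ := Submodule.mem_span_singleton.1 h₂
    exact ⟨s, hs, a, b, rfl⟩
  · rintro ⟨s, hs, a, b, rfl⟩
    exact ⟨⟨s, hs⟩, Submodule.add_mem_sup
      (Submodule.smul_mem _ a (Submodule.mem_span_singleton_self _))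
      (Submodule.smul_mem _ b (Submodule.mem_span_singleton_self _))⟩

theorem rep_mem_affineCone {x : Projectivization ℂ V} (hx : x ∈ D.scroll) :
    x.rep ∈ affineCone D.scroll := ⟨x.rep_nonzero, by rwa [x.mk_rep]⟩

/-- A point of the scroll lies on the first directrix, or is the sum of a point of the second
directrix and a multiple of the corresponding point of the first. -/
theorem exists_eq_span {x : Projectivization ℂ V} (hx : x ∈ D.scroll) :
    ∃ o, x.submodule = Submodule.span ℂ {D.lift₁ o 0} ∨
      ∃ t : ℂ, x.submodule = Submodule.span ℂ {D.lift₂ o 0 + t • D.lift₁ o 0} := by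
  obtain ⟨-, s, hs, a, b, h⟩ := D.mem_affineCone.1 (D.rep_mem_affineCone hx)
  obtain ⟨o, c, hc, rfl⟩ := exists_eq_smul_affinePoint hs
  have h' : x.rep = (a * c ^ m) • D.lift₁ o 0 + (b * c ^ d) • D.lift₂ o 0 := by
    rw [h]
    simp only [veronese_smul, map_smul, lift₁, lift₂, mul_smul]
  refine ⟨o, ?_⟩
  by_cases hb : b = 0
  · left
    rw [hb, zero_mul, zero_smul, add_zero] at h'
    have ha : a * c ^ m ≠ 0 := fun h0 => x.rep_nonzero (by rw [h', h0, zero_smul])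
    rw [x.submodule_eq, h', Submodule.span_singleton_smul_eq ha.isUnit]
  · right
    have hb' : b * c ^ d ≠ 0 := mul_ne_zero hb (pow_ne_zero _ hc)
    refine ⟨(b * c ^ d)⁻¹ * (a * c ^ m), ?_⟩
    have h3 : x.rep = (b * c ^ d) • (D.lift₂ o 0 +
        ((b * c ^ d)⁻¹ * (a * c ^ m)) • D.lift₁ o 0) := by
      rw [h', smul_add, smul_smul, mul_inv_cancel_left₀ hb', add_comm]
    rw [x.submodule_eq, h3, Submodule.span_singleton_smul_eq hb'.isUnit]

section Osculating

variable [FiniteDimensional ℂ V] (hm : 1 ≤ m) (hd : 1 ≤ d)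
include hm hd

theorem isLocalParametrization_first {x : Projectivization ℂ V} {o : Option ℂ}
    (hx : x.submodule = Submodule.span ℂ {D.lift₁ o 0}) :
    IsLocalParametrization D.scroll x (ruledLift (D.lift₁ o) (D.lift₂ o) 0) := by
  have : CompleteSpace V := FiniteDimensional.complete ℂ V
  exact (D.isLocalScroll hm hd o).isLocalParametrization (p := D.proj)
    (fun i v hv => (D.proj_of_mem_line₁ hv).1) (fun i v hv => (D.proj_of_mem_line₂ hv).2)
    (by simpa using hx)

theorem isLocalParametrization_second {x : Projectivization ℂ V} {o : Option ℂ} {t : ℂ}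
    (hx : x.submodule = Submodule.span ℂ {D.lift₂ o 0 + t • D.lift₁ o 0}) :
    IsLocalParametrization D.scroll x (ruledLift (D.lift₂ o) (D.lift₁ o) t) := by
  have : CompleteSpace V := FiniteDimensional.complete ℂ V
  rw [scroll, joinOfCurves_comm]
  exact (D.isLocalScroll hm hd o).symm.isLocalParametrization (p := D.proj')
    (fun i v hv => (D.proj_of_mem_line₂ hv).1) (fun i v hv => (D.proj_of_mem_line₁ hv).2) hx

theorem exists_isLocalParametrization {x : Projectivization ℂ V} (hx : x ∈ D.scroll) :
    ∃ F : ℂ × ℂ → V, IsLocalParametrization D.scroll x F := by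
  obtain ⟨o, h | ⟨t, h⟩⟩ := D.exists_eq_span hx
  · exact ⟨_, D.isLocalParametrization_first hm hd h⟩
  · exact ⟨_, D.isLocalParametrization_second hm hd h⟩

theorem finrank_osculatingSpace_le {x : Projectivization ℂ V} (hx : x ∈ D.scroll) (k : ℕ) :
    Module.finrank ℂ (osculatingSpace (ℂ × ℂ) k D.scroll x) ≤ 2 * k + 1 := by
  have : CompleteSpace V := FiniteDimensional.complete ℂ V
  obtain ⟨o, h | ⟨t, h⟩⟩ := D.exists_eq_span hx
  · have hS := D.isLocalScroll hm hd o
    rw [osculatingSpace_eq (D.isLocalParametrization_first hm hd h)]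
    exact finrank_derivativeSpan_ruledLift_le hS.immersive₁.1 hS.immersive₂.1 0 k
  · have hS := D.isLocalScroll hm hd o
    rw [osculatingSpace_eq (D.isLocalParametrization_second hm hd h)]
    exact finrank_derivativeSpan_ruledLift_le hS.immersive₂.1 hS.immersive₁.1 t k

theorem finrank_osculatingSpace_first {x : Projectivization ℂ V} {o : Option ℂ}
    (hx : x.submodule = Submodule.span ℂ {D.lift₁ o 0}) (k : ℕ) :
    Module.finrank ℂ (osculatingSpace (ℂ × ℂ) k D.scroll x) =
      min (k + 1) (m + 1) + Module.finrank ℂ (jetSpan k (D.lift₂ o)) := by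
  have : CompleteSpace V := FiniteDimensional.complete ℂ V
  rw [← D.finrank_jetSpan_lift₁ (k + 1) o]
  exact (D.isLocalScroll hm hd o).finrank_osculatingSpace (p := D.proj)
    (fun i v hv => (D.proj_of_mem_line₁ hv).1) (fun i v hv => (D.proj_of_mem_line₂ hv).2) hx k

theorem le_finrank_osculatingSpace_second {x : Projectivization ℂ V} {o : Option ℂ} {t : ℂ}
    (hx : x.submodule = Submodule.span ℂ {D.lift₂ o 0 + t • D.lift₁ o 0}) (k : ℕ) :
    Module.finrank ℂ (jetSpan (k + 1) (D.lift₂ o)) + min k (m + 1) ≤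
      Module.finrank ℂ (osculatingSpace (ℂ × ℂ) k D.scroll x) := by
  have : CompleteSpace V := FiniteDimensional.complete ℂ V
  rw [osculatingSpace_eq (D.isLocalParametrization_second hm hd hx),
    ← D.finrank_jetSpan_lift₁ k o]
  exact (D.isLocalScroll hm hd o).symm.le_finrank_derivativeSpan (p := D.proj')
    (fun i v hv => (D.proj_of_mem_line₂ hv).1) (fun i v hv => (D.proj_of_mem_line₁ hv).2) t k

/-- The osculating spaces of order `m` of a scroll whose directrices have no inflection points of
order less than `m`. -/
theorem finrank_osculatingSpace_eq (hmd : m ≤ d)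
    (hdisj : ∀ o, Disjoint (LinearMap.ker (D.snd : (Fin (d + 1) → ℂ) →ₗ[ℂ] V))
      (jetSpan (m + 1) fun w => veronese d (affinePoint o w)))
    {x : Projectivization ℂ V} (hx : x ∈ D.scroll) :
    Module.finrank ℂ (osculatingSpace (ℂ × ℂ) m D.scroll x) = 2 * m + 1 := by
  obtain ⟨o, h | ⟨t, h⟩⟩ := D.exists_eq_span hx
  · rw [D.finrank_osculatingSpace_first hm hd h, D.finrank_jetSpan_lift₂ (by lia)
      ((hdisj o).mono_right (jetSpan_mono (by lia) _))]
    lia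
  · refine le_antisymm (D.finrank_osculatingSpace_le hm hd hx m) ?_
    have := D.le_finrank_osculatingSpace_second hm hd h m
    rw [D.finrank_jetSpan_lift₂ (by lia) (hdisj o)] at this
    lia

end Osculating

theorem proj_add (a : Fin (m + 1) → ℂ) (b : Fin (d + 1) → ℂ) :
    D.proj (D.fst a + D.snd b) = D.fst a ∧ D.proj' (D.fst a + D.snd b) = D.snd b := by
  simp [proj', D.proj_fst, D.proj_snd]

/-- Membership in the cone says that, for some point of the compact unit sphere, both components of
`v` lie on the corresponding lines. Failure at one point of the sphere is an open condition, and
compactness makes the neighbourhood uniform. -/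
theorem isClosed_scroll : IsClosed (insert 0 (affineCone D.scroll)) := by
  have hcompact : CompactSpace (Metric.sphere (0 : ℂ × ℂ) 1) :=
    isCompact_iff_compactSpace.1 (isCompact_sphere _ _)
  have hadd : ∀ v, D.proj v + D.proj' v = v := fun v => by simp [proj']
  have hmem : ∀ v, v ∈ insert 0 (affineCone D.scroll) ↔ ∃ i : Metric.sphere (0 : ℂ × ℂ) 1,
      D.proj v ∈ Submodule.span ℂ {D.fst (veronese m i)} ∧
      D.proj' v ∈ Submodule.span ℂ {D.snd (veronese d i)} := by
    intro v
    constructor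
    · rintro (rfl | hv)
      · exact ⟨⟨(1, 0), by simp [Prod.norm_def]⟩, by simp, by simp⟩
      · obtain ⟨-, s, hs, a, b, rfl⟩ := D.mem_affineCone.1 hv
        obtain ⟨i, c, hc, hci⟩ := exists_sphere ⟨s, hs⟩
        obtain rfl : s = c • (i : ℂ × ℂ) := hci
        rw [← map_smul, ← map_smul, (D.proj_add _ _).1, (D.proj_add _ _).2]
        simp only [veronese_smul, map_smul]
        exact ⟨i, Submodule.smul_mem _ _ (Submodule.smul_mem _ _
          (Submodule.mem_span_singleton_self _)), Submodule.smul_mem _ _ (Submodule.smul_mem _ _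
          (Submodule.mem_span_singleton_self _))⟩
    · rintro ⟨i, h₁, h₂⟩
      by_cases hv : v = 0
      · exact Or.inl hv
      · obtain ⟨a, ha⟩ := Submodule.mem_span_singleton.1 h₁
        obtain ⟨b, hb⟩ := Submodule.mem_span_singleton.1 h₂
        exact Or.inr (D.mem_affineCone.2 ⟨hv, i, ne_zero_of_mem_unit_sphere i, a, b, by
          rw [ha, hb, hadd]⟩)
  rw [← isOpen_compl_iff, isOpen_iff_mem_nhds]
  intro v₀ hv₀
  have hv₀' : ∀ i : Metric.sphere (0 : ℂ × ℂ) 1, ¬ (D.proj v₀ ∈ Submodule.span ℂ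
      {D.fst (veronese m i)} ∧ D.proj' v₀ ∈ Submodule.span ℂ {D.snd (veronese d i)}) :=
    fun i hi => hv₀ ((hmem v₀).2 ⟨i, hi⟩)
  have hc₁ : Continuous fun i : Metric.sphere (0 : ℂ × ℂ) 1 => D.fst (veronese m (i : ℂ × ℂ)) :=
    D.fst.continuous.comp ((continuous_veronese m).comp continuous_subtype_val)
  have hc₂ : Continuous fun i : Metric.sphere (0 : ℂ × ℂ) 1 => D.snd (veronese d (i : ℂ × ℂ)) :=
    D.snd.continuous.comp ((continuous_veronese d).comp continuous_subtype_val)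
  have key := (isCompact_univ
    (X := Metric.sphere (0 : ℂ × ℂ) 1)).eventually_forall_of_forall_eventually
    (x₀ := v₀) (P := fun v i => ¬ (D.proj v ∈ Submodule.span ℂ {D.fst (veronese m (i : ℂ × ℂ))} ∧
      D.proj' v ∈ Submodule.span ℂ {D.snd (veronese d (i : ℂ × ℂ))})) fun i _ => by
      rw [nhds_prod_eq]
      have t₁ : Tendsto (fun z : V × Metric.sphere (0 : ℂ × ℂ) 1 => (D.proj z.1, z.2))
          (𝓝 v₀ ×ˢ 𝓝 i) (𝓝 (D.proj v₀) ×ˢ 𝓝 i) :=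
        (D.proj.continuous.tendsto v₀).prodMap tendsto_id
      have t₂ : Tendsto (fun z : V × Metric.sphere (0 : ℂ × ℂ) 1 => (D.proj' z.1, z.2))
          (𝓝 v₀ ×ˢ 𝓝 i) (𝓝 (D.proj' v₀) ×ˢ 𝓝 i) :=
        (D.proj'.continuous.tendsto v₀).prodMap tendsto_id
      by_cases h : D.proj v₀ ∈ Submodule.span ℂ {D.fst (veronese m (i : ℂ × ℂ))}
      · have h2 := eventually_notMem_span (g := fun i : Metric.sphere (0 : ℂ × ℂ) 1 =>
          D.snd (veronese d (i : ℂ × ℂ))) hc₂.continuousAt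
          (D.snd_ne_zero (ne_zero_of_mem_unit_sphere i)) fun h' => hv₀' i ⟨h, h'⟩
        filter_upwards [t₂.eventually h2] with z hz hz'
        exact hz hz'.2
      · have h2 := eventually_notMem_span (g := fun i : Metric.sphere (0 : ℂ × ℂ) 1 =>
          D.fst (veronese m (i : ℂ × ℂ))) hc₁.continuousAt
          (D.fst_ne_zero (ne_zero_of_mem_unit_sphere i)) h
        filter_upwards [t₁.eventually h2] with z hz hz'
        exact hz hz'.1
  filter_upwards [key] with v hv hmem'
  obtain ⟨i, hi⟩ := (hmem v).1 hmem'
  exact hv i (Set.mem_univ i) hi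

/-- The punctured cone is a continuous image of the product of two copies of `ℂ² ∖ 0`; the
independence of the two components ensures that no vector of this image is zero. -/
theorem isConnected_scroll : IsConnected (affineCone D.scroll) := by
  have hconn : IsConnected ({0}ᶜ : Set (ℂ × ℂ)) := by
    refine isConnected_compl_singleton_of_one_lt_rank ?_ 0
    rw [← Module.finrank_eq_rank (R := ℝ) (M := ℂ × ℂ), Module.finrank_prod,
      Complex.finrank_real_complex]
    norm_num
  have himage : affineCone D.scroll = (fun z : (ℂ × ℂ) × (ℂ × ℂ) =>
      z.2.1 • D.fst (veronese m z.1) + z.2.2 • D.snd (veronese d z.1)) '' ({0}ᶜ ×ˢ {0}ᶜ) := by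
    ext v
    rw [D.mem_affineCone]
    constructor
    · rintro ⟨hv0, s, hs, a, b, rfl⟩
      refine ⟨(s, (a, b)), ⟨hs, fun h0 => hv0 ?_⟩, rfl⟩
      have h0' : (a, b) = (0 : ℂ × ℂ) := h0
      have ha : a = 0 := congrArg Prod.fst h0'
      have hb : b = 0 := congrArg Prod.snd h0'
      simp [ha, hb]
    · rintro ⟨⟨s, a, b⟩, ⟨hs, hab⟩, rfl⟩
      refine ⟨fun h0 => hab ?_, s, hs, a, b, rfl⟩
      have h3 := D.proj_add (a • veronese m s) (b • veronese d s)
      simp only [map_smul] at h3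
      have h0' : a • D.fst (veronese m s) + b • D.snd (veronese d s) = 0 := h0
      rw [h0', map_zero, map_zero] at h3
      exact Prod.ext ((smul_eq_zero.1 h3.1.symm).resolve_right (D.fst_ne_zero hs))
        ((smul_eq_zero.1 h3.2.symm).resolve_right (D.snd_ne_zero hs))
  rw [himage]
  have h1 := continuous_veronese m
  have h2 := continuous_veronese d
  refine (hconn.prod hconn).image _ (Continuous.continuousOn ?_)
  fun_prop

/-- A linear form vanishing on both directrices vanishes on both spaces of coefficients, since a
rational normal curve spans. -/
theorem linearSpan_scroll : linearSpan D.scroll = ⊤ := by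
  have hmem : ∀ {v}, v ∈ affineCone D.scroll → v ∈ linearSpan D.scroll := by
    rintro v ⟨hv, hvm⟩
    refine (le_iSup₂_of_le (f := fun x (_ : x ∈ D.scroll) => x.submodule) _ hvm le_rfl) ?_
    rw [Projectivization.submodule_mk]
    exact Submodule.mem_span_singleton_self _
  have h₁ : ∀ s : ℂ × ℂ, s ≠ 0 → D.fst (veronese m s) ∈ linearSpan D.scroll := fun s hs =>
    hmem (D.mem_affineCone.2 ⟨D.fst_ne_zero hs, s, hs, 1, 0, by simp⟩)
  have h₂ : ∀ s : ℂ × ℂ, s ≠ 0 → D.snd (veronese d s) ∈ linearSpan D.scroll := fun s hs =>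
    hmem (D.mem_affineCone.2 ⟨D.snd_ne_zero hs, s, hs, 0, 1, by simp⟩)
  by_contra hne
  obtain ⟨v, -, hv⟩ := SetLike.exists_of_lt (lt_top_iff_ne_top.2 hne)
  obtain ⟨l, hl, hlS⟩ := Submodule.exists_le_ker_of_notMem hv
  have e₁ : l ∘ₗ (D.fst : (Fin (m + 1) → ℂ) →ₗ[ℂ] V) = 0 :=
    eq_zero_of_apply_veronese_affinePoint none fun w => hlS (h₁ _ (affinePoint_ne_zero none w))
  have e₂ : l ∘ₗ (D.snd : (Fin (d + 1) → ℂ) →ₗ[ℂ] V) = 0 :=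
    eq_zero_of_apply_veronese_affinePoint none fun w => hlS (h₂ _ (affinePoint_ne_zero none w))
  have h3 : (⊤ : Submodule ℂ V) ≤ LinearMap.ker l := by
    rw [← D.sup_range, sup_le_iff]
    exact ⟨LinearMap.range_le_ker_iff.2 e₁, LinearMap.range_le_ker_iff.2 e₂⟩
  exact hl (h3 Submodule.mem_top)

theorem isSmoothProjectiveSurface [FiniteDimensional ℂ V] (hm : 1 ≤ m) (hd : 1 ≤ d) :
    IsSmoothProjectiveSurface D.scroll :=
  ⟨D.isClosed_scroll, D.isConnected_scroll, fun _ hx => D.exists_isLocalParametrization hm hd hx⟩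

end ScrollData

theorem InducesEmbedding.comp_injective {V W : Type*} [NormedAddCommGroup V] [NormedSpace ℂ V]
    [NormedAddCommGroup W] [NormedSpace ℂ W] {d : ℕ} {π : (Fin (d + 1) → ℂ) →L[ℂ] V}
    (h : InducesEmbedding fun s => π (veronese d s)) (L : V →L[ℂ] W) (hL : Function.Injective L) :
    InducesEmbedding fun s => (L.comp π) (veronese d s) := by
  refine ⟨fun s hs h0 => h.defined s hs (hL (h0.trans (map_zero _).symm)),
    fun s t hs ht hst => h.injective s t hs ht ?_, fun s hs => ?_⟩
  · have h1 : ∀ v : V, (Submodule.span ℂ {v}).map (L : V →ₗ[ℂ] W) = Submodule.span ℂ {L v} :=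
      fun v => by rw [Submodule.map_span, Set.image_singleton]; rfl
    refine Submodule.map_injective_of_injective (f := (L : V →ₗ[ℂ] W)) hL ?_
    rw [h1, h1]
    exact hst
  · have h1 : HasFDerivAt (fun s => π (veronese d s)) (fderiv ℂ (fun s => π (veronese d s)) s) s :=
      ((π.analyticAt _).comp (analyticAt_veronese d s)).differentiableAt.hasFDerivAt
    have h2 : HasFDerivAt (fun s => (L.comp π) (veronese d s))
        (L.comp (fderiv ℂ (fun s => π (veronese d s)) s)) s := L.hasFDerivAt.comp s h1
    rw [h2.fderiv]
    exact hL.comp (h.immersive s hs)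

namespace ScrollData

variable {m d : ℕ} {V : Type*} [NormedAddCommGroup V] [NormedSpace ℂ V] [FiniteDimensional ℂ V]

/-- The scroll in `V` corresponding to a scroll in a product under a linear isomorphism. -/
def ofEquiv {n : ℕ} (e : V ≃ₗ[ℂ] (Fin (m + 1) → ℂ) × (Fin n → ℂ))
    (π : (Fin (d + 1) → ℂ) →ₗ[ℂ] (Fin n → ℂ)) (hπ : Function.Surjective π)
    (h : InducesEmbedding fun s => π (veronese d s)) : ScrollData m d V where
  fst := LinearMap.toContinuousLinearMap (e.symm.toLinearMap ∘ₗ LinearMap.inl ℂ _ _)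
  snd := (LinearMap.toContinuousLinearMap (e.symm.toLinearMap ∘ₗ LinearMap.inr ℂ _ _)).comp
    (LinearMap.toContinuousLinearMap π)
  proj := LinearMap.toContinuousLinearMap (e.symm.toLinearMap ∘ₗ LinearMap.inl ℂ _ _ ∘ₗ
    LinearMap.fst ℂ _ _ ∘ₗ e.toLinearMap)
  injective_fst := e.symm.injective.comp LinearMap.inl_injective
  inducesEmbedding := InducesEmbedding.comp_injective (π := LinearMap.toContinuousLinearMap π) h _
    (e.symm.injective.comp LinearMap.inr_injective)
  proj_fst a := by simp
  proj_snd b := by simp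
  sup_range := by
    refine eq_top_iff.2 fun v _ => ?_
    obtain ⟨b, hb⟩ := hπ (e v).2
    refine Submodule.mem_sup.2 ⟨_, ⟨(e v).1, rfl⟩, _, ⟨b, rfl⟩, e.injective ?_⟩
    simp [hb]

variable {n : ℕ} (e : V ≃ₗ[ℂ] (Fin (m + 1) → ℂ) × (Fin n → ℂ))
  (π : (Fin (d + 1) → ℂ) →ₗ[ℂ] (Fin n → ℂ)) (hπ : Function.Surjective π)
  (h : InducesEmbedding fun s => π (veronese d s))

theorem ofEquiv_snd_eq_zero {b : Fin (d + 1) → ℂ} : (ofEquiv e π hπ h).snd b = 0 ↔ π b = 0 := by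
  simp [ofEquiv]

theorem image_scroll_ofEquiv :
    Projectivization.map e.toLinearMap e.injective '' (ofEquiv e π hπ h).scroll =
      rationalScroll (veronese m) fun s => π (veronese d s) := by
  have h₁ : ∀ s, ((ofEquiv e π hπ h).line₁ s).map e.toLinearMap =
      Submodule.span ℂ {(veronese m s, 0)} := fun s => by
    rw [line₁, Submodule.map_span, Set.image_singleton]
    simp [ofEquiv]
  have h₂ : ∀ s, ((ofEquiv e π hπ h).line₂ s).map e.toLinearMap =
      Submodule.span ℂ {(0, π (veronese d s))} := fun s => by
    rw [line₂, Submodule.map_span, Set.image_singleton]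
    simp [ofEquiv]
  exact image_joinOfCurves e (fun i => ⟨i, h₁ i, h₂ i⟩) fun j => ⟨j, h₁ j, h₂ j⟩

theorem eq_scroll_ofEquiv {X : Set (Projectivization ℂ V)}
    (hX : Projectivization.map e.toLinearMap e.injective '' X =
      rationalScroll (veronese m) fun s => π (veronese d s)) : X = (ofEquiv e π hπ h).scroll :=
  (Projectivization.map_injective e.toLinearMap e.injective).image_injective
    (hX.trans (image_scroll_ofEquiv e π hπ h).symm)

end ScrollData

/-! ### The two kinds of scrolls in a common form -/

section Projected

variable {m d : ℕ} {V : Type*} [NormedAddCommGroup V] [NormedSpace ℂ V] [FiniteDimensional ℂ V]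
  {X : Set (Projectivization ℂ V)}

theorem IsProjectedRationalScroll.exists_scrollData (hd : 1 ≤ d)
    (hX : IsProjectedRationalScroll m d X) :
    ∃ D : ScrollData m d V, X = D.scroll ∧
      ∀ o, Disjoint (LinearMap.ker (D.snd : (Fin (d + 1) → ℂ) →ₗ[ℂ] V))
        (jetSpan (m + 1) fun w => veronese d (affinePoint o w)) := by
  obtain ⟨π, hπ, hE, hdisj, e, he⟩ := hX
  refine ⟨.ofEquiv e π hπ hE, ScrollData.eq_scroll_ofEquiv e π hπ hE he, fun o => ?_⟩
  have hy : (Projectivization.mk ℂ _ (veronese_ne_zero d (affinePoint_ne_zero o 0))).submodule =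
      Submodule.span ℂ {veronese d (affinePoint o 0)} := Projectivization.submodule_mk _ _
  have h1 := hdisj _ ⟨_, affinePoint_ne_zero o 0, hy⟩
  rw [osculatingSpace_rationalNormalCurve hd m o hy] at h1
  exact h1.mono_left fun b hb => (ScrollData.ofEquiv_snd_eq_zero e π hπ hE).1 hb

theorem IsSemibalancedRationalNormalScroll.exists_scrollData
    (hX : IsSemibalancedRationalNormalScroll m X) :
    ∃ D : ScrollData m (m + 1) V, X = D.scroll ∧ Function.Injective D.snd := by
  obtain ⟨e, he⟩ := hX
  have hE : InducesEmbedding fun s => (LinearMap.id : (Fin (m + 2) → ℂ) →ₗ[ℂ] (Fin (m + 2) → ℂ))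
      (veronese (m + 1) s) :=
    inducesEmbedding_veronese (ContinuousLinearMap.id ℂ _) (by lia) Function.injective_id
  refine ⟨.ofEquiv e LinearMap.id Function.surjective_id hE,
    ScrollData.eq_scroll_ofEquiv e _ _ hE he, ?_⟩
  exact (injective_iff_map_eq_zero _).2 fun b hb =>
    (ScrollData.ofEquiv_snd_eq_zero e _ Function.surjective_id hE).1 hb

theorem IsProjectedRationalScroll.finrank_osculatingSpace_eq (hm : 1 ≤ m) (hmd : m ≤ d)
    (hX : IsProjectedRationalScroll m d X) {x : Projectivization ℂ V} (hx : x ∈ X) :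
    Module.finrank ℂ (osculatingSpace (ℂ × ℂ) m X x) = 2 * m + 1 := by
  obtain ⟨D, rfl, h⟩ := hX.exists_scrollData (hm.trans hmd)
  exact D.finrank_osculatingSpace_eq hm (hm.trans hmd) hmd h hx

theorem IsProjectedRationalScroll.inflectionalLocus_eq_empty (hm : 1 ≤ m) (hmd : m ≤ d)
    (hX : IsProjectedRationalScroll m d X) : inflectionalLocus (ℂ × ℂ) m X = ∅ := by
  refine Set.eq_empty_iff_forall_notMem.2 ?_
  rintro x ⟨hx, y, hy, h⟩
  rw [hX.finrank_osculatingSpace_eq hm hmd hx, hX.finrank_osculatingSpace_eq hm hmd hy] at h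
  exact h.false

theorem IsProjectedRationalScroll.satisfiesPieneTaiHypotheses (hm : 1 ≤ m) (hmd : m ≤ d)
    (hV : Module.finrank ℂ V = 2 * m + 3)
    (hX : IsProjectedRationalScroll m d X) : SatisfiesPieneTaiHypotheses (2 * m + 2) X := by
  have hfin : (2 * m + 2 - 1) / 2 = m := by lia
  have hosc := fun x hx => hX.finrank_osculatingSpace_eq (x := x) hm hmd hx
  obtain ⟨D, rfl, h⟩ := hX.exists_scrollData (hm.trans hmd)
  refine ⟨hV, D.isSmoothProjectiveSurface hm (hm.trans hmd), D.linearSpan_scroll,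
    fun x hx k => D.finrank_osculatingSpace_le hm (hm.trans hmd) hx k, ?_⟩
  rw [hfin]
  exact hosc

end Projected

/-! ### Binary forms and apolarity -/

section Apolar

/-- The functional on `ℂ^(n+1)` associated with a vector by the invariant bilinear pairing of binary
forms of degree `n`. -/
def apolarForm (n : ℕ) (u : Fin (n + 1) → ℂ) : (Fin (n + 1) → ℂ) →ₗ[ℂ] ℂ :=
  ∑ i : Fin (n + 1), ((n.choose i : ℂ) * u i) • LinearMap.proj i

theorem apolarForm_apply (n : ℕ) (u v : Fin (n + 1) → ℂ) :
    apolarForm n u v = ∑ i : Fin (n + 1), (n.choose i : ℂ) * u i * v i := by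
  simp [apolarForm]

theorem apolarForm_comm (n : ℕ) (u v : Fin (n + 1) → ℂ) : apolarForm n u v = apolarForm n v u := by
  simp only [apolarForm_apply]
  exact Finset.sum_congr rfl fun i _ => by ring

theorem apolarForm_veronese (n : ℕ) (s t : ℂ × ℂ) :
    apolarForm n (veronese n s) (veronese n t) = (s.1 * t.1 + s.2 * t.2) ^ n := by
  rw [apolarForm_apply, add_comm (s.1 * t.1), add_pow, ← Fin.sum_univ_eq_sum_range (fun i =>
    (s.2 * t.2) ^ i * (s.1 * t.1) ^ (n - i) * (n.choose i : ℂ))]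
  refine Finset.sum_congr rfl fun i _ => ?_
  simp only [veronese, mul_pow]
  ring

/-- The pairing is nondegenerate because the binomial coefficients are nonzero, and the powers of
linear forms from one affine chart already span. -/
theorem eq_zero_of_apolarForm_eq_zero {n : ℕ} {u : Fin (n + 1) → ℂ} (o : Option ℂ)
    (h : ∀ w, apolarForm n (veronese n (affinePoint o w)) u = 0) : u = 0 := by
  have h1 : apolarForm n u = 0 := eq_zero_of_apply_veronese_affinePoint o fun w => by
    rw [apolarForm_comm, h]
  funext i
  have h2 := LinearMap.congr_fun h1 (Pi.single i 1)
  rw [apolarForm_apply, Finset.sum_eq_single i (fun j _ hj => by simp [hj])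
    (fun hi => absurd (Finset.mem_univ i) hi)] at h2
  have h3 : (n.choose i : ℂ) ≠ 0 := by
    exact_mod_cast (Nat.choose_pos (Nat.lt_succ_iff.1 i.2)).ne'
  simpa [h3] using h2

theorem exists_eq_smul_of_mul_eq {s t : ℂ × ℂ} (ht : t ≠ 0) (h : t.2 * s.1 = t.1 * s.2) :
    ∃ c : ℂ, s = c • t := by
  by_cases h1 : t.1 = 0
  · have h2 : t.2 ≠ 0 := fun h2 => ht (Prod.ext h1 h2)
    rw [h1, zero_mul] at h
    refine ⟨s.2 / t.2, Prod.ext ?_ ?_⟩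
    · simp [h1, (mul_eq_zero.1 h).resolve_left h2]
    · simp [h2]
  · refine ⟨s.1 / t.1, Prod.ext ?_ ?_⟩
    · simp [h1]
    · simp only [Prod.smul_snd, smul_eq_mul]
      field_simp
      linear_combination -h

/-- A binary form with only one root is a multiple of a power of a linear form. -/
theorem exists_eq_smul_apolarForm {d : ℕ} {l : (Fin (d + 1) → ℂ) →ₗ[ℂ] ℂ} {x : ℂ}
    (h : ∀ s : ℂ × ℂ, s ≠ 0 → l (veronese d s) = 0 → ∃ c : ℂ, s = c • ((1 : ℂ), x)) :
    ∃ c : ℂ, c ≠ 0 ∧ l = c • apolarForm d (veronese d (-x, 1)) := by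
  let R : Polynomial ℂ := ∑ i : Fin (d + 1),
    Polynomial.C (l (Pi.single i 1)) * Polynomial.X ^ (i : ℕ)
  have hR : ∀ X, R.eval X = l (veronese d (1, X)) := by
    intro X
    rw [apply_veronese]
    simp only [R, Polynomial.eval_finsetSum]
    exact Finset.sum_congr rfl fun i _ => by
      rw [Polynomial.eval_mul, Polynomial.eval_C, Polynomial.eval_pow, Polynomial.eval_X, one_pow,
        one_mul, mul_comm]
  have hroot : ∀ X, R.eval X = 0 → X = x := by
    intro X hX
    obtain ⟨c, hc⟩ := h (1, X) (fun h0 => one_ne_zero (congrArg Prod.fst h0)) ((hR X).symm.trans hX)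
    have h1 := congrArg Prod.fst hc
    have h2 := congrArg Prod.snd hc
    simp only [Prod.smul_fst, Prod.smul_snd, smul_eq_mul, mul_one] at h1 h2
    rw [h2, ← h1, one_mul]
  have hdeg : R.natDegree ≤ d := Polynomial.natDegree_sum_le_of_forall_le _ _ fun i _ =>
    (Polynomial.natDegree_C_mul_X_pow_le _ _).trans (by lia)
  have hcoeff : R.coeff d ≠ 0 := by
    have h1 : R.coeff d = l (veronese d (0, 1)) := by
      rw [apply_veronese]
      simp only [R, Polynomial.finsetSum_coeff]
      refine Finset.sum_congr rfl fun i _ => ?_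
      rw [Polynomial.coeff_C_mul, Polynomial.coeff_X_pow]
      by_cases hi : d = (i : ℕ)
      · simp [← hi]
      · have : d - (i : ℕ) ≠ 0 := by lia
        simp [hi, this]
    rw [h1]
    intro h0
    obtain ⟨c, hc⟩ := h (0, 1) (fun h0 => one_ne_zero (congrArg Prod.snd h0)) h0
    have h2 := congrArg Prod.fst hc
    have h3 := congrArg Prod.snd hc
    simp only [Prod.smul_fst, Prod.smul_snd, smul_eq_mul, mul_one] at h2 h3
    rw [← h2, zero_mul] at h3
    exact one_ne_zero h3
  have hd : R.natDegree = d := le_antisymm hdeg (Polynomial.le_natDegree_of_ne_zero hcoeff)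
  have hR0 : R ≠ 0 := fun h0 => hcoeff (by rw [h0, Polynomial.coeff_zero])
  -- The only possible affine root is `x`, and the top coefficient is nonzero because infinity is
  -- not a root; so `x` is a root of multiplicity `d`.
  have hroots : R.roots = Multiset.replicate d x := by
    rw [Multiset.eq_replicate]
    refine ⟨?_, fun y hy => hroot y ((Polynomial.mem_roots hR0).1 hy)⟩
    rw [← hd]
    exact (IsAlgClosed.splits R).natDegree_eq_card_roots.symm
  have hprod := (IsAlgClosed.splits R).eq_prod_roots
  rw [hroots, Multiset.map_replicate, Multiset.prod_replicate] at hprod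
  refine ⟨R.leadingCoeff, Polynomial.leadingCoeff_ne_zero.2 hR0, ?_⟩
  rw [← sub_eq_zero]
  refine eq_zero_of_apply_veronese_affinePoint (some 0) fun w => ?_
  have h4 := congrArg (Polynomial.eval w) hprod
  rw [hR, Polynomial.eval_mul, Polynomial.eval_C, Polynomial.eval_pow, Polynomial.eval_sub,
    Polynomial.eval_X, Polynomial.eval_C] at h4
  rw [LinearMap.sub_apply, LinearMap.smul_apply, apolarForm_veronese]
  simp only [affinePoint, zero_add, smul_eq_mul]
  rw [h4]
  ring

theorem eq_top_of_veronese_mem {d : ℕ} {S : Submodule ℂ (Fin (d + 1) → ℂ)}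
    (h : ∀ s, s ≠ 0 → veronese d s ∈ S) : S = ⊤ := by
  by_contra hne
  obtain ⟨v, -, hv⟩ := SetLike.exists_of_lt (lt_top_iff_ne_top.2 hne)
  obtain ⟨l, hl, hlS⟩ := Submodule.exists_le_ker_of_notMem hv
  refine hl ?_
  rw [eq_zero_of_apply_veronese_affinePoint (l := l) none fun w =>
    hlS (h _ (affinePoint_ne_zero none w)), LinearMap.zero_apply]

end Apolar

/-! ### Comparison of scrolls -/

namespace ScrollData

variable {m d : ℕ} {V : Type*} [NormedAddCommGroup V] [NormedSpace ℂ V]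

theorem proj'_eq_zero_iff (D : ScrollData m d V) {v : V} :
    D.proj' v = 0 ↔ v ∈ LinearMap.range (D.fst : (Fin (m + 1) → ℂ) →ₗ[ℂ] V) := by
  constructor
  · intro hv
    obtain ⟨_, ⟨a, rfl⟩, _, ⟨b, rfl⟩, h⟩ := Submodule.mem_sup.1
      (D.sup_range.ge (Submodule.mem_top : v ∈ ⊤))
    rw [← h] at hv
    rw [← h]
    have h1 : D.snd b = 0 := (D.proj_add a b).2.symm.trans hv
    exact ⟨a, by simp [h1]⟩
  · rintro ⟨a, rfl⟩
    simp [proj', D.proj_fst]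

theorem finrank_add_finrank_range_snd (D : ScrollData m d V) [FiniteDimensional ℂ V] :
    m + 1 + Module.finrank ℂ (LinearMap.range (D.snd : (Fin (d + 1) → ℂ) →ₗ[ℂ] V)) =
      Module.finrank ℂ V := by
  have h1 : Disjoint (LinearMap.range (D.fst : (Fin (m + 1) → ℂ) →ₗ[ℂ] V))
      (LinearMap.range (D.snd : (Fin (d + 1) → ℂ) →ₗ[ℂ] V)) := by
    rw [Submodule.disjoint_def]
    rintro _ ⟨a, rfl⟩ ⟨b, hb⟩
    have hb' : D.snd b = D.fst a := hb
    have := D.proj_snd b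
    rw [hb', D.proj_fst] at this
    exact this
  have h2 := Submodule.finrank_add_eq_of_isCompl ⟨h1, codisjoint_iff.2 D.sup_range⟩
  rw [LinearMap.finrank_range_of_inj D.injective_fst, Module.finrank_fin_fun] at h2
  exact h2

variable [FiniteDimensional ℂ V] (D : ScrollData m d V) (D' : ScrollData m (m + 1) V)
  (h : D.scroll = D'.scroll) (hD' : Function.Injective D'.snd)
include h hD'

/-- Osculating spaces of order `m + 1` have dimension at most `2m + 2` along the first directrix of
`D`, but at least `2m + 3` off the first directrix of the semibalanced `D'`, whose second directrix
has full jets. So the former directrix lies on the latter, and the spans agree by dimension. -/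
theorem range_fst_eq (hm : 1 ≤ m) (hd : 1 ≤ d) :
    LinearMap.range (D.fst : (Fin (m + 1) → ℂ) →ₗ[ℂ] V) =
      LinearMap.range (D'.fst : (Fin (m + 1) → ℂ) →ₗ[ℂ] V) := by
  refine Submodule.eq_of_le_of_finrank_eq ?_ (by
    rw [LinearMap.finrank_range_of_inj D.injective_fst,
      LinearMap.finrank_range_of_inj D'.injective_fst])
  rw [LinearMap.range_le_iff_comap]
  refine eq_top_of_veronese_mem fun s hs => ?_
  obtain ⟨o, c, hc, rfl⟩ := exists_eq_smul_affinePoint hs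
  rw [veronese_smul]
  refine Submodule.smul_mem _ _ ?_
  change D.lift₁ o 0 ∈ LinearMap.range (D'.fst : (Fin (m + 1) → ℂ) →ₗ[ℂ] V)
  have h0 : D.lift₁ o 0 ≠ 0 := D.fst_ne_zero (affinePoint_ne_zero o 0)
  have hx : (Projectivization.mk ℂ _ h0).submodule = Submodule.span ℂ {D.lift₁ o 0} :=
    Projectivization.submodule_mk _ _
  have hxX : Projectivization.mk ℂ _ h0 ∈ D.scroll :=
    ⟨⟨_, affinePoint_ne_zero o 0⟩, hx.le.trans le_sup_left⟩
  have h1 := D.finrank_osculatingSpace_first hm hd hx (m + 1)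
  have h2 := finrank_jetSpan_le (m + 1) (D.lift₂ o)
  rw [h] at h1 hxX
  obtain ⟨o', h3 | ⟨t, h3⟩⟩ := D'.exists_eq_span hxX
  · have h4 : D.lift₁ o 0 ∈ Submodule.span ℂ {D'.lift₁ o' 0} := by
      rw [← h3, hx]
      exact Submodule.mem_span_singleton_self _
    exact (Submodule.span_singleton_le_iff_mem (D'.lift₁ o' 0)
      (LinearMap.range (D'.fst : (Fin (m + 1) → ℂ) →ₗ[ℂ] V))).2 (LinearMap.mem_range_self _ _) h4
  · have h4 := D'.le_finrank_osculatingSpace_second hm (by lia) h3 (m + 1)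
    rw [D'.finrank_jetSpan_lift₂ (by lia) (Disjoint.mono_left (b := ⊥) (fun v hv =>
      (Submodule.mem_bot ℂ).2 (hD' (hv.trans (map_zero _).symm))) disjoint_bot_left)] at h4
    lia

/-- Projection from the common span of the first directrices maps the second directrix of `D`
injectively to the rational normal curve of degree `m + 1`. Hyperplanes osculating the latter pull
back to powers of linear forms, enough of them to make `D.snd` injective; counting dimensions gives
`d`. -/
theorem eq_of_scroll_eq (hm : 1 ≤ m) (hd : 1 ≤ d) (hV : Module.finrank ℂ V = 2 * m + 3) :
    d = m + 1 := by
  have hrange := D.range_fst_eq D' h hD' hm hd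
  have hker : ∀ v, D'.proj' v = 0 → D.proj v = v := by
    intro v hv
    rw [D'.proj'_eq_zero_iff, ← hrange] at hv
    obtain ⟨a, rfl⟩ := hv
    exact D.proj_fst a
  -- A point of the second directrix of `D` does not lie in the centre of projection: `D.proj` kills
  -- the former and fixes the latter. Hence the multiplier `b` is nonzero.
  have hG : ∀ s : ℂ × ℂ, s ≠ 0 → ∃ t : ℂ × ℂ, t ≠ 0 ∧ ∃ b : ℂ, b ≠ 0 ∧
      D'.proj' (D.snd (veronese d s)) = b • D'.snd (veronese (m + 1) t) := by
    intro s hs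
    have h1 : D.snd (veronese d s) ∈ affineCone D.scroll :=
      D.mem_affineCone.2 ⟨D.snd_ne_zero hs, s, hs, 0, 1, by simp⟩
    rw [h] at h1
    obtain ⟨-, t, ht, a, b, hab⟩ := D'.mem_affineCone.1 h1
    have h2 : D'.proj' (D.snd (veronese d s)) = b • D'.snd (veronese (m + 1) t) := by
      have := (D'.proj_add (a • veronese m t) (b • veronese (m + 1) t)).2
      simp only [map_smul] at this
      rw [hab, this]
    refine ⟨t, ht, b, fun hb => D.snd_ne_zero hs ?_, h2⟩
    rw [hb, zero_smul] at h2
    rw [← hker _ h2, D.proj_snd]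
  have hinj : ∀ s t : ℂ × ℂ, s ≠ 0 → t ≠ 0 → ∀ c : ℂ,
      D'.proj' (D.snd (veronese d s)) = c • D'.proj' (D.snd (veronese d t)) →
      ∃ b : ℂ, s = b • t := by
    intro s t hs ht c hc
    have h1 := hker (D.snd (veronese d s) - c • D.snd (veronese d t)) (by
      rw [map_sub, map_smul, hc, sub_self])
    rw [map_sub, map_smul, D.proj_snd, D.proj_snd, smul_zero, sub_zero, eq_comm, sub_eq_zero] at h1
    have hc0 : c ≠ 0 := by
      rintro rfl
      exact D.snd_ne_zero hs (by rw [h1, zero_smul])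
    have h2 := D.inducesEmbedding.injective s t hs ht (by
      rw [h1, Submodule.span_singleton_smul_eq hc0.isUnit])
    obtain ⟨b, hb⟩ := Submodule.mem_span_singleton.1
      (h2 ▸ Submodule.mem_span_singleton_self s : s ∈ Submodule.span ℂ {t})
    exact ⟨b, hb.symm⟩
  obtain ⟨g, hg⟩ := LinearMap.exists_leftInverse_of_injective
    (D'.snd : (Fin (m + 1 + 1) → ℂ) →ₗ[ℂ] V) (LinearMap.ker_eq_bot.2 hD')
  have hg' : ∀ a, g (D'.snd a) = a := fun a => LinearMap.congr_fun hg a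
  have hsnd : Function.Injective (D.snd : (Fin (d + 1) → ℂ) →ₗ[ℂ] V) := by
    refine (injective_iff_map_eq_zero _).2 fun u hu => ?_
    have hu' : D.snd u = 0 := hu
    refine eq_zero_of_apolarForm_eq_zero none fun w => ?_
    have hw0 : ((1 : ℂ), -w) ≠ 0 := fun h0 => one_ne_zero (congrArg Prod.fst h0)
    obtain ⟨t, ht, b, hb, hbt⟩ := hG (1, -w) hw0
    -- The value of this apolar form at the point with parameter `t'` is `(t.2 * t'.1 - t.1 * t'.2)
    -- ^ (m + 1)`: it cuts out the osculating hyperplane at `t`, which meets the curve only there.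
    -- By injectivity its pullback vanishes only at `(1, -w)`.
    let l : (Fin (d + 1) → ℂ) →ₗ[ℂ] ℂ := apolarForm (m + 1) (veronese (m + 1) (t.2, -t.1)) ∘ₗ g ∘ₗ
      (D'.proj' : V →ₗ[ℂ] V) ∘ₗ (D.snd : (Fin (d + 1) → ℂ) →ₗ[ℂ] V)
    have hl : ∀ v, l v = apolarForm (m + 1) (veronese (m + 1) (t.2, -t.1))
      (g (D'.proj' (D.snd v))) := fun v => rfl
    obtain ⟨c, hc, hlc⟩ := exists_eq_smul_apolarForm (l := l) (x := -w) fun s hs hs0 => by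
      obtain ⟨t', ht', b', hb', hbt'⟩ := hG s hs
      rw [hl, hbt', map_smul, map_smul, hg', apolarForm_veronese, smul_eq_mul] at hs0
      have h1 := eq_zero_of_pow_eq_zero ((mul_eq_zero.1 hs0).resolve_left hb')
      obtain ⟨a, rfl⟩ := exists_eq_smul_of_mul_eq (s := t') ht (by linear_combination h1)
      refine hinj _ _ hs hw0 (b' * a ^ (m + 1) * b⁻¹) ?_
      rw [hbt', hbt, veronese_smul, map_smul, smul_smul, smul_smul, inv_mul_cancel_right₀ hb]
    have h2 : l u = 0 := by rw [hl, hu', map_zero, map_zero, map_zero]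
    rw [hlc, LinearMap.smul_apply, smul_eq_mul, neg_neg] at h2
    exact (mul_eq_zero.1 h2).resolve_left hc
  have h3 := D.finrank_add_finrank_range_snd
  rw [LinearMap.finrank_range_of_inj hsnd, Module.finrank_fin_fun, hV] at h3
  lia

end ScrollData

theorem IsProjectedRationalScroll.not_isSemibalancedRationalNormalScroll {m d : ℕ} {V : Type*}
    [NormedAddCommGroup V] [NormedSpace ℂ V] [FiniteDimensional ℂ V]
    {X : Set (Projectivization ℂ V)} (hm : 1 ≤ m) (hmd : m + 2 ≤ d)
    (hV : Module.finrank ℂ V = 2 * m + 3) (hX : IsProjectedRationalScroll m d X) :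
    ¬ IsSemibalancedRationalNormalScroll m X := by
  intro hX'
  obtain ⟨D, rfl, -⟩ := hX.exists_scrollData (by lia)
  obtain ⟨D', h, hD'⟩ := hX'.exists_scrollData
  have := D.eq_of_scroll_eq D' h hD' hm (by lia) hV
  lia

/-! ### Existence of scrolls of the second type -/

section Existence

theorem iteratedDeriv_affine_pow (A B : ℂ) (d j : ℕ) :
    iteratedDeriv j (fun w : ℂ => (A + B * w) ^ d) =
      fun w => (d.descFactorial j : ℂ) * (A + B * w) ^ (d - j) * B ^ j := by
  induction j with
  | zero => simp
  | succ j ih =>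
    rw [iteratedDeriv_succ, ih]
    funext w
    have h1 : HasDerivAt (fun w : ℂ => A + B * w) B w := by
      simpa using ((hasDerivAt_id w).const_mul B).const_add A
    refine (((h1.pow (d - j)).const_mul (d.descFactorial j : ℂ)).mul_const (B ^ j)).deriv.trans ?_
    rw [Nat.descFactorial_succ, Nat.sub_sub]
    push_cast
    ring

variable {m d : ℕ} (ρ : Fin (m + 2) → ℂ)

/-- The projection of the rational normal curve to the curve `[s] ↦ [(ρ j * s.1 + s.2) ^ d]`. -/
def powerProjection (d : ℕ) : (Fin (d + 1) → ℂ) →ₗ[ℂ] (Fin (m + 2) → ℂ) :=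
  LinearMap.pi fun j => apolarForm d (veronese d (ρ j, 1))

theorem powerProjection_veronese (s : ℂ × ℂ) (j : Fin (m + 2)) :
    powerProjection ρ d (veronese d s) j = (ρ j * s.1 + s.2) ^ d := by
  rw [powerProjection, LinearMap.pi_apply, apolarForm_veronese, one_mul]

variable {ρ} (hρ : Function.Injective ρ)

include hρ in
-- The coordinates of the image are the values at the nodes `ρ j` of a polynomial of degree at most
-- `d`, whose coefficients are those of the vector up to binomial factors; Lagrange interpolation
-- prescribes these values.
theorem surjective_powerProjection (hd : m + 1 ≤ d) :
    Function.Surjective (powerProjection ρ d) := by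
  intro c
  let P := Lagrange.interpolate Finset.univ ρ c
  have hP : P.natDegree < d + 1 := by
    by_cases h0 : P = 0
    · rw [h0, Polynomial.natDegree_zero]
      lia
    · rw [Polynomial.natDegree_lt_iff_degree_lt h0]
      refine (Lagrange.degree_interpolate_lt c hρ.injOn).trans_le ?_
      rw [Finset.card_univ, Fintype.card_fin]
      exact_mod_cast (by lia : m + 2 ≤ d + 1)
  refine ⟨fun i => P.coeff (d - i) / (d.choose i : ℂ), funext fun j => ?_⟩
  rw [powerProjection, LinearMap.pi_apply, apolarForm_apply,
    ← Lagrange.eval_interpolate_at_node c hρ.injOn (Finset.mem_univ j),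
    Polynomial.eval_eq_sum_range' hP, ← Finset.sum_range_reflect, ← Fin.sum_univ_eq_sum_range
      (fun i => P.coeff (d + 1 - 1 - i) * ρ j ^ (d + 1 - 1 - i))]
  refine Finset.sum_congr rfl fun i _ => ?_
  have h3 : (d.choose i : ℂ) ≠ 0 := by
    exact_mod_cast (Nat.choose_pos (Nat.lt_succ_iff.1 i.2)).ne'
  simp only [veronese, one_pow, mul_one, Nat.add_sub_cancel]
  field_simp

theorem eq_zero_of_affine_eq_zero {x y : ℂ} (hxy : x ≠ y) {s : ℂ × ℂ} (hx : x * s.1 + s.2 = 0)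
    (hy : y * s.1 + s.2 = 0) : s = 0 := by
  have h1 : s.1 = 0 := by
    have : (x - y) * s.1 = 0 := by linear_combination hx - hy
    exact (mul_eq_zero.1 this).resolve_left (sub_ne_zero.2 hxy)
  refine Prod.ext h1 ?_
  rw [h1, mul_zero, zero_add] at hx
  exact hx

/-- Two vectors with proportional absolute values at `0`, `1`, `2`, `I` are proportional. -/
theorem mul_eq_mul_of_norm_eq {s t : ℂ × ℂ} {r : ℝ}
    (h : ∀ x ∈ ({0, 1, 2, Complex.I} : Set ℂ), ‖x * s.1 + s.2‖ = r * ‖x * t.1 + t.2‖) :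
    t.2 * s.1 = t.1 * s.2 := by
  have h' : ∀ x ∈ ({0, 1, 2, Complex.I} : Set ℂ),
      Complex.normSq (x * s.1 + s.2) = r ^ 2 * Complex.normSq (x * t.1 + t.2) := by
    intro x hx
    rw [Complex.normSq_eq_norm_sq, Complex.normSq_eq_norm_sq, h x hx, mul_pow]
  have h0 := h' 0 (by simp)
  have h1 := h' 1 (by simp)
  have h2 := h' 2 (by simp)
  have h3 := h' Complex.I (by simp)
  rw [← sub_eq_zero, ← Complex.normSq_eq_zero]
  obtain ⟨⟨a, b⟩, ⟨c, e⟩⟩ := s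
  obtain ⟨⟨a', b'⟩, ⟨c', e'⟩⟩ := t
  simp only [Complex.normSq_apply, Complex.add_re, Complex.add_im, Complex.mul_re, Complex.mul_im,
    Complex.sub_re, Complex.sub_im, Complex.zero_re, Complex.zero_im, Complex.one_re,
    Complex.one_im, Complex.I_re, Complex.I_im, Complex.re_ofNat, Complex.im_ofNat] at *
  -- The four absolute values determine the Hermitian form `|x s₁ + s₂|²`: these identities recover
  -- `|s₁|²`, `|s₂|²` and the real and imaginary parts of `s₁` times the conjugate of `s₂`. The
  -- squared norm of the determinant is an expression in them.
  have e1 : a * a + b * b = r ^ 2 * (a' * a' + b' * b') := by linear_combination (h0 + h2) / 2 - h1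
  have e2 : c * c + e * e = r ^ 2 * (c' * c' + e' * e') := by linear_combination h0
  have e3 : a * c + b * e = r ^ 2 * (a' * c' + b' * e') := by
    linear_combination (h1 - e1 - e2) / 2
  have e4 : a * e - b * c = r ^ 2 * (a' * e' - b' * c') := by
    linear_combination (h3 - e1 - e2) / 2
  linear_combination (c' * c' + e' * e') * e1 + (a' * a' + b' * b') * e2 -
    2 * (a' * c' + b' * e') * e3 - 2 * (a' * e' - b' * c') * e4

theorem inducesEmbedding_powerProjection (hd : 2 ≤ d)
    (h : ({0, 1, 2, Complex.I} : Set ℂ) ⊆ Set.range ρ) :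
    InducesEmbedding fun s => powerProjection ρ d (veronese d s) := by
  have hd0 : d ≠ 0 := by lia
  refine ⟨fun s hs h0 => ?_, fun s t hs ht hst => ?_, fun s hs => ?_⟩
  · have key : ∀ x ∈ ({0, 1, 2, Complex.I} : Set ℂ), x * s.1 + s.2 = 0 := by
      intro x hx
      obtain ⟨j, rfl⟩ := h hx
      have := congrFun h0 j
      rw [powerProjection_veronese] at this
      exact eq_zero_of_pow_eq_zero this
    exact hs (eq_zero_of_affine_eq_zero zero_ne_one (key 0 (by simp)) (key 1 (by simp)))
  · obtain ⟨c, hc⟩ := Submodule.mem_span_singleton.1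
      (hst ▸ Submodule.mem_span_singleton_self _ : powerProjection ρ d (veronese d s) ∈
        Submodule.span ℂ {powerProjection ρ d (veronese d t)})
    have hmul : t.2 * s.1 = t.1 * s.2 := by
      -- Equality of `d`-th powers up to `c` fixes the linear forms only up to roots of unity
      -- depending on the node; absolute values remove this ambiguity.
      refine mul_eq_mul_of_norm_eq (r := ‖c‖ ^ ((d : ℝ)⁻¹)) fun x hx => ?_
      obtain ⟨j, rfl⟩ := h hx
      have h1 := congrFun hc j
      rw [Pi.smul_apply, powerProjection_veronese, powerProjection_veronese, smul_eq_mul] at h1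
      refine (pow_left_inj₀ (norm_nonneg _) (by positivity) hd0).1 ?_
      rw [mul_pow, Real.rpow_inv_natCast_pow (norm_nonneg c) hd0, ← norm_pow, ← norm_pow, ← h1,
        norm_mul]
    obtain ⟨a, rfl⟩ := exists_eq_smul_of_mul_eq ht hmul
    have ha : a ≠ 0 := by
      rintro rfl
      exact hs (zero_smul _ _)
    exact Submodule.span_singleton_smul_eq ha.isUnit _
  · refine (injective_iff_map_eq_zero _).2 fun v hv => ?_
    let π := LinearMap.toContinuousLinearMap (powerProjection ρ d)
    have h1 : HasFDerivAt (fun s => powerProjection ρ d (veronese d s))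
        (fderiv ℂ (fun s => powerProjection ρ d (veronese d s)) s) (s + (0 : ℂ) • v) := by
      rw [zero_smul, add_zero]
      exact ((π.analyticAt _).comp (analyticAt_veronese d s)).differentiableAt.hasFDerivAt
    have h2 : HasDerivAt (fun z : ℂ => s + z • v) ((1 : ℂ) • v) 0 :=
      ((hasDerivAt_id (0 : ℂ)).smul_const v).const_add s
    have h3 := h1.comp_hasDerivAt (0 : ℂ) h2
    rw [one_smul, hv] at h3
    -- The coordinate at node `x` has derivative `d (x s₁ + s₂)^(d-1) (x v₁ + v₂)` in the direction
    -- `v`. Since `s ≠ 0`, the first linear form vanishes at one node at most, so the second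
    -- vanishes at two of `0, 1, 2`, and `v = 0`.
    have key : ∀ x ∈ ({0, 1, 2, Complex.I} : Set ℂ),
        x * s.1 + s.2 = 0 ∨ x * v.1 + v.2 = 0 := by
      intro x hx
      obtain ⟨j, rfl⟩ := h hx
      have h4 := (hasDerivAt_pi.1 h3 j).deriv
      have h5 : HasDerivAt (fun z : ℂ => (ρ j * s.1 + s.2) + (ρ j * v.1 + v.2) * z)
          (ρ j * v.1 + v.2) 0 := by
        simpa using ((hasDerivAt_id (0 : ℂ)).const_mul (ρ j * v.1 + v.2)).const_add
          (ρ j * s.1 + s.2)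
      have h6 := (h5.pow d).deriv
      have h7 : (fun z : ℂ => ((fun s => powerProjection ρ d (veronese d s)) ∘
          fun z : ℂ => s + z • v) z j) =
          (fun z : ℂ => (ρ j * s.1 + s.2) + (ρ j * v.1 + v.2) * z) ^ d := by
        funext z
        simp only [Function.comp_apply, powerProjection_veronese, Pi.pow_apply, Prod.fst_add,
          Prod.snd_add, Prod.smul_fst, Prod.smul_snd, smul_eq_mul]
        ring
      rw [h7, h6, mul_zero, add_zero, Pi.zero_apply] at h4
      rcases mul_eq_zero.1 h4 with h8 | h8
      · rcases mul_eq_zero.1 h8 with h9 | h9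
        · exact absurd h9 (by exact_mod_cast hd0)
        · exact Or.inl (eq_zero_of_pow_eq_zero h9)
      · exact Or.inr h8
    have h02 : (0 : ℂ) ≠ 2 := by norm_num
    have h12 : (1 : ℂ) ≠ 2 := by norm_num
    rcases key 0 (by simp) with k0 | k0
    · have k1 := (key 1 (by simp)).resolve_left fun k => hs (eq_zero_of_affine_eq_zero zero_ne_one
        k0 k)
      have k2 := (key 2 (by simp)).resolve_left fun k => hs (eq_zero_of_affine_eq_zero h02 k0 k)
      exact eq_zero_of_affine_eq_zero h12 k1 k2
    · rcases key 1 (by simp) with k1 | k1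
      · have k2 := (key 2 (by simp)).resolve_left fun k => hs (eq_zero_of_affine_eq_zero h12 k1 k)
        exact eq_zero_of_affine_eq_zero h02 k0 k2
      · exact eq_zero_of_affine_eq_zero zero_ne_one k0 k1

theorem exists_polynomial_affinePoint (o : Option ℂ) : ∃ A B : Polynomial ℂ, A ≠ 0 ∧
    A.natDegree ≤ 1 ∧ B.natDegree ≤ 1 ∧ ∀ x w, x * (affinePoint o w).1 + (affinePoint o w).2 =
      A.eval x + B.eval x * w := by
  cases o with
  | none =>
    exact ⟨1, Polynomial.X, one_ne_zero, by simp, by simp, fun x w => by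
      simp only [affinePoint, Polynomial.eval_one, Polynomial.eval_X]
      ring⟩
  | some X =>
    exact ⟨Polynomial.X + Polynomial.C X, 1, Polynomial.X_add_C_ne_zero X, by simp, by simp,
      fun x w => by
        simp only [affinePoint, Polynomial.eval_one, Polynomial.eval_add, Polynomial.eval_X,
          Polynomial.eval_C]
        ring⟩

/-- The binary forms apolar to an osculating space of the rational normal curve are divisible by a
power of a linear form. -/
theorem exists_apolarForm_eq_mul (hd : m ≤ d) {o : Option ℂ} {A B : Polynomial ℂ}
    (hA : A.natDegree ≤ 1) (hB : B.natDegree ≤ 1)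
    (h : ∀ x w, x * (affinePoint o w).1 + (affinePoint o w).2 = A.eval x + B.eval x * w)
    {v : Fin (d + 1) → ℂ} (hv : v ∈ jetSpan (m + 1) fun w => veronese d (affinePoint o w)) :
    ∃ P : Polynomial ℂ, P.natDegree ≤ m ∧
      ∀ x, apolarForm d (veronese d (x, 1)) v = (A ^ (d - m) * P).eval x := by
  let S : Submodule ℂ (Fin (d + 1) → ℂ) :=
    { carrier := {v | ∃ P : Polynomial ℂ, P.natDegree ≤ m ∧
        ∀ x, apolarForm d (veronese d (x, 1)) v = (A ^ (d - m) * P).eval x}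
      zero_mem' := ⟨0, by simp, by simp⟩
      add_mem' := by
        rintro a b ⟨P, hP, hPa⟩ ⟨Q, hQ, hQb⟩
        exact ⟨P + Q, Polynomial.natDegree_add_le_of_degree_le hP hQ, fun x => by
          rw [map_add, hPa, hQb, mul_add, Polynomial.eval_add]⟩
      smul_mem' := by
        rintro c a ⟨P, hP, hPa⟩
        exact ⟨Polynomial.C c * P, (Polynomial.natDegree_C_mul_le c P).trans hP, fun x => by
          rw [map_smul, hPa]
          simp only [Polynomial.eval_mul, Polynomial.eval_C, smul_eq_mul]
          ring⟩ }
  suffices hS : jetSpan (m + 1) (fun w => veronese d (affinePoint o w)) ≤ S from hS hv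
  rw [jetSpan_le_iff]
  intro j hj
  -- The `j`-th derivative of `(A + B w) ^ d` at `w = 0`, with the common factor `A ^ (d - m)` split
  -- off.
  refine ⟨Polynomial.C (d.descFactorial j : ℂ) * (A ^ (m - j) * B ^ j), ?_, fun x => ?_⟩
  · refine (Polynomial.natDegree_C_mul_le _ _).trans (Polynomial.natDegree_mul_le.trans ?_)
    have h1 := Polynomial.natDegree_pow_le_of_le (m - j) hA
    have h2 := Polynomial.natDegree_pow_le_of_le j hB
    lia
  · have h1 := iteratedDeriv_clm_comp
      (LinearMap.toContinuousLinearMap (apolarForm d (veronese d (x, 1))))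
      (analyticAt_veronese_affinePoint d o 0) j
    have h2 : (fun w => LinearMap.toContinuousLinearMap (apolarForm d (veronese d (x, 1)))
        (veronese d (affinePoint o w))) = fun w => (A.eval x + B.eval x * w) ^ d := by
      funext w
      rw [LinearMap.coe_toContinuousLinearMap', apolarForm_veronese, one_mul, h]
    rw [h2, iteratedDeriv_affine_pow] at h1
    refine h1.symm.trans ?_
    simp only [Polynomial.eval_mul, Polynomial.eval_C, Polynomial.eval_pow, mul_zero, add_zero]
    have h3 : d - j = (d - m) + (m - j) := by lia
    rw [h3, pow_add]
    ring

include hρ in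
-- For a vector in both spaces, `A ^ (d - m) * P` vanishes at the `m + 2` nodes, hence so does `P *
-- A`. Its degree is at most `m + 1`, so it is zero, and the vector is apolar to all powers of
-- linear forms.
theorem disjoint_ker_powerProjection (hd : m ≤ d) (o : Option ℂ) :
    Disjoint (LinearMap.ker (powerProjection ρ d))
      (jetSpan (m + 1) fun w => veronese d (affinePoint o w)) := by
  obtain ⟨A, B, hA0, hA, hB, h⟩ := exists_polynomial_affinePoint o
  rw [Submodule.disjoint_def]
  intro v hv hvj
  obtain ⟨P, hP, hPv⟩ := exists_apolarForm_eq_mul hd hA hB h hvj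
  have h1 : P * A = 0 := by
    refine Polynomial.eq_zero_of_natDegree_lt_card_of_eval_eq_zero _ hρ (fun j => ?_) ?_
    · have h2 : apolarForm d (veronese d (ρ j, 1)) v = 0 := congrFun hv j
      rw [hPv, Polynomial.eval_mul, Polynomial.eval_pow] at h2
      rw [Polynomial.eval_mul]
      rcases mul_eq_zero.1 h2 with h3 | h3
      · rw [eq_zero_of_pow_eq_zero h3, mul_zero]
      · rw [h3, zero_mul]
    · rw [Fintype.card_fin]
      have := Polynomial.natDegree_mul_le (p := P) (q := A)
      lia
  have h2 : P = 0 := (mul_eq_zero.1 h1).resolve_right hA0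
  refine eq_zero_of_apolarForm_eq_zero none fun w => ?_
  have h3 := hPv w
  rwa [h2, mul_zero, Polynomial.eval_zero] at h3

theorem exists_injective_range_superset (hm : 2 ≤ m) : ∃ ρ : Fin (m + 2) → ℂ,
    Function.Injective ρ ∧ ({0, 1, 2, Complex.I} : Set ℂ) ⊆ Set.range ρ := by
  -- The nodes are `I` and `0, 1, …, m`; `m ≥ 2` leaves room for `2`.
  refine ⟨Fin.cons Complex.I fun j : Fin (m + 1) => ((j : ℕ) : ℂ), ?_, ?_⟩
  · rw [Fin.cons_injective_iff]
    refine ⟨?_, fun i j hij => Fin.ext (Nat.cast_injective (R := ℂ) hij)⟩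
    rintro ⟨j, hj⟩
    have := congrArg Complex.im hj
    simp at this
  · have key : ∀ n < m + 1, ((n : ℕ) : ℂ) ∈ Set.range
        (Fin.cons Complex.I fun j : Fin (m + 1) => ((j : ℕ) : ℂ) : Fin (m + 2) → ℂ) :=
      fun n hn => ⟨Fin.succ ⟨n, hn⟩, rfl⟩
    rintro x (rfl | rfl | rfl | rfl)
    · simp
    · simpa using key 1 (by lia)
    · simpa using key 2 (by lia)
    · exact ⟨0, rfl⟩

theorem exists_isProjectedRationalScroll {V : Type*} [NormedAddCommGroup V] [NormedSpace ℂ V]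
    [FiniteDimensional ℂ V] (hm : 2 ≤ m) (hd : m + 2 ≤ d)
    (hV : Module.finrank ℂ V = 2 * m + 3) :
    ∃ X : Set (Projectivization ℂ V), IsProjectedRationalScroll m d X := by
  obtain ⟨ρ, hρ, hρr⟩ := exists_injective_range_superset hm
  have e : V ≃ₗ[ℂ] (Fin (m + 1) → ℂ) × (Fin (m + 2) → ℂ) := LinearEquiv.ofFinrankEq _ _ (by
    rw [hV, Module.finrank_prod, Module.finrank_fin_fun, Module.finrank_fin_fun]
    lia)
  have hπ := surjective_powerProjection hρ (d := d) (by lia)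
  have hE := inducesEmbedding_powerProjection (d := d) (by lia) hρr
  refine ⟨(ScrollData.ofEquiv e _ hπ hE).scroll, _, hπ, hE, fun y hy => ?_, e,
    ScrollData.image_scroll_ofEquiv e _ hπ hE⟩
  obtain ⟨o, ho⟩ := exists_affinePoint_of_mem_rationalNormalCurve hy
  rw [osculatingSpace_rationalNormalCurve (by lia) m o ho]
  exact disjoint_ker_powerProjection hρ (by lia) o

end Existence

end

theorem theorem3p4 (m : ℕ) (hm : 2 ≤ m) :
    -- the classification
    (∀ (C : Type*) [TopologicalSpace C] [T2Space C] [CompactSpace C] [ConnectedSpace C]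
        [ChartedSpace ℂ C] [IsManifold 𝓘(ℂ) ω C]
        (X : Set (Projectivization ℂ (Fin (2 * m + 3) → ℂ))),
        IsDecomposableSurfaceScroll C X → inflectionalLocus (ℂ × ℂ) m X = ∅ →
        IsSemibalancedRationalNormalScroll m X ∨
          ∃ d : ℕ, m + 2 ≤ d ∧ IsProjectedRationalScroll m d X) ∧
    -- for every `d` the second type occurs, and violates the conjecture of Piene and Tai
    (∀ d : ℕ, m + 2 ≤ d →
      (∃ X : Set (Projectivization ℂ (Fin (2 * m + 3) → ℂ)), IsProjectedRationalScroll m d X) ∧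
      ∀ X : Set (Projectivization ℂ (Fin (2 * m + 3) → ℂ)), IsProjectedRationalScroll m d X →
        inflectionalLocus (ℂ × ℂ) m X = ∅ ∧
        SatisfiesPieneTaiHypotheses (2 * m + 2) X ∧
        ¬ IsSemibalancedRationalNormalScroll m X) := by
  have hV : Module.finrank ℂ (Fin (2 * m + 3) → ℂ) = 2 * m + 3 := Module.finrank_fin_fun ℂ
  refine ⟨fun C _ _ _ _ _ _ X hX hinf =>
    classification_of_inflectionalLocus_eq_empty hm hV hX hinf, fun d hd =>
    ⟨exists_isProjectedRationalScroll hm hd hV, fun X hX =>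
      ⟨hX.inflectionalLocus_eq_empty (by lia) (by lia),
        hX.satisfiesPieneTaiHypotheses (by lia) (by lia) hV,
        hX.not_isSemibalancedRationalNormalScroll (by lia) hd hV⟩⟩⟩
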